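/- **Theorem 1.1 (Hölder regularity).** Let $N\ge 2$, $\alpha\in(0,2)$, $\mathfrak C_1\ge 1$ and $\mathfrak C_2\ge 1$. There exist constants $\gamma>1$ and $\alpha_*\in(0,1)$, depending only on $\mathfrak C_1,\mathfrak C_2,N,\alpha$, with the following property. Let $E\subset\mathbb R^N$ be a bounded domain and let $(\mu(x,\cdot))_{x\in\mathbb R^N}$ be a family of Borel measures on $\mathbb R^N$. For open $D\subseteq\mathbb R^N$ write $$\mathcal E_D^\mu(u,\varphi)=\int_D\int_D (u(y)-u(x))(\varphi(y)-\varphi(x))\,\mu(x,dy)\,dx,\qquad \mathcal E^\mu=\mathcal E^\mu_{\mathbb R^N}.$$ Write $u\in H^\mu_{\rm loc}(E)$ if $u\in L^2(D)$ and $\mathcal E^\mu_D(u,u)<\infty$ for every open $D$ with $\overline D\subseteq E$, and $\varphi\in H^\mu(\mathbb R^N)$ if $\varphi\in L^2(\mathbb R^N)$ and $\mathcal E^\mu(\varphi,\varphi)<\infty$. Assume: * (S) for every Borel set $\Omega$ the function $x\mapsto\mu(x,\Omega)$ is Lebesgue measurable, and $\int_{\Omega_1}\mu(x,\Omega_2)\,dx=\int_{\Omega_2}\mu(x,\Omega_1)\,dx$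 for all disjoint Borel sets $\Omega_1,\Omega_2$; * (H$_1$) for every ball $B_\rho(x_0)\subset E$ and every $v\in H^\mu_{\rm loc}(E)$ that is integrable on $B_\rho(x_0)$, with mean value $[v]_{B_\rho(x_0)}$ there, $\int_{B_\rho(x_0)}(v-[v]_{B_\rho(x_0)})^2\,dx\le \mathfrak C_1\rho^\alpha\,\mathcal E^\mu_{B_\rho(x_0)}(v,v)$; * (H$_2$) $\mu(x_0,\mathbb R^N\setminus B_r(x_0))\le \mathfrak C_2 r^{-\alpha}$ for all $x_0\in\mathbb R^N$ and $r>0$. Let $u:\mathbb R^N\to\mathbb R$ be a local weak solution of $\mathscr Lu=\mathrm{p.v.}\int_{\mathbb R^N}(u(x)-u(y))\,\mu(x,dy)=0$ in $E$, that is: $u$ is Lebesgue measurable, $u\in H^\mu_{\rm loc}(E)$, $$\operatorname*{ess\,sup}_{x\in B_{7R/8}(x_0)}\int_{\mathbb R^N\setminus B_R(x_0)}|u(y)|\,\mu(x,dy)<\infty\quad\text{for every ball } B_R(x_0)\subset E,$$ and $\mathcal E^\mu(u,\varphi)=0$ for every non-negative $\varphi\in H^\mu(\mathbb R^N)$ with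 $\operatorname{supp}\varphi\subseteq E$. Assume moreover that $u$ is essentially bounded on every compact subset of $E$. Then $u$ is locally Hölder continuous in $E$: it coincides a.e. in $E$ with a function that is Hölder continuous with exponent $\alpha_*$ on every compact subset of $E$. More precisely, for every ball $B_R(x_0)\subset E$ and every $0<\rho<R$, $$\operatorname*{ess\,sup}_{B_\rho(x_0)}u-\operatorname*{ess\,inf}_{B_\rho(x_0)}u\le\gamma\,\omega\Big(\frac{\rho}{R}\Big)^{\alpha_*},$$ where $$\omega=2\operatorname*{ess\,sup}_{B_R(x_0)}|u|+R^\alpha\operatorname*{ess\,sup}_{x\in B_{7R/8}(x_0)}\int_{\mathbb R^N\setminus B_R(x_0)}|u(y)|\,\mu(x,dy)\in[0,\infty].$$ -/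

import Mathlib

open MeasureTheory Metric Set
open scoped ENNReal NNReal

noncomputable section

namespace NonlocalHolder

/-- Symmetry of a family `(μ(x,·))_x` of Borel measures on `ℝ^N`: `x ↦ μ(x,Ω)` is Lebesgue
measurable for every Borel set `Ω`, and `∫_{Ω₁} μ(x,Ω₂) dx = ∫_{Ω₂} μ(x,Ω₁) dx` for disjoint Borel
sets. (For functions into `[0,∞]`, `AEMeasurable` with respect to `volume` is exactly Lebesgue
measurability.) -/
structure IsSymmetricFamily {N : ℕ}
    (μ : EuclideanSpace ℝ (Fin N) → Measure (EuclideanSpace ℝ (Fin N))) : Prop where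
  measurable : ∀ Ω : Set (EuclideanSpace ℝ (Fin N)), MeasurableSet Ω →
    AEMeasurable (fun x => μ x Ω) volume
  symm : ∀ Ω₁ Ω₂ : Set (EuclideanSpace ℝ (Fin N)), MeasurableSet Ω₁ → MeasurableSet Ω₂ →
    Disjoint Ω₁ Ω₂ → ∫⁻ x in Ω₁, μ x Ω₂ = ∫⁻ x in Ω₂, μ x Ω₁

/-- The bilinear form
`𝓔(u,φ) = ∫_{ℝ^N} ∫_{ℝ^N} (u(y) - u(x)) (φ(y) - φ(x)) μ(x,dy) dx`. -/
def bilinForm {N : ℕ} (μ : EuclideanSpace ℝ (Fin N) → Measure (EuclideanSpace ℝ (Fin N)))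
    (u φ : EuclideanSpace ℝ (Fin N) → ℝ) : ℝ :=
  ∫ x, ∫ y, (u y - u x) * (φ y - φ x) ∂(μ x)

/-- The quadratic form `𝓔_D(u,u) = ∫_D ∫_D (u(y) - u(x))² μ(x,dy) dx`, with values in `[0,∞]`. -/
def quadForm {N : ℕ} (μ : EuclideanSpace ℝ (Fin N) → Measure (EuclideanSpace ℝ (Fin N)))
    (D : Set (EuclideanSpace ℝ (Fin N))) (u : EuclideanSpace ℝ (Fin N) → ℝ) : ℝ≥0∞ :=
  ∫⁻ x in D, ∫⁻ y in D, ENNReal.ofReal ((u y - u x) ^ 2) ∂(μ x)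

/-- `u ∈ H^μ_loc(E)`: for every open `D` whose closure lies in `E`, `u ∈ L²(D)` (the domain of the
form on `D`) and `𝓔_D(u,u) < ∞`. -/
def MemHLoc {N : ℕ} (μ : EuclideanSpace ℝ (Fin N) → Measure (EuclideanSpace ℝ (Fin N)))
    (E : Set (EuclideanSpace ℝ (Fin N))) (u : EuclideanSpace ℝ (Fin N) → ℝ) : Prop :=
  ∀ D : Set (EuclideanSpace ℝ (Fin N)), IsOpen D → closure D ⊆ E →
    MemLp u 2 (volume.restrict D) ∧ quadForm μ D u < ∞

/-- `u ∈ H^μ(ℝ^N)`: `u ∈ L²(ℝ^N)` and `𝓔(u,u) < ∞`. -/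
def MemH {N : ℕ} (μ : EuclideanSpace ℝ (Fin N) → Measure (EuclideanSpace ℝ (Fin N)))
    (u : EuclideanSpace ℝ (Fin N) → ℝ) : Prop :=
  MemLp u 2 volume ∧ quadForm μ univ u < ∞

/-- The nonlocal tail `r₂^α · ess sup_{x ∈ B_{r₁}(x₀)} ∫_{ℝ^N ∖ B_{r₂}(x₀)} f(y) μ(x,dy)` of a
non-negative function `f`, with values in `[0,∞]`. -/
def tail {N : ℕ} (μ : EuclideanSpace ℝ (Fin N) → Measure (EuclideanSpace ℝ (Fin N))) (α : ℝ)
    (f : EuclideanSpace ℝ (Fin N) → ℝ) (x₀ : EuclideanSpace ℝ (Fin N)) (r₁ r₂ : ℝ) : ℝ≥0∞ :=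
  ENNReal.ofReal (r₂ ^ α) *
    essSup (fun x => ∫⁻ y in (ball x₀ r₂)ᶜ, ENNReal.ofReal (f y) ∂(μ x))
      (volume.restrict (ball x₀ r₁))

/-- What sub- and super-solutions have in common: Lebesgue measurability on `ℝ^N`, membership in
`H^μ_loc(E)`, and finiteness of the tail integrals over `ℝ^N ∖ B_R(x₀)`, essentially uniformly in
`x ∈ B_{7R/8}(x₀)`, for all balls `B_R(x₀) ⊆ E`. -/
structure IsAdmissible {N : ℕ}
    (μ : EuclideanSpace ℝ (Fin N) → Measure (EuclideanSpace ℝ (Fin N)))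
    (E : Set (EuclideanSpace ℝ (Fin N))) (u : EuclideanSpace ℝ (Fin N) → ℝ) : Prop where
  measurable : AEMeasurable u volume
  memHLoc : MemHLoc μ E u
  tail_lt_top : ∀ (x₀ : EuclideanSpace ℝ (Fin N)) (R : ℝ), 0 < R → ball x₀ R ⊆ E →
    essSup (fun x => ∫⁻ y in (ball x₀ R)ᶜ, ENNReal.ofReal |u y| ∂(μ x))
      (volume.restrict (ball x₀ (7 / 8 * R))) < ∞

/-- Local weak sub-solutions of `𝓛u = 0` in `E`. -/
def IsLocalWeakSubsolution {N : ℕ}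
    (μ : EuclideanSpace ℝ (Fin N) → Measure (EuclideanSpace ℝ (Fin N)))
    (E : Set (EuclideanSpace ℝ (Fin N))) (u : EuclideanSpace ℝ (Fin N) → ℝ) : Prop :=
  IsAdmissible μ E u ∧
    ∀ φ : EuclideanSpace ℝ (Fin N) → ℝ, MemH μ φ → (∀ x, 0 ≤ φ x) → tsupport φ ⊆ E →
      bilinForm μ u φ ≤ 0

/-- Local weak super-solutions of `𝓛u = 0` in `E`. -/
def IsLocalWeakSupersolution {N : ℕ}
    (μ : EuclideanSpace ℝ (Fin N) → Measure (EuclideanSpace ℝ (Fin N)))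
    (E : Set (EuclideanSpace ℝ (Fin N))) (u : EuclideanSpace ℝ (Fin N) → ℝ) : Prop :=
  IsAdmissible μ E u ∧
    ∀ φ : EuclideanSpace ℝ (Fin N) → ℝ, MemH μ φ → (∀ x, 0 ≤ φ x) → tsupport φ ⊆ E →
      0 ≤ bilinForm μ u φ

/-- Local weak solutions of `𝓛u = 0` in `E`. -/
def IsLocalWeakSolution {N : ℕ}
    (μ : EuclideanSpace ℝ (Fin N) → Measure (EuclideanSpace ℝ (Fin N)))
    (E : Set (EuclideanSpace ℝ (Fin N))) (u : EuclideanSpace ℝ (Fin N) → ℝ) : Prop :=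
  IsLocalWeakSubsolution μ E u ∧ IsLocalWeakSupersolution μ E u

/-- The Poincaré-type inequality on balls `B_ρ(x₀) ⊆ E` for `v ∈ H^μ_loc(E)`. Integrability of `v`
on the ball is asked for so that its mean value makes sense; it is automatic if the closed ball
lies in `E`. -/
def PoincareInequality {N : ℕ}
    (μ : EuclideanSpace ℝ (Fin N) → Measure (EuclideanSpace ℝ (Fin N)))
    (E : Set (EuclideanSpace ℝ (Fin N))) (α C₁ : ℝ) : Prop :=
  ∀ (x₀ : EuclideanSpace ℝ (Fin N)) (ρ : ℝ), 0 < ρ → ball x₀ ρ ⊆ E →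
    ∀ v : EuclideanSpace ℝ (Fin N) → ℝ, MemHLoc μ E v → IntegrableOn v (ball x₀ ρ) volume →
      ∫⁻ x in ball x₀ ρ, ENNReal.ofReal ((v x - ⨍ z in ball x₀ ρ, v z) ^ 2) ≤
        ENNReal.ofReal (C₁ * ρ ^ α) * quadForm μ (ball x₀ ρ) v

/-- The decay condition `μ(x₀, ℝ^N ∖ B_r(x₀)) ≤ C₂ / r^α` for all `x₀` and all `r > 0`. -/
def DecayBound {N : ℕ}
    (μ : EuclideanSpace ℝ (Fin N) → Measure (EuclideanSpace ℝ (Fin N))) (α C₂ : ℝ) : Prop :=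
  ∀ (x₀ : EuclideanSpace ℝ (Fin N)) (r : ℝ), 0 < r →
    μ x₀ (ball x₀ r)ᶜ ≤ ENNReal.ofReal (C₂ / r ^ α)

/-- `u` is (essentially) bounded on every compact subset of `E`. -/
def IsLocallyBounded {N : ℕ} (E : Set (EuclideanSpace ℝ (Fin N)))
    (u : EuclideanSpace ℝ (Fin N) → ℝ) : Prop :=
  ∀ K : Set (EuclideanSpace ℝ (Fin N)), IsCompact K → K ⊆ E →
    ∃ M : ℝ, ∀ᵐ x ∂(volume.restrict K), |u x| ≤ M

/-- The (essential) oscillation `ess sup_B u - ess inf_B u`, as an extended real. -/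
def essOsc {N : ℕ} (u : EuclideanSpace ℝ (Fin N) → ℝ) (B : Set (EuclideanSpace ℝ (Fin N))) :
    EReal :=
  essSup (fun x => (u x : EReal)) (volume.restrict B) -
    essInf (fun x => (u x : EReal)) (volume.restrict B)

/-- `ω = 2 ess sup_{B_R(x₀)} |u| + Tail(|u|; x₀, 7R/8, R)`, with values in `[0,∞]`. -/
def omega {N : ℕ} (μ : EuclideanSpace ℝ (Fin N) → Measure (EuclideanSpace ℝ (Fin N))) (α : ℝ)
    (u : EuclideanSpace ℝ (Fin N) → ℝ) (x₀ : EuclideanSpace ℝ (Fin N)) (R : ℝ) : ℝ≥0∞ :=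
  2 * essSup (fun x => ENNReal.ofReal |u x|) (volume.restrict (ball x₀ R)) +
    tail μ α (fun y => |u y|) x₀ (7 / 8 * R) R

end NonlocalHolder

end

/-! The proof is De Giorgi's method for a nonlocal form whose jump measures need have no density.
All double integrals are carried out against a symmetric measure `J` on the product space,
representing `μ(x,dy) dx` off the diagonal; (S) and (H₂) suffice to construct it
(`exists_isJumpMeasure`).

For a solution `w` that is non-negative on a ball, testing with `η² G(w)` and bounding the integrand
pointwise (`energy_estimate`) gives two inequalities. With `G(w) = (k - w)₊` it is the Caccioppoli
estimate; with `G(w) = 1/(w + d)` it bounds the energy of the truncated logarithm `(-log(w + d))₊`.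
In both, what happens outside the ball enters only through the negative part of `w`, which is the
one quantitative tail.

No Sobolev inequality is assumed. Instead, the Poincaré inequality on balls of a small radius `s`,
averaged over all centres, yields `faberKrahn`: energy times `s^α`, plus an error quadratic in the
measure of the support. Choosing `s` anew at each step makes the De Giorgi iteration converge, so a
sublevel set `{w < d}` of small measure forces `w ≥ d/2` on a smaller ball
(`exists_deGiorgi_threshold`). If `w ≥ 1` on half of a ball, the logarithm vanishes there, and
Poincaré together with the logarithmic estimate makes `{w < d}` small once `d` is small; hence
positivity expands (`exists_growth_const`).

Applied to `u - inf u` or `sup u - u`, suitably normalised, this reduces the oscillation by a factor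
`1 - κ` when the radius shrinks by `8`. The tails of the excess of `u` beyond its current range are
propagated along with the bounds, since the factor `8^α` gained by rescaling outweighs what the
shrinking range adds. Iteration gives the power decay, and decay at every centre gives the Hölder
representative. -/

namespace NonlocalHolder

open ProbabilityTheory

/-! ### The jump measure on the product space -/

/-- A uniformly bounded family of measures that is almost everywhere measurable on each measurable
set agrees almost everywhere with a finite kernel. -/
theorem exists_kernel_ae_eq {α β : Type*} [MeasurableSpace α] [MeasurableSpace β]
    [MeasurableSpace.CountablyGenerated β] {m : Measure α} {ν : α → Measure β} {C : ℝ≥0∞}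
    (hC : C < ∞) (hν : ∀ x, ν x univ ≤ C)
    (hm : ∀ s, MeasurableSet s → AEMeasurable (fun x => ν x s) m) :
    ∃ κ : Kernel α β, IsFiniteKernel κ ∧ ∀ᵐ x ∂m, κ x = ν x := by
  classical
  set S : Set (Set β) := generateSetAlgebra (MeasurableSpace.countableGeneratingSet β) with hS
  have hSc : S.Countable :=
    countable_generateSetAlgebra (MeasurableSpace.countable_countableGeneratingSet (α := β))
  have hgen : ‹MeasurableSpace β› = .generateFrom S := by
    rw [hS, generateFrom_generateSetAlgebra_eq, MeasurableSpace.generateFrom_countableGeneratingSet]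
  have hSm : ∀ s ∈ S, MeasurableSet s := fun s hs => by
    rw [hgen]; exact MeasurableSpace.measurableSet_generateFrom hs
  have hpi : IsPiSystem S := fun s hs t ht _ =>
    (isSetAlgebra_generateSetAlgebra (𝒜 := MeasurableSpace.countableGeneratingSet β)).inter_mem hs ht
  -- Countability of the generating algebra puts all exceptional points into one null set. With the
  -- kernel set to zero there, measurability on this π-system extends to the whole σ-algebra.
  have hae : ∀ᵐ x ∂m, ∀ s : S, ν x s = (hm s (hSm s s.2)).mk _ x := by
    have : Countable S := hSc
    exact ae_all_iff.2 fun s => (hm s (hSm s s.2)).ae_eq_mk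
  obtain ⟨Z, hZsub, hZm, hZ0⟩ := exists_measurable_superset_of_null (ae_iff.1 hae)
  have huniv : univ ∈ S :=
    (isSetAlgebra_generateSetAlgebra (𝒜 := MeasurableSpace.countableGeneratingSet β)).univ_mem
  have hval : ∀ s ∈ S, Measurable fun x => (if x ∈ Z then (0 : Measure β) else ν x) s := by
    intro s hs
    have : (fun x => (if x ∈ Z then (0 : Measure β) else ν x) s) =
        fun x => if x ∈ Z then 0 else (hm s (hSm s hs)).mk _ x := by
      funext x
      by_cases hx : x ∈ Z
      · simp [hx]
      · have h := not_not.1 (fun h => hx (hZsub h)) ⟨s, hs⟩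
        simpa [hx] using h
    rw [this]
    exact Measurable.ite hZm measurable_const (hm s (hSm s hs)).measurable_mk
  have hfin : ∀ x, (if x ∈ Z then (0 : Measure β) else ν x) univ ≤ C := by
    intro x
    by_cases hx : x ∈ Z <;> simp [hx, hν x]
  have : ∀ x, IsFiniteMeasure (if x ∈ Z then (0 : Measure β) else ν x) :=
    fun x => ⟨(hfin x).trans_lt hC⟩
  refine ⟨⟨fun x => if x ∈ Z then 0 else ν x,
    Measurable.measure_of_isPiSystem hgen hpi hval (hval _ huniv)⟩, ⟨C, hC, hfin⟩, ?_⟩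
  filter_upwards [compl_mem_ae_iff.2 hZ0] with x hx
  have : x ∉ Z := hx
  change (if x ∈ Z then (0 : Measure β) else ν x) = ν x
  simp [this]

variable {N : ℕ} {μ : EuclideanSpace ℝ (Fin N) → Measure (EuclideanSpace ℝ (Fin N))} {α C₂ : ℝ}

/-- The complement of the diagonal is a countable union of rectangles `U × V` with `U` a ball and
`V` at positive distance from `U`. -/
theorem exists_offDiag_cover (X : Type*) [PseudoMetricSpace X] [SecondCountableTopology X]
    [Nonempty X] :
    ∃ (p : ℕ → X) (ε : ℕ → ℝ), (∀ i, 0 < ε i) ∧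
      ∀ x y : X, 0 < dist x y → ∃ i, x ∈ ball (p i) (ε i) ∧ y ∉ ball (p i) (2 * ε i) := by
  refine ⟨fun i => TopologicalSpace.denseSeq X i.unpair.1, fun i => 1 / ((i.unpair.2 : ℝ) + 1),
    fun i => by positivity, fun x y hxy => ?_⟩
  -- With `ε` below a third of the distance, moving from `x` to the centre costs less than `ε`,
  -- which leaves `y` more than `2ε` away from the centre.
  obtain ⟨n, hn⟩ := exists_nat_one_div_lt (show 0 < dist x y / 3 by positivity)
  obtain ⟨k, hk⟩ := (TopologicalSpace.denseRange_denseSeq X).exists_dist_lt x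
    (show (0 : ℝ) < 1 / ((n : ℝ) + 1) by positivity)
  refine ⟨Nat.pair k n, ?_, ?_⟩
  · simpa [mem_ball] using hk
  · simp only [Nat.unpair_pair, mem_ball]
    have := dist_triangle x (TopologicalSpace.denseSeq X k) y
    rw [dist_comm (TopologicalSpace.denseSeq X k) y] at this
    intro h
    linarith

/-- The family `x ↦ μ(x, · ∖ {x})` agrees almost everywhere with an s-finite kernel. -/
theorem exists_sFinite_kernel (hs : IsSymmetricFamily μ) (hd : DecayBound μ α C₂) :
    ∃ κ : Kernel (EuclideanSpace ℝ (Fin N)) (EuclideanSpace ℝ (Fin N)), IsSFiniteKernel κ ∧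
      ∀ᵐ x ∂(volume : Measure (EuclideanSpace ℝ (Fin N))), κ x = (μ x).restrict {x}ᶜ := by
  classical
  obtain ⟨p, ε, hε, hcov⟩ := exists_offDiag_cover (EuclideanSpace ℝ (Fin N))
  set U : ℕ → Set (EuclideanSpace ℝ (Fin N)) := fun i => ball (p i) (ε i)
  set V : ℕ → Set (EuclideanSpace ℝ (Fin N)) := fun i => (ball (p i) (2 * ε i))ᶜ
  have hUV : ∀ i, ∀ x ∈ U i, V i ⊆ (ball x (ε i))ᶜ := by
    intro i x hx y hy
    simp only [U, V, mem_ball, mem_compl_iff, not_lt] at *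
    have := dist_triangle y x (p i)
    linarith
  -- `μ x` may have infinite mass near `x`, but `V i` stays at distance at least `ε i` from every `x
  -- ∈ U i`, so the decay bound makes each piece uniformly finite.
  have key : ∀ i, ∃ κ : Kernel (EuclideanSpace ℝ (Fin N)) (EuclideanSpace ℝ (Fin N)),
      IsFiniteKernel κ ∧ ∀ᵐ x ∂(volume : Measure (EuclideanSpace ℝ (Fin N))),
        κ x = if x ∈ U i then (μ x).restrict (V i) else 0 := by
    intro i
    refine exists_kernel_ae_eq (C := ENNReal.ofReal (C₂ / ε i ^ α)) ENNReal.ofReal_lt_top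
      (fun x => ?_) (fun s hsm => ?_)
    · by_cases hx : x ∈ U i
      · simp only [hx, if_true, Measure.restrict_apply_univ]
        exact (measure_mono (hUV i x hx)).trans (hd x (ε i) (hε i))
      · simp [hx]
    · have : (fun x => (if x ∈ U i then (μ x).restrict (V i) else 0) s) =
          (U i).indicator fun x => μ x (s ∩ V i) := by
        funext x
        by_cases hx : x ∈ U i <;> simp [hx, Measure.restrict_apply hsm]
      rw [this]
      exact (hs.measurable _ (hsm.inter measurableSet_ball.compl)).indicator measurableSet_ball
  choose κ hκf hκ using key
  -- The rectangles overlap; they are made disjoint so that summing the pieces counts no mass twice.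
  set S : ℕ → Set (EuclideanSpace ℝ (Fin N) × EuclideanSpace ℝ (Fin N)) :=
    disjointed fun i => U i ×ˢ V i
  have hSm : ∀ i, MeasurableSet (S i) :=
    fun i => MeasurableSet.disjointed (fun i => measurableSet_ball.prod measurableSet_ball.compl) i
  set f : ℕ → EuclideanSpace ℝ (Fin N) → EuclideanSpace ℝ (Fin N) → ℝ≥0∞ :=
    fun i x y => (S i).indicator 1 (x, y) with hf
  have hfm : ∀ i, Measurable (Function.uncurry (f i)) :=
    fun i => (measurable_one.indicator (hSm i) : Measurable ((S i).indicator 1))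
  have hκs : ∀ i, IsSFiniteKernel (Kernel.withDensity (κ i) (f i)) := fun i =>
    Kernel.isSFiniteKernel_withDensity_of_isFiniteKernel _ fun a b => by
      simp only [hf, indicator]; split_ifs <;> simp
  refine ⟨Kernel.sum fun i => Kernel.withDensity (κ i) (f i), Kernel.isSFiniteKernel_sum (hκs := hκs), ?_⟩
  filter_upwards [ae_all_iff.2 hκ] with x hx
  have hsec : ⋃ i, Prod.mk x ⁻¹' (S i) = {x}ᶜ := by
    rw [← preimage_iUnion, iUnion_disjointed]
    ext y
    simp only [mem_preimage, mem_iUnion, mem_prod, mem_compl_iff, mem_singleton_iff]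
    constructor
    · rintro ⟨i, h1, h2⟩ rfl
      exact hUV i y h1 h2 (mem_ball_self (hε i))
    · intro hxy
      exact hcov x y (dist_pos.2 (Ne.symm hxy))
  have hsecm : ∀ i, MeasurableSet (Prod.mk x ⁻¹' (S i)) := fun i => measurable_prodMk_left (hSm i)
  have hdisj : Pairwise (Function.onFun Disjoint fun i => Prod.mk x ⁻¹' (S i)) :=
    fun i j hij => (disjoint_disjointed _ hij).preimage _
  rw [Kernel.sum_apply, ← hsec, Measure.restrict_iUnion hdisj hsecm]
  congr 1
  funext i
  rw [Kernel.withDensity_apply _ (hfm i), hx i]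
  have hfi : f i x = (Prod.mk x ⁻¹' (S i)).indicator 1 := rfl
  rw [hfi, withDensity_indicator_one (hsecm i)]
  have hsub : S i ⊆ U i ×ˢ V i := disjointed_subset _ i
  by_cases hxU : x ∈ U i
  · rw [if_pos hxU, Measure.restrict_restrict (hsecm i)]
    congr 1
    exact inter_eq_left.2 fun y hy => (hsub hy).2
  · rw [if_neg hxU, Measure.restrict_zero]
    have : Prod.mk x ⁻¹' (S i) = ∅ := by
      ext y; simp only [mem_preimage, mem_empty_iff_false, iff_false]
      exact fun hy => hxU (hsub hy).1
    rw [this, Measure.restrict_empty]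

/-- For almost every `x`, the measure `μ(x, · ∖ {x})` does not charge a given null set. -/
theorem ae_measure_null_diff (hs : IsSymmetricFamily μ) {Z : Set (EuclideanSpace ℝ (Fin N))}
    (hZ : volume Z = 0) : ∀ᵐ x ∂(volume : Measure (EuclideanSpace ℝ (Fin N))), μ x Z = 0 := by
  obtain ⟨Z', hsub, hm, h0⟩ := exists_measurable_superset_of_null hZ
  -- By symmetry, the mass sent from `Z'ᶜ` into `Z'` equals an integral over the null set `Z'`.
  have h := hs.symm Z'ᶜ Z' hm.compl hm disjoint_compl_left
  rw [Measure.restrict_eq_zero.2 h0, lintegral_zero_measure,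
    lintegral_eq_zero_iff' (hs.measurable _ hm).restrict,
    Filter.EventuallyEq, ae_restrict_iff' hm.compl] at h
  filter_upwards [h, compl_mem_ae_iff.2 h0] with x hx hx'
  exact measure_mono_null hsub (hx hx')

/-- The measure `μ(x,dy) dx` off the diagonal of the product space. -/
structure IsJumpMeasure (μ : EuclideanSpace ℝ (Fin N) → Measure (EuclideanSpace ℝ (Fin N)))
    (J : Measure (EuclideanSpace ℝ (Fin N) × EuclideanSpace ℝ (Fin N))) : Prop where
  sFinite : SFinite J
  lintegral_eq : ∀ f : EuclideanSpace ℝ (Fin N) × EuclideanSpace ℝ (Fin N) → ℝ≥0∞,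
    AEMeasurable f J → ∫⁻ z, f z ∂J = ∫⁻ x, ∫⁻ y in {x}ᶜ, f (x, y) ∂(μ x)
  integral_eq : ∀ f : EuclideanSpace ℝ (Fin N) × EuclideanSpace ℝ (Fin N) → ℝ,
    Integrable f J → ∫ z, f z ∂J = ∫ x, ∫ y in {x}ᶜ, f (x, y) ∂(μ x)
  swap : MeasurePreserving Prod.swap J J
  fst : Measure.QuasiMeasurePreserving Prod.fst J volume
  snd : Measure.QuasiMeasurePreserving Prod.snd J volume

/-- The measure is `volume ⊗ₘ κ` with the s-finite kernel above. Symmetry is known only for disjoint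
sets, but that is enough: the diagonal is `J`-null, and its complement is covered by rectangles with
disjoint sides and finite mass, on which a measure is determined by its values on products. -/
theorem exists_isJumpMeasure (hs : IsSymmetricFamily μ) (hd : DecayBound μ α C₂) :
    ∃ J, IsJumpMeasure μ J := by
  obtain ⟨κ, hκs, hκ⟩ := exists_sFinite_kernel hs hd
  set J : Measure (EuclideanSpace ℝ (Fin N) × EuclideanSpace ℝ (Fin N)) := volume ⊗ₘ κ
  have hlint : ∀ f : EuclideanSpace ℝ (Fin N) × EuclideanSpace ℝ (Fin N) → ℝ≥0∞,
      AEMeasurable f J → ∫⁻ z, f z ∂J = ∫⁻ x, ∫⁻ y in {x}ᶜ, f (x, y) ∂(μ x) := by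
    intro f hf
    rw [lintegral_congr_ae hf.ae_eq_mk, Measure.lintegral_compProd hf.measurable_mk]
    refine lintegral_congr_ae ?_
    filter_upwards [hκ, Measure.ae_ae_of_ae_compProd hf.ae_eq_mk] with x hx hx'
    rw [← hx]
    exact lintegral_congr_ae (hx'.mono fun y hy => hy.symm)
  have hrect : ∀ A B : Set (EuclideanSpace ℝ (Fin N)), MeasurableSet A → MeasurableSet B →
      Disjoint A B → J (A ×ˢ B) = ∫⁻ x in A, μ x B := by
    intro A B hA hB hAB
    rw [← lintegral_indicator_one (hA.prod hB),
      hlint _ (measurable_one.indicator (hA.prod hB)).aemeasurable, ← lintegral_indicator hA]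
    refine lintegral_congr fun x => ?_
    by_cases hx : x ∈ A
    · have hfun : (fun y => (A ×ˢ B : Set (_ × _)).indicator (fun _ => (1 : ℝ≥0∞)) (x, y)) = B.indicator 1 := by
        funext y
        by_cases hy : y ∈ B
        · rw [indicator_of_mem hy, indicator_of_mem (mk_mem_prod hx hy)]; rfl
        · rw [indicator_of_notMem hy, indicator_of_notMem fun h => hy h.2]
      change ∫⁻ y in {x}ᶜ, (A ×ˢ B : Set (_ × _)).indicator (fun _ => (1 : ℝ≥0∞)) (x, y) ∂(μ x) = _
      rw [hfun, lintegral_indicator_one hB, indicator_of_mem hx,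
        Measure.restrict_apply hB]
      congr 1
      exact inter_eq_left.2 fun y hy h => hAB.ne_of_mem hx hy (Eq.symm h)
    · simp [indicator, hx]
  have hdiag : J {z | z.1 = z.2} = 0 := by
    have hm : MeasurableSet {z : EuclideanSpace ℝ (Fin N) × EuclideanSpace ℝ (Fin N) | z.1 = z.2} :=
      measurableSet_eq_fun measurable_fst measurable_snd
    rw [← lintegral_indicator_one hm, hlint _ (measurable_one.indicator hm).aemeasurable]
    have : ∀ x : EuclideanSpace ℝ (Fin N), ∫⁻ y in {x}ᶜ, ({z : EuclideanSpace ℝ (Fin N) ×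
        EuclideanSpace ℝ (Fin N) | z.1 = z.2}).indicator (fun _ => (1 : ℝ≥0∞)) (x, y) ∂(μ x) = 0 := by
      intro x
      rw [setLIntegral_congr_fun (g := 0) (measurableSet_singleton x).compl]
      · simp
      · intro y hy
        have : x ≠ y := fun h => hy h.symm
        simp [indicator, this]
    exact (lintegral_congr this).trans lintegral_zero
  have hswap : J.map Prod.swap = J := by
    obtain ⟨p, ε, hε, hcov⟩ := exists_offDiag_cover (EuclideanSpace ℝ (Fin N))
    set S : Option ℕ → Set (EuclideanSpace ℝ (Fin N) × EuclideanSpace ℝ (Fin N)) := fun i =>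
      i.elim {z | z.1 = z.2} fun i => ball (p i) (ε i) ×ˢ (ball (p i) (2 * ε i))ᶜ with hS
    refine Measure.ext_of_iUnion_eq_univ (s := S) ?_ ?_
    · refine eq_univ_of_forall fun z => mem_iUnion.2 ?_
      by_cases hz : z.1 = z.2
      · exact ⟨none, hz⟩
      · obtain ⟨i, h1, h2⟩ := hcov z.1 z.2 (dist_pos.2 hz)
        exact ⟨some i, h1, h2⟩
    · rintro (_ | i)
      · have h1 : J.restrict {z | z.1 = z.2} = 0 := Measure.restrict_eq_zero.2 hdiag
        have h2 : (J.map Prod.swap).restrict {z | z.1 = z.2} = 0 := by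
          rw [Measure.restrict_eq_zero, Measure.map_apply measurable_swap
            (measurableSet_eq_fun measurable_fst measurable_snd), ← hdiag]
          congr 1
          ext z
          exact eq_comm
        exact h2.trans h1.symm
      · set A := ball (p i) (ε i)
        set B := (ball (p i) (2 * ε i))ᶜ
        have hA : MeasurableSet A := measurableSet_ball
        have hB : MeasurableSet B := measurableSet_ball.compl
        have hAB : Disjoint A B :=
          disjoint_compl_right_iff_subset.2 (ball_subset_ball (by linarith [hε i]))
        have hfin : J (A ×ˢ B) < ∞ := by
          rw [hrect A B hA hB hAB]
          calc ∫⁻ x in A, μ x B ≤ ∫⁻ x in A, ENNReal.ofReal (C₂ / ε i ^ α) := by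
                refine setLIntegral_mono measurable_const fun x hx => ?_
                refine (measure_mono ?_).trans (hd x (ε i) (hε i))
                intro y hy
                simp only [A, B, mem_ball, mem_compl_iff, not_lt] at *
                have := dist_triangle y x (p i)
                linarith
            _ < ∞ := by
                rw [setLIntegral_const]
                exact ENNReal.mul_lt_top ENNReal.ofReal_lt_top measure_ball_lt_top
        change (J.map Prod.swap).restrict (A ×ˢ B) = J.restrict (A ×ˢ B)
        have hpair : ∀ s t : Set (EuclideanSpace ℝ (Fin N)), MeasurableSet s → MeasurableSet t →
            ((J.map Prod.swap).restrict (A ×ˢ B)) (s ×ˢ t) = (J.restrict (A ×ˢ B)) (s ×ˢ t) := by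
          intro s t hs' ht
          rw [Measure.restrict_apply (hs'.prod ht), Measure.restrict_apply (hs'.prod ht),
            prod_inter_prod, Measure.map_apply measurable_swap ((hs'.inter hA).prod (ht.inter hB)),
            preimage_swap_prod]
          have hd' : Disjoint (s ∩ A) (t ∩ B) := hAB.mono inter_subset_right inter_subset_right
          rw [hrect _ _ (ht.inter hB) (hs'.inter hA) hd'.symm,
            hrect _ _ (hs'.inter hA) (ht.inter hB) hd',
            hs.symm _ _ (ht.inter hB) (hs'.inter hA) hd'.symm]
        have : IsFiniteMeasure ((J.map Prod.swap).restrict (A ×ˢ B)) := by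
          refine ⟨?_⟩
          have := hpair univ univ .univ .univ
          rw [univ_prod_univ] at this
          rw [this, Measure.restrict_apply_univ]
          exact hfin
        exact Measure.ext_prod fun hs' ht => hpair _ _ hs' ht
  have hfst : Measure.QuasiMeasurePreserving Prod.fst J volume := by
    refine ⟨measurable_fst, Measure.AbsolutelyContinuous.mk fun Z hZ h0 => ?_⟩
    rw [Measure.map_apply measurable_fst hZ, ← lintegral_indicator_one (measurable_fst hZ),
      hlint _ (measurable_one.indicator (measurable_fst hZ)).aemeasurable]
    refine (lintegral_eq_zero_of_ae_eq_zero ?_)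
    filter_upwards [compl_mem_ae_iff.2 h0] with x hx
    have : x ∉ Z := hx
    simp [indicator, this]
  refine ⟨J, inferInstance, hlint, ?_, ⟨measurable_swap, hswap⟩, hfst, ?_⟩
  · intro f hf
    rw [Measure.integral_compProd hf]
    refine integral_congr_ae ?_
    filter_upwards [hκ] with x hx
    rw [hx]
  · have : (Prod.snd : EuclideanSpace ℝ (Fin N) × EuclideanSpace ℝ (Fin N) → _) =
        Prod.fst ∘ Prod.swap := rfl
    rw [this]
    exact hfst.comp (MeasurePreserving.quasiMeasurePreserving ⟨measurable_swap, hswap⟩)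

end NonlocalHolder

/-! ### Integration and symmetrisation against the jump measure -/

namespace NonlocalHolder

/-- Euclidean space. -/
abbrev Space (N : ℕ) := EuclideanSpace ℝ (Fin N)

variable {N : ℕ} {μ : Space N → Measure (Space N)} {α C₁ C₂ : ℝ}
  {J : Measure (Space N × Space N)}

namespace IsJumpMeasure

theorem aemeasurable_comp_fst {β : Type*} [MeasurableSpace β] (hJ : IsJumpMeasure μ J)
    {u : Space N → β} (hu : AEMeasurable u volume) : AEMeasurable (fun z => u z.1) J :=
  hu.comp_quasiMeasurePreserving hJ.fst

theorem aemeasurable_comp_snd {β : Type*} [MeasurableSpace β] (hJ : IsJumpMeasure μ J)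
    {u : Space N → β} (hu : AEMeasurable u volume) : AEMeasurable (fun z => u z.2) J :=
  hu.comp_quasiMeasurePreserving hJ.snd

theorem ae_fst (hJ : IsJumpMeasure μ J) {p : Space N → Prop} (hp : ∀ᵐ x, p x) :
    ∀ᵐ z ∂J, p z.1 := hJ.fst.ae hp

theorem ae_snd (hJ : IsJumpMeasure μ J) {p : Space N → Prop} (hp : ∀ᵐ x, p x) :
    ∀ᵐ z ∂J, p z.2 := hJ.snd.ae hp

theorem setLIntegral_prod (hJ : IsJumpMeasure μ J) {A B : Set (Space N)} (hA : MeasurableSet A)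
    (hB : MeasurableSet B) {f : Space N × Space N → ℝ≥0∞} (hf : AEMeasurable f J) :
    ∫⁻ z in A ×ˢ B, f z ∂J = ∫⁻ x in A, ∫⁻ y in B \ {x}, f (x, y) ∂(μ x) := by
  rw [← lintegral_indicator (hA.prod hB), hJ.lintegral_eq _ (hf.indicator (hA.prod hB)),
    ← lintegral_indicator hA]
  refine lintegral_congr fun x => ?_
  by_cases hx : x ∈ A
  · rw [indicator_of_mem hx, ← lintegral_indicator (measurableSet_singleton x).compl,
      ← lintegral_indicator (hB.diff (measurableSet_singleton x))]
    refine lintegral_congr fun y => ?_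
    by_cases hy : y ∈ B <;> by_cases hyx : y = x <;> simp [indicator, hx, hy, hyx]
  · simp [indicator, hx]

theorem aemeasurable_sq_sub (hJ : IsJumpMeasure μ J) {v : Space N → ℝ}
    (hv : AEMeasurable v volume) :
    AEMeasurable (fun z : Space N × Space N => ENNReal.ofReal ((v z.2 - v z.1) ^ 2)) J :=
  (((hJ.aemeasurable_comp_snd hv).sub (hJ.aemeasurable_comp_fst hv)).pow_const 2).ennreal_ofReal

theorem quadForm_eq (hJ : IsJumpMeasure μ J) {D : Set (Space N)} (hD : MeasurableSet D)
    {v : Space N → ℝ} (hv : AEMeasurable v volume) :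
    quadForm μ D v = ∫⁻ z in D ×ˢ D, ENNReal.ofReal ((v z.2 - v z.1) ^ 2) ∂J := by
  rw [hJ.setLIntegral_prod hD hD (hJ.aemeasurable_sq_sub hv), quadForm]
  refine lintegral_congr fun x => ?_
  rw [← lintegral_indicator hD, ← lintegral_indicator (hD.diff (measurableSet_singleton x))]
  refine lintegral_congr fun y => ?_
  by_cases hy : y ∈ D <;> by_cases hyx : y = x <;> simp [indicator, hy, hyx]

theorem quadForm_univ_eq (hJ : IsJumpMeasure μ J) {v : Space N → ℝ}
    (hv : AEMeasurable v volume) :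
    quadForm μ univ v = ∫⁻ z, ENNReal.ofReal ((v z.2 - v z.1) ^ 2) ∂J := by
  rw [hJ.quadForm_eq .univ hv, univ_prod_univ, Measure.restrict_univ]

theorem bilinForm_eq (hJ : IsJumpMeasure μ J) {u φ : Space N → ℝ}
    (h : Integrable (fun z : Space N × Space N => (u z.2 - u z.1) * (φ z.2 - φ z.1)) J) :
    bilinForm μ u φ = ∫ z, (u z.2 - u z.1) * (φ z.2 - φ z.1) ∂J := by
  rw [hJ.integral_eq _ h, bilinForm]
  refine integral_congr_ae (Filter.Eventually.of_forall fun x => ?_)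
  refine (setIntegral_eq_integral_of_forall_compl_eq_zero fun y hy => ?_).symm
  have : y = x := by simpa using hy
  simp [this]

theorem lintegral_swap (hJ : IsJumpMeasure μ J) (f : Space N × Space N → ℝ≥0∞) :
    ∫⁻ z, f z.swap ∂J = ∫⁻ z, f z ∂J :=
  hJ.swap.lintegral_comp_emb MeasurableEquiv.prodComm.measurableEmbedding f

theorem setLIntegral_prod_univ_le (hJ : IsJumpMeasure μ J) {A : Set (Space N)}
    (hA : MeasurableSet A) {f : Space N × Space N → ℝ≥0∞} (hf : AEMeasurable f J) {c : ℝ≥0∞}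
    (hc : ∀ᵐ x, x ∈ A → ∫⁻ y in {x}ᶜ, f (x, y) ∂(μ x) ≤ c) :
    ∫⁻ z in A ×ˢ univ, f z ∂J ≤ c * volume A := by
  rw [hJ.setLIntegral_prod hA .univ hf, ← setLIntegral_const]
  refine setLIntegral_mono_ae aemeasurable_const ?_
  filter_upwards [hc] with x hx hxA
  rw [← compl_eq_univ_sdiff]
  exact hx hxA

/-- If `F` has non-negative integral, an upper bound `Q + F ≤ h(x,y) + h(y,x)` bounds the integral
of `Q` by twice that of `h`. -/
theorem lintegral_le_two_mul (hJ : IsJumpMeasure μ J) {F Q : Space N × Space N → ℝ}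
    {h : Space N × Space N → ℝ≥0∞} (hF : Integrable F J) (hF0 : 0 ≤ ∫ z, F z ∂J)
    (hQ : ∀ z, 0 ≤ Q z) (hh : AEMeasurable h J)
    (hle : ∀ᵐ z ∂J, ENNReal.ofReal (Q z + F z) ≤ h z + h z.swap) :
    ∫⁻ z, ENNReal.ofReal (Q z) ∂J ≤ 2 * ∫⁻ z, h z ∂J := by
  set H : Space N × Space N → ℝ≥0∞ := fun z => h z + h z.swap with hH
  have hHm : AEMeasurable H J :=
    hh.add (hh.comp_quasiMeasurePreserving hJ.swap.quasiMeasurePreserving)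
  have hHint : ∫⁻ z, H z ∂J = 2 * ∫⁻ z, h z ∂J := by
    rw [lintegral_add_left' hh, hJ.lintegral_swap, two_mul]
  rw [← hHint]
  by_cases htop : ∫⁻ z, H z ∂J = ∞
  · rw [htop]; exact le_top
  have hHfin : ∀ᵐ z ∂J, H z < ∞ := ae_lt_top' hHm htop
  have hHi : Integrable (fun z => (H z).toReal) J := integrable_toReal_of_lintegral_ne_top hHm htop
  have hle' : ∀ᵐ z ∂J, Q z ≤ (H z).toReal - F z := by
    filter_upwards [hle, hHfin] with z hz hz'
    have := (ENNReal.ofReal_le_iff_le_toReal hz'.ne).1 hz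
    linarith
  calc ∫⁻ z, ENNReal.ofReal (Q z) ∂J ≤ ∫⁻ z, ENNReal.ofReal ((H z).toReal - F z) ∂J :=
        lintegral_mono_ae (hle'.mono fun z hz => ENNReal.ofReal_le_ofReal hz)
    _ = ENNReal.ofReal (∫ z, ((H z).toReal - F z) ∂J) :=
        (ofReal_integral_eq_lintegral_ofReal (hHi.sub hF)
          (hle'.mono fun z hz => (hQ z).trans hz)).symm
    _ ≤ ENNReal.ofReal (∫ z, (H z).toReal ∂J) := by
        rw [integral_sub hHi hF]
        exact ENNReal.ofReal_le_ofReal (by linarith)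
    _ = ∫⁻ z, H z ∂J := by
        rw [integral_toReal hHm hHfin, ENNReal.ofReal_toReal htop]

end IsJumpMeasure

/-! ### Truncated second moments and cut-off functions -/

/-- The constant in the estimate of the truncated second moments of `μ(x,·)`. -/
noncomputable def levyConst (α C₂ : ℝ) : ℝ := 4 * C₂ / (1 - 2 ^ α / 4)

theorem two_rpow_div_four_lt_one (hα2 : α < 2) : (2 : ℝ) ^ α / 4 < 1 := by
  have : (2 : ℝ) ^ α < 2 ^ (2 : ℝ) := Real.rpow_lt_rpow_of_exponent_lt (by norm_num) hα2
  norm_num at this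
  linarith

theorem levyConst_pos (hα2 : α < 2) (hC₂ : 1 ≤ C₂) : 0 < levyConst α C₂ := by
  have := two_rpow_div_four_lt_one hα2
  unfold levyConst
  have h : 0 < 1 - (2 : ℝ) ^ α / 4 := by linarith
  positivity

/-- One term of the series is enough: the one for the first `n` with `2⁻ⁿ ≤ dist x y / s`. If `n ≥
1` then also `dist x y / s ≤ 2 · 2⁻ⁿ`, whose square accounts for the factor `4`. -/
theorem ofReal_min_sq_le_tsum {X : Type*} [PseudoMetricSpace X] (x y : X) {s : ℝ} (hs : 0 < s) :
    ENNReal.ofReal (min 1 (dist x y / s) ^ 2) ≤ ∑' n : ℕ, (ball x (s / 2 ^ n))ᶜ.indicator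
      (fun _ => ENNReal.ofReal (4 * (1 / 4) ^ n)) y := by
  set t := dist x y / s with ht
  have hdist : dist y x = t * s := by rw [ht, dist_comm]; field_simp
  have ht0 : 0 ≤ t := by positivity
  suffices h : t = 0 ∨ ∃ n : ℕ, (1 / 2 : ℝ) ^ n ≤ t ∧ min 1 t ^ 2 ≤ 4 * (1 / 4) ^ n by
    rcases h with h | ⟨n, h1, h2⟩
    · simp [h]
    · refine le_trans ?_ (ENNReal.le_tsum n)
      rw [indicator_of_mem]
      · exact ENNReal.ofReal_le_ofReal h2
      · rw [mem_compl_iff, mem_ball, not_lt, hdist]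
        calc s / 2 ^ n = (1 / 2) ^ n * s := by rw [one_div, inv_pow]; field_simp
          _ ≤ t * s := by gcongr
  rcases ht0.eq_or_lt with h | h
  · exact Or.inl h.symm
  right
  rcases le_or_gt 1 t with h1 | h1
  · exact ⟨0, by simpa using h1, by rw [min_eq_left h1]; norm_num⟩
  · obtain ⟨n, hn1, hn2⟩ := exists_nat_pow_near_of_lt_one h h1.le
      (show (0 : ℝ) < 1 / 2 by norm_num) (by norm_num)
    refine ⟨n + 1, hn1.le, ?_⟩
    rw [min_eq_right h1.le]
    calc t ^ 2 ≤ ((1 / 2) ^ n) ^ 2 := by gcongr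
      _ = 4 * (1 / 4) ^ (n + 1) := by
        rw [← pow_mul, mul_comm, pow_mul, pow_succ]; norm_num; ring

/-- The decay bound at radius `s / 2ⁿ` costs `2^(nα)` while the weight gains `4⁻ⁿ`; the geometric
series of ratio `2^α / 4` converges because `α < 2`, and `levyConst` is its sum. -/
theorem lintegral_min_sq_le (hd : DecayBound μ α C₂) (hα2 : α < 2) (hC₂ : 1 ≤ C₂)
    (x : Space N) {s : ℝ} (hs : 0 < s) :
    ∫⁻ y, ENNReal.ofReal (min 1 (dist x y / s) ^ 2) ∂(μ x) ≤
      ENNReal.ofReal (levyConst α C₂ / s ^ α) := by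
  have hq := two_rpow_div_four_lt_one hα2
  have hq0 : (0 : ℝ) ≤ 2 ^ α / 4 := by positivity
  have hsα : 0 < s ^ α := Real.rpow_pos_of_pos hs _
  calc ∫⁻ y, ENNReal.ofReal (min 1 (dist x y / s) ^ 2) ∂(μ x)
      ≤ ∫⁻ y, ∑' n : ℕ, (ball x (s / 2 ^ n))ᶜ.indicator
          (fun _ => ENNReal.ofReal (4 * (1 / 4) ^ n)) y ∂(μ x) :=
        lintegral_mono fun y => ofReal_min_sq_le_tsum x y hs
    _ = ∑' n : ℕ, ENNReal.ofReal (4 * (1 / 4) ^ n) * μ x (ball x (s / 2 ^ n))ᶜ := by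
        rw [lintegral_tsum fun n =>
          (measurable_const.indicator measurableSet_ball.compl).aemeasurable]
        congr 1
        funext n
        rw [lintegral_indicator measurableSet_ball.compl, setLIntegral_const]
    _ ≤ ∑' n : ℕ, ENNReal.ofReal (4 * C₂ / s ^ α * (2 ^ α / 4) ^ n) := by
        refine ENNReal.tsum_le_tsum fun n => ?_
        refine (mul_le_mul_right (hd x (s / 2 ^ n) (by positivity)) _).trans ?_
        rw [← ENNReal.ofReal_mul (by positivity)]
        refine le_of_eq (congrArg _ ?_)
        rw [Real.div_rpow hs.le (by positivity), ← Real.rpow_natCast 2 n, ← Real.rpow_mul two_pos.le,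
          mul_comm (n : ℝ) α, Real.rpow_mul two_pos.le, Real.rpow_natCast, div_pow, div_pow,
          one_pow]
        field_simp
    _ = ENNReal.ofReal (levyConst α C₂ / s ^ α) := by
        rw [← ENNReal.ofReal_tsum_of_nonneg (fun n => by positivity)
          ((summable_geometric_of_lt_one hq0 hq).mul_left _), tsum_mul_left,
          tsum_geometric_of_lt_one hq0 hq, levyConst]
        congr 1
        have : 1 - (2 : ℝ) ^ α / 4 ≠ 0 := by linarith
        field_simp

/-- A radial Lipschitz cut-off function: it is `1` on `B_a(x₀)` and vanishes off `B_b(x₀)`. -/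
noncomputable def cutoff (x₀ : Space N) (a b : ℝ) (x : Space N) : ℝ :=
  max 0 (min 1 ((b - dist x x₀) / (b - a)))

section Cutoff

variable {x₀ : Space N} {a b : ℝ}

theorem cutoff_nonneg (x : Space N) : 0 ≤ cutoff x₀ a b x := le_max_left _ _

theorem cutoff_le_one (x : Space N) : cutoff x₀ a b x ≤ 1 :=
  max_le zero_le_one (min_le_left _ _)

theorem cutoff_eq_one (hab : a < b) {x : Space N} (hx : x ∈ ball x₀ a) : cutoff x₀ a b x = 1 := by
  have h : 1 ≤ (b - dist x x₀) / (b - a) := by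
    rw [le_div_iff₀ (by linarith)]
    linarith [mem_ball.1 hx]
  rw [cutoff, min_eq_left h, max_eq_right zero_le_one]

theorem cutoff_eq_zero (hab : a < b) {x : Space N} (hx : x ∉ ball x₀ b) : cutoff x₀ a b x = 0 := by
  have h : (b - dist x x₀) / (b - a) ≤ 0 :=
    div_nonpos_of_nonpos_of_nonneg (by linarith [not_lt.1 (mt mem_ball.2 hx)]) (by linarith)
  rw [cutoff, max_eq_left ((min_le_right _ _).trans h)]

theorem measurable_cutoff : Measurable (cutoff x₀ a b) := by
  unfold cutoff
  fun_prop

theorem abs_cutoff_sub_le (hab : a < b) (x y : Space N) :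
    |cutoff x₀ a b x - cutoff x₀ a b y| ≤ min 1 (dist x y / (b - a)) := by
  refine le_min ?_ ?_
  · rw [abs_le]
    constructor <;> linarith [cutoff_nonneg (x₀ := x₀) (a := a) (b := b) x,
      cutoff_nonneg (x₀ := x₀) (a := a) (b := b) y, cutoff_le_one (x₀ := x₀) (a := a) (b := b) x,
      cutoff_le_one (x₀ := x₀) (a := a) (b := b) y]
  · have hba : 0 < b - a := by linarith
    calc |cutoff x₀ a b x - cutoff x₀ a b y|
        ≤ |min 1 ((b - dist x x₀) / (b - a)) - min 1 ((b - dist y x₀) / (b - a))| := by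
          unfold cutoff
          rw [max_comm 0, max_comm 0]
          exact abs_max_sub_max_le_abs _ _ _
      _ ≤ |(b - dist x x₀) / (b - a) - (b - dist y x₀) / (b - a)| := by
          rw [min_comm 1, min_comm 1]
          refine (abs_min_sub_min_le_max _ _ _ _).trans ?_
          simp
      _ = |dist y x₀ - dist x x₀| / (b - a) := by
          rw [← sub_div, abs_div, abs_of_pos hba]
          congr 2; ring
      _ ≤ dist x y / (b - a) := by
          gcongr
          rw [dist_comm x y]
          exact abs_dist_sub_le y x x₀

theorem cutoff_sub_sq_le (hab : a < b) (x y : Space N) :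
    (cutoff x₀ a b y - cutoff x₀ a b x) ^ 2 ≤ min 1 (dist x y / (b - a)) ^ 2 := by
  rw [← sq_abs, abs_sub_comm]
  gcongr
  exact abs_cutoff_sub_le hab x y

end Cutoff

end NonlocalHolder

/-! ### Test functions and integrability of the form -/

namespace NonlocalHolder

variable {N : ℕ} {μ : Space N → Measure (Space N)} {α C₁ C₂ : ℝ}
  {J : Measure (Space N × Space N)} {E : Set (Space N)} {w : Space N → ℝ} {x₀ : Space N}
  {r a b M : ℝ} {T τ : ℝ≥0∞}

theorem lintegral_cutoff_le (hJ : IsJumpMeasure μ J) (hd : DecayBound μ α C₂) (hα2 : α < 2)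
    (hC₂ : 1 ≤ C₂) (hab : a < b) {A : Set (Space N)} (hA : MeasurableSet A) :
    ∫⁻ z in A ×ˢ univ, ENNReal.ofReal ((cutoff x₀ a b z.2 - cutoff x₀ a b z.1) ^ 2) ∂J ≤
      ENNReal.ofReal (levyConst α C₂ / (b - a) ^ α) * volume A := by
  refine hJ.setLIntegral_prod_univ_le hA
    (hJ.aemeasurable_sq_sub measurable_cutoff.aemeasurable) (ae_of_all _ fun x _ => ?_)
  refine le_trans ?_ (lintegral_min_sq_le hd hα2 hC₂ x (sub_pos.2 hab))
  refine (setLIntegral_le_lintegral _ _).trans (lintegral_mono fun y => ?_)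
  exact ENNReal.ofReal_le_ofReal (cutoff_sub_sq_le hab x y)

/-- The integrand vanishes unless one of the two points lies in `B_b`, so the symmetry of `J`
reduces the integral to twice the one over `B_b × ℝ^N`. -/
theorem lintegral_cutoff_lt_top (hJ : IsJumpMeasure μ J) (hd : DecayBound μ α C₂) (hα2 : α < 2)
    (hC₂ : 1 ≤ C₂) (hab : a < b) :
    ∫⁻ z, ENNReal.ofReal ((cutoff x₀ a b z.2 - cutoff x₀ a b z.1) ^ 2) ∂J < ∞ := by
  set g : Space N × Space N → ℝ≥0∞ :=
    fun z => ENNReal.ofReal ((cutoff x₀ a b z.2 - cutoff x₀ a b z.1) ^ 2) with hg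
  have hgm : AEMeasurable g J := hJ.aemeasurable_sq_sub measurable_cutoff.aemeasurable
  have hm : MeasurableSet (ball x₀ b ×ˢ (univ : Set (Space N))) := measurableSet_ball.prod .univ
  have hfin : ∫⁻ z, (ball x₀ b ×ˢ univ).indicator g z ∂J < ∞ := by
    rw [lintegral_indicator hm]
    exact (lintegral_cutoff_le hJ hd hα2 hC₂ hab measurableSet_ball).trans_lt
      (ENNReal.mul_lt_top ENNReal.ofReal_lt_top measure_ball_lt_top)
  have hle : ∀ z, g z ≤ (ball x₀ b ×ˢ univ).indicator g z +
      (ball x₀ b ×ˢ univ).indicator g z.swap := by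
    intro z
    by_cases h1 : z.1 ∈ ball x₀ b
    · rw [indicator_of_mem (show z ∈ ball x₀ b ×ˢ univ from ⟨h1, trivial⟩)]
      exact le_self_add
    by_cases h2 : z.2 ∈ ball x₀ b
    · rw [indicator_of_mem (show z.swap ∈ ball x₀ b ×ˢ univ from ⟨h2, trivial⟩)]
      refine le_trans (le_of_eq ?_) le_add_self
      simp only [hg, Prod.fst_swap, Prod.snd_swap]
      congr 1; ring
    · simp [hg, cutoff_eq_zero hab h1, cutoff_eq_zero hab h2]
  refine (lintegral_mono hle).trans_lt ?_
  rw [lintegral_add_left' (hgm.indicator hm), hJ.lintegral_swap]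
  exact ENNReal.add_lt_top.2 ⟨hfin, hfin⟩

/-- The test functions carry the square of the cut-off, whose increments are at most twice those of
the cut-off itself. -/
theorem lintegral_cutoff_sq_lt_top (hJ : IsJumpMeasure μ J) (hd : DecayBound μ α C₂) (hα2 : α < 2)
    (hC₂ : 1 ≤ C₂) (hab : a < b) :
    ∫⁻ z, ENNReal.ofReal ((cutoff x₀ a b z.2 ^ 2 - cutoff x₀ a b z.1 ^ 2) ^ 2) ∂J < ∞ := by
  have h := ENNReal.mul_lt_top (a := 4) (by simp)
    (lintegral_cutoff_lt_top (x₀ := x₀) hJ hd hα2 hC₂ hab)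
  rw [← lintegral_const_mul' _ _ (by simp)] at h
  refine lt_of_le_of_lt (lintegral_mono fun z => ?_) h
  rw [show (4 : ℝ≥0∞) = ENNReal.ofReal 4 by simp, ← ENNReal.ofReal_mul (by norm_num)]
  refine ENNReal.ofReal_le_ofReal ?_
  have h1 := cutoff_nonneg (x₀ := x₀) (a := a) (b := b) z.1
  have h2 := cutoff_nonneg (x₀ := x₀) (a := a) (b := b) z.2
  have h3 := cutoff_le_one (x₀ := x₀) (a := a) (b := b) z.1
  have h4 := cutoff_le_one (x₀ := x₀) (a := a) (b := b) z.2
  rw [sq_sub_sq, mul_pow]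
  gcongr
  nlinarith

/-- Products of cut-offs with bounded Lipschitz functions of `w` have finite energy. -/
theorem memH_mul_comp (hJ : IsJumpMeasure μ J) (hw : AEMeasurable w volume)
    (hen : quadForm μ (ball x₀ r) w < ∞) {G : ℝ → ℝ} {K : ℝ≥0} (hG : LipschitzWith K G)
    (hG0 : ∀ t, 0 ≤ G t) (hGM : ∀ t, G t ≤ M) {ζ : Space N → ℝ} (hζ : Measurable ζ)
    (hζ0 : ∀ x, 0 ≤ ζ x) (hζ1 : ∀ x, ζ x ≤ 1) (hζr : ∀ x, x ∉ ball x₀ r → ζ x = 0)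
    (hζe : ∫⁻ z, ENNReal.ofReal ((ζ z.2 - ζ z.1) ^ 2) ∂J < ∞) :
    MemH μ fun x => ζ x * G (w x) := by
  set φ : Space N → ℝ := fun x => ζ x * G (w x) with hφ
  have hφm : AEMeasurable φ volume := hζ.aemeasurable.mul (hG.continuous.measurable.comp_aemeasurable hw)
  have hM : 0 ≤ M := (hG0 0).trans (hGM 0)
  refine ⟨?_, ?_⟩
  · have hφr : φ = (ball x₀ r).indicator φ := by
      funext x
      by_cases hx : x ∈ ball x₀ r <;> simp [indicator, hx, hφ, hζr]
    rw [hφr, memLp_indicator_iff_restrict measurableSet_ball]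
    have : IsFiniteMeasure (volume.restrict (ball x₀ r)) := ⟨by
      rw [Measure.restrict_apply_univ]; exact measure_ball_lt_top⟩
    refine MemLp.of_bound hφm.aestronglyMeasurable.restrict M (ae_of_all _ fun x => ?_)
    rw [Real.norm_of_nonneg (mul_nonneg (hζ0 x) (hG0 _))]
    calc ζ x * G (w x) ≤ 1 * M := mul_le_mul (hζ1 x) (hGM _) (hG0 _) zero_le_one
      _ = M := one_mul M
  · rw [hJ.quadForm_univ_eq hφm]
    have hDm : MeasurableSet (ball x₀ r ×ˢ ball x₀ r) := measurableSet_ball.prod measurableSet_ball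
    have hpt : ∀ z : Space N × Space N, ENNReal.ofReal ((φ z.2 - φ z.1) ^ 2) ≤
        ENNReal.ofReal (2 * K ^ 2) * (ball x₀ r ×ˢ ball x₀ r).indicator
          (fun z => ENNReal.ofReal ((w z.2 - w z.1) ^ 2)) z +
        ENNReal.ofReal (2 * M ^ 2) * ENNReal.ofReal ((ζ z.2 - ζ z.1) ^ 2) := by
      rintro ⟨x, y⟩
      have hsq : ∀ t, G t ^ 2 ≤ M ^ 2 := fun t => pow_le_pow_left₀ (hG0 t) (hGM t) 2
      by_cases hx : x ∈ ball x₀ r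
      · by_cases hy : y ∈ ball x₀ r
        · rw [indicator_of_mem (show (x, y) ∈ ball x₀ r ×ˢ ball x₀ r from ⟨hx, hy⟩),
            ← ENNReal.ofReal_mul (by positivity), ← ENNReal.ofReal_mul (by positivity),
            ← ENNReal.ofReal_add (by positivity) (by positivity)]
          refine ENNReal.ofReal_le_ofReal ?_
          have hl : (G (w y) - G (w x)) ^ 2 ≤ K ^ 2 * (w y - w x) ^ 2 := by
            have := hG.dist_le_mul (w y) (w x)
            rw [Real.dist_eq, Real.dist_eq] at this
            rw [← mul_pow, ← sq_abs, ← sq_abs ((K : ℝ) * _), abs_mul, NNReal.abs_eq]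
            gcongr
          have h1 : (ζ y * (G (w y) - G (w x))) ^ 2 ≤ K ^ 2 * (w y - w x) ^ 2 := by
            rw [mul_pow]
            have : ζ y ^ 2 ≤ 1 := pow_le_one₀ (hζ0 y) (hζ1 y)
            nlinarith [sq_nonneg (G (w y) - G (w x))]
          have h2 : (G (w x) * (ζ y - ζ x)) ^ 2 ≤ M ^ 2 * (ζ y - ζ x) ^ 2 := by
            rw [mul_pow]
            exact mul_le_mul_of_nonneg_right (hsq _) (sq_nonneg _)
          have h3 : φ y - φ x = ζ y * (G (w y) - G (w x)) + G (w x) * (ζ y - ζ x) := by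
            simp only [hφ]; ring
          simp only [h3]
          nlinarith [sq_nonneg (ζ y * (G (w y) - G (w x)) - G (w x) * (ζ y - ζ x))]
        -- For a jump leaving the ball, `φ y = ζ y = 0`, so the increment of `φ` is at most `M`
        -- times that of `ζ`; nothing about `w` outside the ball is needed.
        · refine le_trans ?_ le_add_self
          rw [← ENNReal.ofReal_mul (by positivity)]
          refine ENNReal.ofReal_le_ofReal ?_
          simp only [hφ, hζr y hy]
          nlinarith [mul_le_mul_of_nonneg_right (hsq (w x)) (sq_nonneg (ζ x)),
            mul_nonneg (sq_nonneg M) (sq_nonneg (ζ x))]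
      · refine le_trans ?_ le_add_self
        rw [← ENNReal.ofReal_mul (by positivity)]
        refine ENNReal.ofReal_le_ofReal ?_
        simp only [hφ, hζr x hx]
        nlinarith [mul_le_mul_of_nonneg_right (hsq (w y)) (sq_nonneg (ζ y)),
            mul_nonneg (sq_nonneg M) (sq_nonneg (ζ y))]
    refine (lintegral_mono hpt).trans_lt ?_
    rw [lintegral_add_left' (((hJ.aemeasurable_sq_sub hw).indicator hDm).const_mul _),
      lintegral_const_mul' _ _ ENNReal.ofReal_ne_top, lintegral_const_mul' _ _ ENNReal.ofReal_ne_top,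
      lintegral_indicator hDm, ← hJ.quadForm_eq measurableSet_ball hw]
    exact ENNReal.add_lt_top.2 ⟨ENNReal.mul_lt_top ENNReal.ofReal_lt_top hen,
      ENNReal.mul_lt_top ENNReal.ofReal_lt_top hζe⟩

/-- Solutions of `𝓛w = 0` in `E`, in a form invariant under affine changes `w ↦ a w + b`. -/
structure IsWeakHarmonic (μ : Space N → Measure (Space N)) (E : Set (Space N))
    (w : Space N → ℝ) : Prop where
  aemeasurable : AEMeasurable w volume
  energy : ∀ D : Set (Space N), IsOpen D → closure D ⊆ E → quadForm μ D w < ∞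
  weak : ∀ φ : Space N → ℝ, MemH μ φ → (∀ x, 0 ≤ φ x) → tsupport φ ⊆ E → bilinForm μ w φ = 0

/-- A solution with values in `[0,M]` on the ball `B_r(x₀)` whose negative part has a small tail. -/
structure IsNonnegSolutionOn (μ : Space N → Measure (Space N)) (E : Set (Space N))
    (w : Space N → ℝ) (x₀ : Space N) (r M : ℝ) (T τ : ℝ≥0∞) : Prop where
  pos : 0 < r
  subset : closedBall x₀ r ⊆ E
  sol : IsWeakHarmonic μ E w
  nonneg : ∀ᵐ x, x ∈ ball x₀ r → 0 ≤ w x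
  le : ∀ᵐ x, x ∈ ball x₀ r → w x ≤ M
  lt_top : T < ∞
  tail : ∀ᵐ x, x ∈ ball x₀ (7 / 8 * r) →
    ∫⁻ y in (ball x₀ r)ᶜ, ENNReal.ofReal |w y| ∂(μ x) ≤ T
  negTail : ∀ᵐ x, x ∈ ball x₀ (7 / 8 * r) →
    ∫⁻ y in (ball x₀ r)ᶜ, ENNReal.ofReal (-w y) ∂(μ x) ≤ τ

theorem IsNonnegSolutionOn.energy (h : IsNonnegSolutionOn μ E w x₀ r M T τ) :
    quadForm μ (ball x₀ r) w < ∞ :=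
  h.sol.energy _ isOpen_ball (closure_ball_subset_closedBall.trans h.subset)

/-- Integrals over `A × B_rᶜ` reduce to integrals against `μ(x,·)`, since `A ⊆ B_r`. -/
theorem setLIntegral_prod_compl_ball_le (hJ : IsJumpMeasure μ J) {A : Set (Space N)}
    (hA : MeasurableSet A) {f : Space N → ℝ≥0∞} (hf : AEMeasurable f volume)
    {c : ℝ≥0∞} (hc : ∀ᵐ x, x ∈ A → ∫⁻ y in (ball x₀ r)ᶜ, f y ∂(μ x) ≤ c) :
    ∫⁻ z in A ×ˢ (ball x₀ r)ᶜ, f z.2 ∂J ≤ c * volume A := by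
  rw [hJ.setLIntegral_prod hA measurableSet_ball.compl (hJ.aemeasurable_comp_snd hf),
    ← setLIntegral_const]
  refine setLIntegral_mono_ae aemeasurable_const ?_
  filter_upwards [hc] with x hx hxA
  exact (lintegral_mono_set sdiff_subset).trans (hx hxA)

/-- Within `B_r × B_r` the product is dominated by the energies of `w` and `φ`. A jump from `B_b`
out of `B_r` is dominated by `K (|w y| + M)`, which the finite tail and the gap `r/8` between `B_b`
and the complement of `B_r` make integrable. The bounds `M` and `T` serve only for this qualitative
fact and enter no later estimate. -/
theorem integrable_form (hJ : IsJumpMeasure μ J) (hd : DecayBound μ α C₂)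
    (h : IsNonnegSolutionOn μ E w x₀ r M T τ) {b : ℝ} (hb : b ≤ 7 / 8 * r) {φ : Space N → ℝ}
    (hφ : MemH μ φ) {K : ℝ} (hφ0 : ∀ x, 0 ≤ φ x) (hφK : ∀ x, φ x ≤ K)
    (hφb : ∀ x, x ∉ ball x₀ b → φ x = 0) :
    Integrable (fun z : Space N × Space N => (w z.2 - w z.1) * (φ z.2 - φ z.1)) J := by
  have hw := h.sol.aemeasurable
  have hr := h.pos
  have hφm : AEMeasurable φ volume := hφ.1.aestronglyMeasurable.aemeasurable
  have hK : 0 ≤ K := (hφ0 x₀).trans (hφK x₀)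
  have hbr : ball x₀ b ⊆ ball x₀ r := ball_subset_ball (by linarith)
  have hFm : AEMeasurable (fun z : Space N × Space N => (w z.2 - w z.1) * (φ z.2 - φ z.1)) J :=
    ((hJ.aemeasurable_comp_snd hw).sub (hJ.aemeasurable_comp_fst hw)).mul
      ((hJ.aemeasurable_comp_snd hφm).sub (hJ.aemeasurable_comp_fst hφm))
  refine ⟨hFm.aestronglyMeasurable, ?_⟩
  set D : Set (Space N × Space N) := ball x₀ r ×ˢ ball x₀ r with hD
  have hDm : MeasurableSet D := measurableSet_ball.prod measurableSet_ball
  set S : Set (Space N × Space N) := ball x₀ b ×ˢ (ball x₀ r)ᶜ with hS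
  have hSm : MeasurableSet S := measurableSet_ball.prod measurableSet_ball.compl
  set g : Space N × Space N → ℝ≥0∞ :=
    fun z => ENNReal.ofReal ((w z.2 - w z.1) ^ 2) + ENNReal.ofReal ((φ z.2 - φ z.1) ^ 2) with hg
  set f : Space N → ℝ≥0∞ := fun y => ENNReal.ofReal K * ENNReal.ofReal |w y| + ENNReal.ofReal (K * M)
    with hf
  have hfm : AEMeasurable f volume := (hw.abs.ennreal_ofReal.const_mul _).add_const _
  have hgm : AEMeasurable g J := (hJ.aemeasurable_sq_sub hw).add (hJ.aemeasurable_sq_sub hφm)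
  have hpt : ∀ᵐ z ∂J, ‖(w z.2 - w z.1) * (φ z.2 - φ z.1)‖ₑ ≤ D.indicator g z +
      (S.indicator (fun z => f z.2) z + S.indicator (fun z => f z.2) z.swap) := by
    have hae : ∀ᵐ x, x ∈ ball x₀ r → 0 ≤ w x ∧ w x ≤ M := by
      filter_upwards [h.nonneg, h.le] with x h1 h2 hx using ⟨h1 hx, h2 hx⟩
    filter_upwards [hJ.ae_fst hae, hJ.ae_snd hae] with z hz1 hz2
    have hcross : ∀ x y, x ∈ ball x₀ b → y ∉ ball x₀ r → (0 ≤ w x ∧ w x ≤ M) →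
        ENNReal.ofReal (|w y - w x| * |φ y - φ x|) ≤ f y := by
      intro x y hx hy hwx
      simp only [hf]
      rw [← ENNReal.ofReal_mul hK, hφb y fun h => hy (hbr h), zero_sub, abs_neg,
        abs_of_nonneg (hφ0 x)]
      have hM : 0 ≤ M := hwx.1.trans hwx.2
      rw [← ENNReal.ofReal_add (by positivity) (by positivity)]
      refine ENNReal.ofReal_le_ofReal ?_
      have h1 : |w y - w x| ≤ |w y| + M := by
        refine (abs_sub _ _).trans ?_
        rw [abs_of_nonneg hwx.1]; linarith [hwx.2]
      calc |w y - w x| * φ x ≤ (|w y| + M) * K :=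
            mul_le_mul h1 (hφK x) (hφ0 x) (by positivity)
        _ = K * |w y| + K * M := by ring
    rw [Real.enorm_eq_ofReal_abs, abs_mul]
    by_cases h1 : z.1 ∈ ball x₀ r
    · by_cases h2 : z.2 ∈ ball x₀ r
      · refine le_trans ?_ le_self_add
        rw [indicator_of_mem (show z ∈ D from ⟨h1, h2⟩), hg]
        simp only
        rw [← ENNReal.ofReal_add (by positivity) (by positivity)]
        refine ENNReal.ofReal_le_ofReal ?_
        nlinarith [sq_nonneg (|w z.2 - w z.1| - |φ z.2 - φ z.1|), sq_abs (w z.2 - w z.1),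
          sq_abs (φ z.2 - φ z.1), sq_nonneg (w z.2 - w z.1), sq_nonneg (φ z.2 - φ z.1)]
      · by_cases h3 : z.1 ∈ ball x₀ b
        · refine le_trans ?_ le_add_self
          refine le_trans ?_ le_self_add
          rw [indicator_of_mem (show z ∈ S from ⟨h3, h2⟩)]
          exact hcross _ _ h3 h2 (hz1 h1)
        · simp [hφb _ h3, hφb _ fun h => h2 (hbr h)]
    · by_cases h3 : z.2 ∈ ball x₀ b
      · refine le_trans ?_ le_add_self
        refine le_trans ?_ le_add_self
        rw [indicator_of_mem (show z.swap ∈ S from ⟨h3, h1⟩), abs_sub_comm, abs_sub_comm (φ z.2)]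
        exact hcross _ _ h3 h1 (hz2 (hbr h3))
      · simp [hφb _ h3, hφb _ fun h => h1 (hbr h)]
  refine (lintegral_mono_ae hpt).trans_lt ?_
  have hSfin : ∫⁻ z, S.indicator (fun z => f z.2) z ∂J < ∞ := by
    rw [lintegral_indicator hSm]
    refine (setLIntegral_prod_compl_ball_le
      (c := ENNReal.ofReal K * T + ENNReal.ofReal (K * M) * ENNReal.ofReal (C₂ / (r / 8) ^ α))
      hJ measurableSet_ball hfm ?_).trans_lt ?_
    · filter_upwards [h.tail] with x hx hxb
      have hx' : x ∈ ball x₀ (7 / 8 * r) := ball_subset_ball hb hxb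
      simp only [hf]
      rw [lintegral_add_right _ measurable_const, lintegral_const_mul' _ _ ENNReal.ofReal_ne_top,
        setLIntegral_const]
      refine add_le_add (mul_le_mul_right (hx hx') _) (mul_le_mul_right ?_ _)
      refine (measure_mono ?_).trans (hd x (r / 8) (by positivity))
      refine compl_subset_compl.2 fun y hy => ?_
      rw [mem_ball] at *
      linarith [dist_triangle y x x₀]
    · refine ENNReal.mul_lt_top (ENNReal.add_lt_top.2 ⟨?_, ?_⟩) measure_ball_lt_top
      · exact ENNReal.mul_lt_top ENNReal.ofReal_lt_top h.lt_top
      · exact ENNReal.mul_lt_top ENNReal.ofReal_lt_top ENNReal.ofReal_lt_top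
  rw [lintegral_add_left' (hgm.indicator hDm),
    lintegral_add_left' ((hJ.aemeasurable_comp_snd hfm).indicator hSm), hJ.lintegral_swap]
  refine ENNReal.add_lt_top.2 ⟨?_, ENNReal.add_lt_top.2 ⟨hSfin, hSfin⟩⟩
  rw [lintegral_indicator hDm, lintegral_add_left' (hJ.aemeasurable_sq_sub hw).restrict]
  refine ENNReal.add_lt_top.2 ⟨?_, ?_⟩
  · rw [← hJ.quadForm_eq measurableSet_ball hw]
    exact h.energy
  · refine (setLIntegral_le_lintegral _ _).trans_lt ?_
    rw [← hJ.quadForm_univ_eq hφm]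
    exact hφ.2

end NonlocalHolder

/-! ### Energy estimate and Caccioppoli inequality -/

namespace NonlocalHolder

variable {N : ℕ} {μ : Space N → Measure (Space N)} {α C₁ C₂ : ℝ}
  {J : Measure (Space N × Space N)} {E : Set (Space N)} {w : Space N → ℝ} {x₀ : Space N}
  {r a b M : ℝ} {T τ : ℝ≥0∞}

theorem tsupport_subset_of_eq_zero {φ : Space N → ℝ} (h : ∀ x, x ∉ ball x₀ b → φ x = 0) :
    tsupport φ ⊆ closedBall x₀ b :=
  closure_minimal (fun x hx => by
    by_contra hx'
    exact hx (h x fun h' => hx' (ball_subset_closedBall h'))) isClosed_closedBall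

/-- The general energy estimate: testing with `η² G(w)` bounds the integral of any `Q` which is
pointwise dominated in terms of the cut-off function and the negative tail. -/
theorem energy_estimate (hJ : IsJumpMeasure μ J) (hd : DecayBound μ α C₂) (hα2 : α < 2)
    (hC₂ : 1 ≤ C₂) (h : IsNonnegSolutionOn μ E w x₀ r M T τ) (hab : a < b) (hb : b ≤ 7 / 8 * r)
    {G : ℝ → ℝ} {K : ℝ≥0} (hG : LipschitzWith K G) (hG0 : ∀ t, 0 ≤ G t) {M' : ℝ}
    (hGM : ∀ t, G t ≤ M') {φ : Space N → ℝ} (hφ : φ = fun x => cutoff x₀ a b x ^ 2 * G (w x))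
    {A : Set (Space N)} (hA : MeasurableSet A) (hAb : A ⊆ ball x₀ b) {p : Space N → Prop}
    (hp : ∀ᵐ x, p x) {Q : Space N × Space N → ℝ} {c₁ c₂ : ℝ} (hc₁ : 0 ≤ c₁) (hc₂ : 0 ≤ c₂)
    (hQ0 : ∀ z, 0 ≤ Q z) (hQs : ∀ z, Q z.swap = Q z)
    (hin : ∀ x y, p x → p y → x ∈ ball x₀ r → y ∈ ball x₀ r →
      Q (x, y) + (w y - w x) * (φ y - φ x) ≤ c₁ * (cutoff x₀ a b y - cutoff x₀ a b x) ^ 2)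
    (hin' : ∀ x y, p x → p y → x ∈ ball x₀ r → y ∈ ball x₀ r → x ∉ A → y ∉ A →
      Q (x, y) + (w y - w x) * (φ y - φ x) ≤ 0)
    (hout : ∀ x y, p x → x ∈ A → y ∉ ball x₀ r →
      Q (x, y) + (w y - w x) * (φ y - φ x) ≤
        c₁ * (cutoff x₀ a b y - cutoff x₀ a b x) ^ 2 + c₂ * max (-w y) 0)
    (hout' : ∀ x y, p x → x ∈ ball x₀ r → x ∉ A → y ∉ ball x₀ r →
      Q (x, y) + (w y - w x) * (φ y - φ x) ≤ 0)
    (hQout : ∀ x y, x ∉ ball x₀ r → y ∉ ball x₀ r → Q (x, y) = 0) :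
    ∫⁻ z, ENNReal.ofReal (Q z) ∂J ≤ 2 * ((ENNReal.ofReal c₁ *
      ENNReal.ofReal (levyConst α C₂ / (b - a) ^ α) + ENNReal.ofReal c₂ * τ) * volume A) := by
  have hw := h.sol.aemeasurable
  have hr := h.pos
  have hbr : ball x₀ b ⊆ ball x₀ r := ball_subset_ball (by linarith)
  have hAr : A ⊆ ball x₀ r := hAb.trans hbr
  have hφ0 : ∀ x, 0 ≤ φ x := fun x => by
    rw [hφ]; exact mul_nonneg (sq_nonneg _) (hG0 _)
  have hφb : ∀ x, x ∉ ball x₀ b → φ x = 0 := fun x hx => by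
    simp [hφ, cutoff_eq_zero hab hx]
  have hζ1 : ∀ x, cutoff x₀ a b x ^ 2 ≤ 1 := fun x =>
    pow_le_one₀ (cutoff_nonneg x) (cutoff_le_one x)
  have hφM : ∀ x, φ x ≤ M' := fun x => by
    rw [hφ]
    calc cutoff x₀ a b x ^ 2 * G (w x) ≤ 1 * M' := mul_le_mul (hζ1 x) (hGM _) (hG0 _) zero_le_one
      _ = M' := one_mul _
  have hφH : MemH μ φ := by
    rw [hφ]
    refine memH_mul_comp (ζ := fun x => cutoff x₀ a b x ^ 2) hJ hw h.energy hG hG0 hGM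
      (measurable_cutoff.pow_const 2) (fun x => sq_nonneg _) hζ1 (fun x hx => ?_)
      (lintegral_cutoff_sq_lt_top hJ hd hα2 hC₂ hab)
    rw [cutoff_eq_zero hab fun h => hx (hbr h)]; simp
  have hF := integrable_form hJ hd h hb hφH hφ0 hφM hφb
  -- This is where the equation is used; only the sign of the form is needed from here on.
  have hF0 : 0 ≤ ∫ z, (w z.2 - w z.1) * (φ z.2 - φ z.1) ∂J := by
    rw [← hJ.bilinForm_eq hF, h.sol.weak φ hφH hφ0]
    exact (tsupport_subset_of_eq_zero hφb).trans
      ((closedBall_subset_closedBall (by linarith)).trans h.subset)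
  set g₁ : Space N × Space N → ℝ≥0∞ := fun z => ENNReal.ofReal c₁ *
    ENNReal.ofReal ((cutoff x₀ a b z.2 - cutoff x₀ a b z.1) ^ 2) with hg₁
  set g₂ : Space N → ℝ≥0∞ := fun y => ENNReal.ofReal c₂ * ENNReal.ofReal (-w y) with hg₂
  set S₁ : Set (Space N × Space N) := A ×ˢ univ with hS₁
  set S₂ : Set (Space N × Space N) := A ×ˢ (ball x₀ r)ᶜ with hS₂
  have hS₁m : MeasurableSet S₁ := hA.prod .univ
  have hS₂m : MeasurableSet S₂ := hA.prod measurableSet_ball.compl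
  have hg₁m : AEMeasurable g₁ J :=
    (hJ.aemeasurable_sq_sub measurable_cutoff.aemeasurable).const_mul _
  have hg₂m : AEMeasurable g₂ volume := hw.neg.ennreal_ofReal.const_mul _
  -- This majorant charges only pairs whose first point lies in `A`. Pairs with only the second
  -- point in `A` are covered by its swap, and pairs avoiding `A` contribute nothing positive.
  set hh : Space N × Space N → ℝ≥0∞ :=
    fun z => S₁.indicator g₁ z + S₂.indicator (fun z => g₂ z.2) z with hhh
  have hhm : AEMeasurable hh J :=
    (hg₁m.indicator hS₁m).add ((hJ.aemeasurable_comp_snd hg₂m).indicator hS₂m)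
  have hin₁ : ∀ x y, p x → p y → x ∈ A → y ∈ ball x₀ r →
      ENNReal.ofReal (Q (x, y) + (w y - w x) * (φ y - φ x)) ≤ hh (x, y) := by
    intro x y hpx hpy hx hy
    refine le_trans ?_ le_self_add
    rw [indicator_of_mem (show (x, y) ∈ S₁ from ⟨hx, trivial⟩), hg₁]
    simp only
    rw [← ENNReal.ofReal_mul hc₁]
    exact ENNReal.ofReal_le_ofReal (hin x y hpx hpy (hAr hx) hy)
  have hout₁ : ∀ x y, p x → x ∈ ball x₀ r → y ∉ ball x₀ r →
      ENNReal.ofReal (Q (x, y) + (w y - w x) * (φ y - φ x)) ≤ hh (x, y) := by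
    intro x y hpx hx hy
    by_cases hxA : x ∈ A
    · refine (ENNReal.ofReal_le_ofReal (hout x y hpx hxA hy)).trans ?_
      refine ENNReal.ofReal_add_le.trans ?_
      rw [ENNReal.ofReal_mul hc₁, ENNReal.ofReal_mul hc₂, ENNReal.ofReal_max, ENNReal.ofReal_zero,
        max_eq_left zero_le, hhh]
      simp only
      rw [indicator_of_mem (show (x, y) ∈ S₁ from ⟨hxA, trivial⟩),
        indicator_of_mem (show (x, y) ∈ S₂ from ⟨hxA, hy⟩)]
    · rw [ENNReal.ofReal_of_nonpos (hout' x y hpx hx hxA hy)]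
      exact zero_le
  have hsymm : ∀ z : Space N × Space N, Q z + (w z.2 - w z.1) * (φ z.2 - φ z.1) =
      Q (z.2, z.1) + (w z.1 - w z.2) * (φ z.1 - φ z.2) := by
    intro z
    have : Q (z.2, z.1) = Q z := hQs z
    rw [this]; ring
  have hle : ∀ᵐ z ∂J, ENNReal.ofReal (Q z + (w z.2 - w z.1) * (φ z.2 - φ z.1)) ≤
      hh z + hh z.swap := by
    filter_upwards [hJ.ae_fst hp, hJ.ae_snd hp] with z hp1 hp2
    by_cases h1 : z.1 ∈ ball x₀ r
    · by_cases h2 : z.2 ∈ ball x₀ r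
      · by_cases hA1 : z.1 ∈ A
        · exact (hin₁ z.1 z.2 hp1 hp2 hA1 h2).trans le_self_add
        · by_cases hA2 : z.2 ∈ A
          · rw [hsymm]
            exact (hin₁ z.2 z.1 hp2 hp1 hA2 h1).trans le_add_self
          · rw [ENNReal.ofReal_of_nonpos (hin' z.1 z.2 hp1 hp2 h1 h2 hA1 hA2)]
            exact zero_le
      · exact (hout₁ z.1 z.2 hp1 h1 h2).trans le_self_add
    · by_cases h2 : z.2 ∈ ball x₀ r
      · rw [hsymm]
        exact (hout₁ z.2 z.1 hp2 h2 h1).trans le_add_self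
      · rw [show Q z = 0 from hQout z.1 z.2 h1 h2, hφb _ fun h => h1 (hbr h),
          hφb _ fun h => h2 (hbr h)]
        simp
  refine (hJ.lintegral_le_two_mul hF hF0 hQ0 hhm hle).trans (mul_le_mul_right ?_ _)
  rw [lintegral_add_left' (hg₁m.indicator hS₁m), lintegral_indicator hS₁m,
    lintegral_indicator hS₂m, add_mul]
  refine add_le_add ?_ ?_
  · rw [hg₁, lintegral_const_mul' _ _ ENNReal.ofReal_ne_top, mul_assoc]
    exact mul_le_mul_right (lintegral_cutoff_le hJ hd hα2 hC₂ hab hA) _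
  · refine setLIntegral_prod_compl_ball_le hJ hA hg₂m ?_
    filter_upwards [h.negTail] with x hx hxA
    rw [hg₂, lintegral_const_mul' _ _ ENNReal.ofReal_ne_top]
    exact mul_le_mul_right (hx (ball_subset_ball hb (hAb hxA))) _

/-- The truncation `(k - t)₊`, cut at height `k`. -/
noncomputable def truncBelow (k t : ℝ) : ℝ := max 0 (min k (k - t))

theorem lipschitzWith_truncBelow (k : ℝ) : LipschitzWith 1 (truncBelow k) := by
  have h : LipschitzWith 1 fun t : ℝ => k - t := by
    refine LipschitzWith.of_dist_le_mul fun x y => ?_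
    rw [Real.dist_eq, Real.dist_eq, NNReal.coe_one, one_mul, abs_sub_comm x y]
    exact le_of_eq (congrArg _ (by ring))
  exact (h.const_min k).const_max 0

theorem truncBelow_nonneg (k t : ℝ) : 0 ≤ truncBelow k t := le_max_left _ _

theorem truncBelow_le {k : ℝ} (hk : 0 ≤ k) (t : ℝ) : truncBelow k t ≤ k :=
  max_le hk (min_le_left _ _)

theorem truncBelow_eq_zero {k t : ℝ} (h : k ≤ t) : truncBelow k t = 0 :=
  max_eq_left ((min_le_right _ _).trans (by linarith))

theorem truncBelow_eq_sub {k t : ℝ} (ht : 0 ≤ t) (h : t ≤ k) : truncBelow k t = k - t := by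
  rw [truncBelow, min_eq_right (by linarith), max_eq_right (by linarith)]

/-- For `s, t ≤ k`, put `p = k - s` and `q = k - t`: the left side is then exactly `p q (η - ζ)²`.
If `s` or `t` exceeds `k`, the corresponding truncation vanishes and the left side is non-positive.
-/
theorem caccioppoli_pointwise {k s t ζ η : ℝ} (hs : 0 ≤ s) (ht : 0 ≤ t) (hk : 0 ≤ k) :
    (η * truncBelow k t - ζ * truncBelow k s) ^ 2 +
      (t - s) * (η ^ 2 * truncBelow k t - ζ ^ 2 * truncBelow k s) ≤ k ^ 2 * (η - ζ) ^ 2 := by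
  rcases le_total k s with h1 | h1 <;> rcases le_total k t with h2 | h2
  · rw [truncBelow_eq_zero h1, truncBelow_eq_zero h2]
    nlinarith [mul_nonneg (sq_nonneg k) (sq_nonneg (η - ζ))]
  · rw [truncBelow_eq_zero h1, truncBelow_eq_sub ht h2]
    have : 0 ≤ (s - k) * (η ^ 2 * (k - t)) :=
      mul_nonneg (by linarith) (mul_nonneg (sq_nonneg _) (by linarith))
    nlinarith [mul_nonneg (sq_nonneg k) (sq_nonneg (η - ζ))]
  · rw [truncBelow_eq_sub hs h1, truncBelow_eq_zero h2]
    have : 0 ≤ (t - k) * (ζ ^ 2 * (k - s)) :=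
      mul_nonneg (by linarith) (mul_nonneg (sq_nonneg _) (by linarith))
    nlinarith [mul_nonneg (sq_nonneg k) (sq_nonneg (η - ζ))]
  · rw [truncBelow_eq_sub hs h1, truncBelow_eq_sub ht h2]
    have h3 : (k - t) * (k - s) ≤ k ^ 2 := by nlinarith [mul_nonneg hs hk, mul_nonneg ht hk]
    have := mul_le_mul_of_nonneg_right h3 (sq_nonneg (η - ζ))
    nlinarith

/-- The case of a jump out of the ball, where `t` may be negative. For `s ≤ k` the left side equals
`ζ² (k - s)(k - t)`, and `k - t ≤ k + t₋` produces the tail term. -/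
theorem caccioppoli_pointwise_right {k s t ζ : ℝ} (hζ0 : 0 ≤ ζ) (hζ1 : ζ ≤ 1) (hs : 0 ≤ s)
    (hk : 0 ≤ k) :
    (0 * truncBelow k t - ζ * truncBelow k s) ^ 2 +
      (t - s) * (0 ^ 2 * truncBelow k t - ζ ^ 2 * truncBelow k s) ≤
        k ^ 2 * (0 - ζ) ^ 2 + k * max (-t) 0 := by
  have hP0 : 0 ≤ max (-t) 0 := le_max_right _ _
  have hPt : -t ≤ max (-t) 0 := le_max_left _ _
  generalize max (-t) 0 = P at *
  have hkP := mul_nonneg hk hP0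
  rcases le_total k s with h1 | h1
  · rw [truncBelow_eq_zero h1]
    nlinarith [mul_nonneg (sq_nonneg k) (sq_nonneg ζ)]
  · rw [truncBelow_eq_sub hs h1]
    have hζ2 : ζ ^ 2 ≤ 1 := pow_le_one₀ hζ0 hζ1
    have h2 : (k - s) * (k - t) ≤ k * (k + P) := by
      calc (k - s) * (k - t) ≤ (k - s) * (k + P) :=
            mul_le_mul_of_nonneg_left (by linarith) (by linarith)
        _ ≤ k * (k + P) := mul_le_mul_of_nonneg_right (by linarith) (by linarith)
    have h3 : ζ ^ 2 * ((k - s) * (k - t)) ≤ ζ ^ 2 * (k * (k + P)) :=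
      mul_le_mul_of_nonneg_left h2 (sq_nonneg _)
    have h4 : ζ ^ 2 * (k * P) ≤ 1 * (k * P) := mul_le_mul_of_nonneg_right hζ2 hkP
    nlinarith

/-- Caccioppoli estimate for the truncations `(k - w)₊`. -/
theorem caccioppoli (hJ : IsJumpMeasure μ J) (hd : DecayBound μ α C₂) (hα2 : α < 2)
    (hC₂ : 1 ≤ C₂) (h : IsNonnegSolutionOn μ E w x₀ r M T τ) (hab : a < b) (hb : b ≤ 7 / 8 * r)
    {k : ℝ} (hk : 0 ≤ k) {A : Set (Space N)} (hA : MeasurableSet A) (hAb : A ⊆ ball x₀ b)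
    (hAw : ∀ x ∈ ball x₀ b, w x < k → x ∈ A) :
    quadForm μ univ (fun x => cutoff x₀ a b x * truncBelow k (w x)) ≤ 2 * ((ENNReal.ofReal (k ^ 2) *
      ENNReal.ofReal (levyConst α C₂ / (b - a) ^ α) + ENNReal.ofReal k * τ) * volume A) := by
  have hw := h.sol.aemeasurable
  have hr := h.pos
  have hbr : ball x₀ b ⊆ ball x₀ r := ball_subset_ball (by linarith)
  have hfm : AEMeasurable (fun x => cutoff x₀ a b x * truncBelow k (w x)) volume :=
    measurable_cutoff.aemeasurable.mul
      ((lipschitzWith_truncBelow k).continuous.measurable.comp_aemeasurable hw)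
  rw [hJ.quadForm_univ_eq hfm]
  have hzero : ∀ x, x ∉ A → cutoff x₀ a b x = 0 ∨ truncBelow k (w x) = 0 := by
    intro x hx
    by_cases hxb : x ∈ ball x₀ b
    · exact Or.inr (truncBelow_eq_zero (not_lt.1 fun h => hx (hAw x hxb h)))
    · exact Or.inl (cutoff_eq_zero hab hxb)
  refine energy_estimate hJ hd hα2 hC₂ h hab hb (lipschitzWith_truncBelow k) (truncBelow_nonneg k)
    (truncBelow_le hk) rfl hA hAb h.nonneg (sq_nonneg k) hk (fun z => sq_nonneg _)
    (fun z => by simp only [Prod.fst_swap, Prod.snd_swap]; ring) ?_ ?_ ?_ ?_ ?_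
  · intro x y hx hy hxr hyr
    exact caccioppoli_pointwise (hx hxr) (hy hyr) hk
  · intro x y _ _ _ _ hxA hyA
    rcases hzero x hxA with h1 | h1 <;> rcases hzero y hyA with h2 | h2 <;> simp [h1, h2]
  · intro x y hx hxA hyr
    have h1 := cutoff_eq_zero (x₀ := x₀) hab fun h => hyr (hbr h)
    have hwx := hx (hbr (hAb hxA))
    rw [h1]
    have h2 := caccioppoli_pointwise_right (t := w y) (cutoff_nonneg (x₀ := x₀) (a := a) (b := b) x)
      (cutoff_le_one x) hwx hk
    linarith
  · intro x y _ _ hxA hyr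
    have h1 := cutoff_eq_zero (x₀ := x₀) hab fun h => hyr (hbr h)
    rcases hzero x hxA with h2 | h2 <;> simp [h1, h2]
  · intro x y hx hy
    simp [cutoff_eq_zero hab fun h => hx (hbr h), cutoff_eq_zero hab fun h => hy (hbr h)]

/-! ### The logarithmic estimate -/

/-- The weight `1 / (t₊ + d)` used in the logarithmic estimate. -/
noncomputable def invWeight (d t : ℝ) : ℝ := (max t 0 + d)⁻¹

/-- The truncated logarithm `(-log (t₊ + d))₊`. -/
noncomputable def negLog (d t : ℝ) : ℝ := max 0 (-Real.log (max t 0 + d))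

section LogWeights

variable {d : ℝ}

theorem le_max_add (t : ℝ) : d ≤ max t 0 + d := by
  linarith [le_max_right t 0]

theorem abs_max_add_sub_le (s t : ℝ) : |(max s 0 + d) - (max t 0 + d)| ≤ |s - t| := by
  rw [add_sub_add_right_eq_sub]
  exact abs_max_sub_max_le_abs _ _ _

theorem invWeight_nonneg (hd : 0 < d) (t : ℝ) : 0 ≤ invWeight d t :=
  inv_nonneg.2 (hd.le.trans (le_max_add t))

theorem invWeight_le (hd : 0 < d) (t : ℝ) : invWeight d t ≤ d⁻¹ :=
  inv_anti₀ hd (le_max_add t)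

theorem lipschitzWith_invWeight (hd : 0 < d) :
    LipschitzWith (Real.toNNReal (d⁻¹ * d⁻¹)) (invWeight d) := by
  refine LipschitzWith.of_dist_le_mul fun s t => ?_
  rw [Real.coe_toNNReal _ (by positivity), Real.dist_eq, Real.dist_eq]
  have hs : 0 < max s 0 + d := hd.trans_le (le_max_add s)
  have ht : 0 < max t 0 + d := hd.trans_le (le_max_add t)
  have h1 : invWeight d s - invWeight d t =
      ((max t 0 + d) - (max s 0 + d)) * (invWeight d s * invWeight d t) := by
    unfold invWeight; field_simp
  rw [h1, abs_mul, abs_of_nonneg (mul_nonneg (invWeight_nonneg hd s) (invWeight_nonneg hd t)),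
    mul_comm]
  refine mul_le_mul (mul_le_mul (invWeight_le hd s) (invWeight_le hd t) (invWeight_nonneg hd t)
    (by positivity)) ?_ (abs_nonneg _) (by positivity)
  rw [abs_sub_comm]
  exact abs_max_add_sub_le s t

theorem abs_log_sub_log_le {x y : ℝ} (hd : 0 < d) (hx : d ≤ x) (hy : d ≤ y) :
    |Real.log x - Real.log y| ≤ d⁻¹ * |x - y| := by
  have key : ∀ x y : ℝ, d ≤ x → d ≤ y → Real.log x - Real.log y ≤ d⁻¹ * |x - y| := by
    intro x y hx hy
    have hx0 := hd.trans_le hx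
    have hy0 := hd.trans_le hy
    rw [← Real.log_div hx0.ne' hy0.ne']
    calc Real.log (x / y) ≤ x / y - 1 := Real.log_le_sub_one_of_pos (by positivity)
      _ = y⁻¹ * (x - y) := by field_simp
      _ ≤ y⁻¹ * |x - y| := by gcongr; exact le_abs_self _
      _ ≤ d⁻¹ * |x - y| := by gcongr
  rw [abs_le]
  constructor
  · have := key y x hy hx
    rw [abs_sub_comm] at this
    linarith
  · exact key x y hx hy

theorem lipschitzWith_negLog (hd : 0 < d) : LipschitzWith (Real.toNNReal d⁻¹) (negLog d) := by
  refine LipschitzWith.of_dist_le_mul fun s t => ?_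
  rw [Real.coe_toNNReal _ (by positivity), Real.dist_eq, Real.dist_eq]
  calc |negLog d s - negLog d t|
      ≤ |-Real.log (max s 0 + d) - -Real.log (max t 0 + d)| := by
        unfold negLog
        rw [max_comm 0, max_comm 0]
        exact abs_max_sub_max_le_abs _ _ _
    _ = |Real.log (max s 0 + d) - Real.log (max t 0 + d)| := by
        rw [← abs_neg]; congr 1; ring
    _ ≤ d⁻¹ * |(max s 0 + d) - (max t 0 + d)| :=
        abs_log_sub_log_le hd (le_max_add s) (le_max_add t)
    _ ≤ d⁻¹ * |s - t| :=
        mul_le_mul_of_nonneg_left (abs_max_add_sub_le s t) (inv_nonneg.2 hd.le)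

theorem negLog_nonneg (t : ℝ) : 0 ≤ negLog d t := le_max_left _ _

theorem negLog_le (hd : 0 < d) (t : ℝ) : negLog d t ≤ max 0 (-Real.log d) :=
  max_le_max le_rfl (neg_le_neg (Real.log_le_log hd (le_max_add t)))

theorem negLog_eq_zero (hd : 0 < d) {t : ℝ} (ht : 1 ≤ t) : negLog d t = 0 := by
  refine max_eq_left (neg_nonpos.2 (Real.log_nonneg ?_))
  linarith [le_max_left t 0]

theorem neg_log_two_mul_le_negLog (hd : 0 < d) {t : ℝ} (ht : t ≤ d) :
    -Real.log (2 * d) ≤ negLog d t := by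
  refine le_trans (neg_le_neg (Real.log_le_log (hd.trans_le (le_max_add t)) ?_)) (le_max_right _ _)
  linarith [max_le ht hd.le]

end LogWeights

/-- With `s = log (y / x)` the right side is `(2 sinh (s/2))²`, and `|sinh| ≥ |·|`. -/
theorem sq_log_sub_log_le {x y : ℝ} (hx : 0 < x) (hy : 0 < y) :
    (Real.log y - Real.log x) ^ 2 ≤ (y - x) ^ 2 / (x * y) := by
  set s := Real.log y - Real.log x with hs
  have hexp : Real.exp s = y / x := by rw [hs, Real.exp_sub, Real.exp_log hx, Real.exp_log hy]
  have hexp' : Real.exp (-s) = x / y := by rw [Real.exp_neg, hexp, inv_div]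
  have h1 : (y - x) ^ 2 / (x * y) = (2 * Real.sinh (s / 2)) ^ 2 := by
    have h2 : Real.cosh s = Real.cosh (s / 2) ^ 2 + Real.sinh (s / 2) ^ 2 := by
      rw [← Real.cosh_two_mul]; congr 1; ring
    have h3 := Real.cosh_sq (s / 2)
    have h4 : Real.cosh s = (y / x + x / y) / 2 := by rw [Real.cosh_eq, hexp, hexp']
    have h5 : (2 * Real.sinh (s / 2)) ^ 2 = 2 * Real.cosh s - 2 := by rw [h2, h3]; ring
    rw [h5, h4]
    field_simp
    ring
  rw [h1]
  have h2 : |s / 2| ≤ |Real.sinh (s / 2)| := by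
    rw [Real.abs_sinh]
    exact Real.self_le_sinh_iff.2 (abs_nonneg _)
  have h3 := sq_le_sq.2 h2
  nlinarith

/-- Completing the square: the two sides differ by `(η x - ζ y)² / (x y)`. -/
theorem log_pointwise {x y ζ η : ℝ} (hx : 0 < x) (hy : 0 < y) :
    (y - x) * (η ^ 2 * y⁻¹ - ζ ^ 2 * x⁻¹) ≤ (η - ζ) ^ 2 := by
  have h : (y - x) * (η ^ 2 * y⁻¹ - ζ ^ 2 * x⁻¹) =
      (η - ζ) ^ 2 - (η * x - ζ * y) ^ 2 / (x * y) := by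
    field_simp
    ring
  rw [h]
  have : 0 ≤ (η * x - ζ * y) ^ 2 / (x * y) := by positivity
  linarith

/-- Logarithmic estimate. -/
theorem log_estimate (hJ : IsJumpMeasure μ J) (hd : DecayBound μ α C₂) (hα2 : α < 2)
    (hC₂ : 1 ≤ C₂) (h : IsNonnegSolutionOn μ E w x₀ r M T τ) (hab : a < b) (hb : b ≤ 7 / 8 * r)
    {d : ℝ} (hd0 : 0 < d) :
    quadForm μ (ball x₀ a) (fun x => negLog d (w x)) ≤
      2 * ((ENNReal.ofReal (levyConst α C₂ / (b - a) ^ α) +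
        ENNReal.ofReal d⁻¹ * τ) * volume (ball x₀ b)) := by
  have hw := h.sol.aemeasurable
  have hr := h.pos
  have hbr : ball x₀ b ⊆ ball x₀ r := ball_subset_ball (by linarith)
  have habs : ball x₀ a ⊆ ball x₀ b := ball_subset_ball hab.le
  have hvm : AEMeasurable (fun x => negLog d (w x)) volume :=
    (lipschitzWith_negLog hd0).continuous.measurable.comp_aemeasurable hw
  set D : Set (Space N × Space N) := ball x₀ a ×ˢ ball x₀ a with hD
  have hDm : MeasurableSet D := measurableSet_ball.prod measurableSet_ball
  set Q : Space N × Space N → ℝ :=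
    D.indicator fun z => (negLog d (w z.2) - negLog d (w z.1)) ^ 2 with hQ
  have hquad : quadForm μ (ball x₀ a) (fun x => negLog d (w x)) = ∫⁻ z, ENNReal.ofReal (Q z) ∂J := by
    rw [hJ.quadForm_eq measurableSet_ball hvm, ← lintegral_indicator hDm]
    refine lintegral_congr fun z => ?_
    by_cases hz : z ∈ D <;> simp [hQ, hz]
  rw [hquad]
  have hQz : ∀ x y, x ∉ ball x₀ a ∨ y ∉ ball x₀ a → Q (x, y) = 0 := by
    intro x y hxy
    refine indicator_of_notMem (fun hz => ?_) _
    exact hxy.elim (fun h => h hz.1) (fun h => h hz.2)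
  have hη0 : ∀ x, 0 ≤ cutoff x₀ a b x := fun x => cutoff_nonneg x
  refine (energy_estimate (c₁ := 1) (c₂ := d⁻¹) (τ := τ) (Q := Q) hJ hd hα2 hC₂ h hab hb
    (lipschitzWith_invWeight hd0)
    (invWeight_nonneg hd0) (invWeight_le hd0) rfl measurableSet_ball subset_rfl h.nonneg zero_le_one
    (inv_nonneg.2 hd0.le) ?_ ?_ ?_ ?_ ?_ ?_ ?_).trans (by simp)
  · exact fun z => indicator_nonneg (fun z _ => sq_nonneg _) z
  · intro z
    by_cases hz : z ∈ D
    · rw [hQ, indicator_of_mem hz, indicator_of_mem (show z.swap ∈ D from ⟨hz.2, hz.1⟩)]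
      simp only [Prod.fst_swap, Prod.snd_swap]; ring
    · rw [hQ, indicator_of_notMem hz, indicator_of_notMem (fun h => hz ⟨h.2, h.1⟩)]
  · intro x y hx hy hxr hyr
    have hwx := hx hxr
    have hwy := hy hyr
    have hx0 : 0 < w x + d := by linarith
    have hy0 : 0 < w y + d := by linarith
    rw [one_mul]
    simp only [invWeight, max_eq_left hwx, max_eq_left hwy]
    have hdiff : w y - w x = (w y + d) - (w x + d) := by ring
    by_cases hz : (x, y) ∈ D
    · rw [hQ, indicator_of_mem hz, cutoff_eq_one hab hz.1, cutoff_eq_one hab hz.2, hdiff]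
      -- Where both cut-offs equal `1`, the form is the exact negative of this quotient, so it
      -- absorbs `Q` and leaves nothing over.
      have h1 : (negLog d (w y) - negLog d (w x)) ^ 2 ≤
          ((w y + d) - (w x + d)) ^ 2 / ((w x + d) * (w y + d)) := by
        refine le_trans ?_ (sq_log_sub_log_le hx0 hy0)
        simp only [negLog, max_eq_left hwx, max_eq_left hwy]
        refine sq_le_sq.2 ?_
        rw [max_comm 0, max_comm 0]
        refine (abs_max_sub_max_le_abs _ _ _).trans (le_of_eq ?_)
        rw [neg_sub_neg, abs_sub_comm]
      have h2 : ((w y + d) - (w x + d)) * (1 ^ 2 * (w y + d)⁻¹ - 1 ^ 2 * (w x + d)⁻¹) =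
          -(((w y + d) - (w x + d)) ^ 2 / ((w x + d) * (w y + d))) := by
        field_simp
        ring
      simp only [h2]
      linarith
    · rw [hQ, indicator_of_notMem hz, hdiff, zero_add]
      exact log_pointwise hx0 hy0
  · intro x y _ _ _ _ hxA hyA
    rw [hQz x y (Or.inl fun h => hxA (habs h)), cutoff_eq_zero hab hxA, cutoff_eq_zero hab hyA]
    simp
  · intro x y hx hxA hyr
    have hwx := hx (hbr hxA)
    rw [hQz x y (Or.inr fun h => hyr (hbr (habs h))), cutoff_eq_zero hab fun h => hyr (hbr h)]
    simp only [invWeight, max_eq_left hwx]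
    have h1 : cutoff x₀ a b x ^ 2 ≤ 1 := pow_le_one₀ (hη0 x) (cutoff_le_one x)
    have h0 := sq_nonneg (cutoff x₀ a b x)
    generalize cutoff x₀ a b x = η at *
    have hP0 : 0 ≤ max (-w y) 0 := le_max_right _ _
    have hPt : -w y ≤ max (-w y) 0 := le_max_left _ _
    generalize max (-w y) 0 = P at *
    have hx0 : 0 < w x + d := by linarith
    -- The `1` becomes `η² = (0 - η)²`, a cut-off increment, and `d⁻¹ P` goes to the tail term.
    have h2 : (w x - w y) * (w x + d)⁻¹ ≤ 1 + d⁻¹ * P := by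
      have h3 : (w x - w y) * (w x + d)⁻¹ ≤ (w x + d + P) * (w x + d)⁻¹ :=
        mul_le_mul_of_nonneg_right (by linarith) (by positivity)
      have h4 : (w x + d)⁻¹ ≤ d⁻¹ := inv_anti₀ hd0 (by linarith)
      have h5 : (w x + d + P) * (w x + d)⁻¹ = 1 + P * (w x + d)⁻¹ := by field_simp
      nlinarith [mul_le_mul_of_nonneg_left h4 hP0]
    have h3 := mul_le_mul_of_nonneg_left h2 h0
    have h4 : η ^ 2 * (d⁻¹ * P) ≤ 1 * (d⁻¹ * P) :=
      mul_le_mul_of_nonneg_right h1 (by positivity)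
    nlinarith
  · intro x y _ _ hxA hyr
    rw [hQz x y (Or.inl fun h => hxA (habs h)), cutoff_eq_zero hab hxA,
      cutoff_eq_zero hab fun h => hyr (hbr h)]
    simp
  · intro x y hx _
    exact hQz x y (Or.inl fun h => hx (hbr (habs h)))

end NonlocalHolder

/-! ### A Faber–Krahn inequality -/

namespace NonlocalHolder

variable {N : ℕ} {μ : Space N → Measure (Space N)} {α C₁ C₂ : ℝ}
  {J : Measure (Space N × Space N)} {E : Set (Space N)} {w : Space N → ℝ} {x₀ : Space N}
  {r a b M : ℝ} {T τ : ℝ≥0∞}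

theorem quadForm_mono {D D' : Set (Space N)} (h : D ⊆ D') (u : Space N → ℝ) :
    quadForm μ D u ≤ quadForm μ D' u :=
  (lintegral_mono fun _ => lintegral_mono_set h).trans (lintegral_mono_set h)

theorem MemH.memHLoc {f : Space N → ℝ} (hf : MemH μ f) : MemHLoc μ E f := fun _ _ _ =>
  ⟨hf.1.restrict _, (quadForm_mono (subset_univ _) f).trans_lt hf.2⟩

/-- This makes the Poincaré inequality available for the truncated logarithm of a solution.
Composition with a Lipschitz function keeps the energy finite; boundedness of `G` and of `E` gives
square integrability. -/
theorem IsWeakHarmonic.memHLoc_comp (hw : IsWeakHarmonic μ E w) (hE : Bornology.IsBounded E)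
    {G : ℝ → ℝ} {K : ℝ≥0} (hG : LipschitzWith K G) {M : ℝ} (hGM : ∀ t, |G t| ≤ M) :
    MemHLoc μ E fun x => G (w x) := by
  intro D hD hDE
  refine ⟨?_, ?_⟩
  · have hb : Bornology.IsBounded D := hE.subset (subset_closure.trans hDE)
    have : IsFiniteMeasure (volume.restrict D) := ⟨by
      rw [Measure.restrict_apply_univ]; exact hb.measure_lt_top⟩
    exact MemLp.of_bound
      (hG.continuous.measurable.comp_aemeasurable hw.aemeasurable).aestronglyMeasurable.restrict M
      (ae_of_all _ fun x => hGM _)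
  · have h := ENNReal.mul_lt_top (a := ENNReal.ofReal (K ^ 2)) ENNReal.ofReal_lt_top
      (hw.energy D hD hDE)
    refine lt_of_le_of_lt ?_ h
    rw [quadForm, quadForm, ← lintegral_const_mul' _ _ ENNReal.ofReal_ne_top]
    refine lintegral_mono fun x => ?_
    rw [← lintegral_const_mul' _ _ ENNReal.ofReal_ne_top]
    refine lintegral_mono fun y => ?_
    rw [← ENNReal.ofReal_mul (by positivity)]
    refine ENNReal.ofReal_le_ofReal ?_
    have := hG.dist_le_mul (w y) (w x)
    rw [Real.dist_eq, Real.dist_eq] at this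
    rw [← mul_pow, ← sq_abs, ← sq_abs ((K : ℝ) * _), abs_mul, NNReal.abs_eq]
    gcongr

/-- Tonelli's theorem in the form needed to average integrals over balls with respect to their
centres. -/
theorem lintegral_setLIntegral_section {X Y : Type*} [MeasurableSpace X] [MeasurableSpace Y]
    {m : Measure X} {ν : Measure Y} [SFinite m] [SFinite ν] {S : Set (X × Y)}
    (hS : MeasurableSet S) {g : Y → ℝ≥0∞} (hg : AEMeasurable g ν) :
    AEMeasurable (fun z => ∫⁻ p in Prod.mk z ⁻¹' S, g p ∂ν) m ∧
    ∫⁻ z, ∫⁻ p in Prod.mk z ⁻¹' S, g p ∂ν ∂m =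
      ∫⁻ p, m ((fun z => (z, p)) ⁻¹' S) * g p ∂ν := by
  have hm : AEMeasurable (S.indicator fun q : X × Y => g q.2) (m.prod ν) :=
    (hg.comp_quasiMeasurePreserving Measure.quasiMeasurePreserving_snd).indicator hS
  have h1 : ∀ z, ∫⁻ p in Prod.mk z ⁻¹' S, g p ∂ν =
      ∫⁻ p, S.indicator (fun q : X × Y => g q.2) (z, p) ∂ν := by
    intro z
    rw [← lintegral_indicator (measurable_prodMk_left hS)]
    rfl
  have h2 : ∀ p, ∫⁻ z, S.indicator (fun q : X × Y => g q.2) (z, p) ∂m =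
      m ((fun z => (z, p)) ⁻¹' S) * g p := by
    intro p
    have : (fun z => S.indicator (fun q : X × Y => g q.2) (z, p)) =
        ((fun z => (z, p)) ⁻¹' S).indicator fun _ => g p := rfl
    rw [this, lintegral_indicator (measurable_prodMk_right hS), setLIntegral_const, mul_comm]
  simp_rw [h1]
  refine ⟨hm.lintegral_prod_right', ?_⟩
  rw [lintegral_lintegral_swap (f := fun z p => S.indicator (fun q : X × Y => g q.2) (z, p)) hm]
  exact lintegral_congr h2

/-- A Faber–Krahn type inequality, from the Poincaré inequality on all balls of radius `s`. -/
theorem faberKrahn (hJ : IsJumpMeasure μ J) (hP : PoincareInequality μ E α C₁)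
    {f : Space N → ℝ} (hf : MemH μ f) (hf0 : ∀ x, 0 ≤ f x) {k : ℝ} (hfk : ∀ x, f x ≤ k)
    {A : Set (Space N)} (hA : MeasurableSet A) (hAfin : volume A < ∞)
    (hfA : ∀ x, x ∉ A → f x = 0) {s : ℝ} (hs : 0 < s)
    (hball : ∀ z, (ball z s ∩ A).Nonempty → ball z s ⊆ E) :
    ∫⁻ x, ENNReal.ofReal (f x ^ 2) ≤ 2 * (ENNReal.ofReal (C₁ * s ^ α) * quadForm μ univ f +
      (ENNReal.ofReal k * volume A) * (ENNReal.ofReal k * volume A) /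
        volume (ball (0 : Space N) s)) := by
  have := hJ.sFinite
  have hfm : AEMeasurable f volume := hf.1.aestronglyMeasurable.aemeasurable
  have hf2m : AEMeasurable (fun x => ENNReal.ofReal (f x ^ 2)) volume :=
    (hfm.pow_const 2).ennreal_ofReal
  set V := volume (ball (0 : Space N) s) with hV
  have hVz : ∀ z : Space N, volume (ball z s) = V := fun z => Measure.addHaar_ball_center _ z s
  have hV0 : V ≠ 0 := (measure_ball_pos volume _ hs).ne'
  have hVt : V ≠ ∞ := measure_ball_lt_top.ne
  set m := ENNReal.ofReal k * volume A with hm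
  have hmt : m ≠ ∞ := (ENNReal.mul_lt_top ENNReal.ofReal_lt_top hAfin).ne
  have hfI : ∫⁻ x, ENNReal.ofReal (f x) ≤ m := by
    rw [hm, ← setLIntegral_const, ← lintegral_indicator hA]
    refine lintegral_mono fun x => ?_
    by_cases hx : x ∈ A
    · rw [indicator_of_mem hx]; exact ENNReal.ofReal_le_ofReal (hfk x)
    · simp [hfA x hx]
  -- With `c` the mean of `f` on the ball, `f² ≤ 2 (f - c)² + 2 c²`. Poincaré bounds the first part,
  -- and `c² V = (I / V) I` with `I ≤ m` the second. On a ball missing `A` there is nothing to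
  -- prove, so Poincaré is only invoked on balls inside `E`.
  have hloc : ∀ z, ∫⁻ x in ball z s, ENNReal.ofReal (f x ^ 2) ≤
      2 * (ENNReal.ofReal (C₁ * s ^ α) *
        (∫⁻ p in ball z s ×ˢ ball z s, ENNReal.ofReal ((f p.2 - f p.1) ^ 2) ∂J) +
        m / V * ∫⁻ x in ball z s, ENNReal.ofReal (f x)) := by
    intro z
    by_cases hz : (ball z s ∩ A).Nonempty
    · have hfin : IsFiniteMeasure (volume.restrict (ball z s)) := ⟨by
        rw [Measure.restrict_apply_univ]; exact measure_ball_lt_top⟩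
      have hint : IntegrableOn f (ball z s) volume :=
        Integrable.of_bound hfm.aestronglyMeasurable.restrict k
          (ae_of_all _ fun x => by rw [Real.norm_of_nonneg (hf0 x)]; exact hfk x)
      have hPo := hP z s hs (hball z hz) f hf.memHLoc hint
      rw [hJ.quadForm_eq measurableSet_ball hfm] at hPo
      have hc := ofReal_setAverage hint (ae_of_all _ hf0)
      set c := ⨍ x in ball z s, f x with hcdef
      rw [hVz z] at hc
      set I := ∫⁻ x in ball z s, ENNReal.ofReal (f x) with hI
      have hc0 : 0 ≤ c := by
        rw [hcdef, setAverage_eq]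
        exact smul_nonneg (inv_nonneg.2 measureReal_nonneg) (integral_nonneg hf0)
      have hIm : I ≤ m := (setLIntegral_le_lintegral _ _).trans hfI
      calc ∫⁻ x in ball z s, ENNReal.ofReal (f x ^ 2)
          ≤ ∫⁻ x in ball z s, (2 * ENNReal.ofReal ((f x - c) ^ 2) + 2 * ENNReal.ofReal (c ^ 2)) := by
            refine lintegral_mono fun x => ?_
            rw [show (2 : ℝ≥0∞) = ENNReal.ofReal 2 by simp, ← ENNReal.ofReal_mul (by norm_num),
              ← ENNReal.ofReal_mul (by norm_num), ← ENNReal.ofReal_add (by positivity)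
              (by positivity)]
            exact ENNReal.ofReal_le_ofReal (by nlinarith [sq_nonneg (f x - 2 * c)])
        _ = 2 * (∫⁻ x in ball z s, ENNReal.ofReal ((f x - c) ^ 2)) +
              2 * (ENNReal.ofReal (c ^ 2) * V) := by
            rw [lintegral_add_right _ measurable_const, lintegral_const_mul' _ _ (by simp),
              setLIntegral_const, hVz, mul_assoc]
        _ = 2 * (∫⁻ x in ball z s, ENNReal.ofReal ((f x - c) ^ 2)) + 2 * (I / V * I) := by
            rw [ENNReal.ofReal_pow hc0, hc, sq, mul_assoc, ENNReal.div_mul_cancel hV0 hVt]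
        _ ≤ _ := by
            rw [← mul_add]
            gcongr
    · have hz0 : ∀ x ∈ ball z s, f x = 0 := fun x hx => hfA x fun hxA => hz ⟨x, hx, hxA⟩
      rw [setLIntegral_congr_fun (g := 0) measurableSet_ball]
      · simp
      · intro x hx; simp [hz0 x hx]
  have hS1 : MeasurableSet {p : Space N × Space N | dist p.2 p.1 < s} :=
    measurableSet_lt (by fun_prop) (by fun_prop)
  have hS2 : MeasurableSet {p : Space N × (Space N × Space N) |
      dist p.2.1 p.1 < s ∧ dist p.2.2 p.1 < s} := by
    have h1 : MeasurableSet {p : Space N × (Space N × Space N) | dist p.2.1 p.1 < s} :=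
      measurableSet_lt (by fun_prop) (by fun_prop)
    have h2 : MeasurableSet {p : Space N × (Space N × Space N) | dist p.2.2 p.1 < s} :=
      measurableSet_lt (by fun_prop) (by fun_prop)
    exact h1.inter h2
  -- Each point lies in `B_s(z)` for a set of centres `z` of measure exactly `V`; a pair of points
  -- lies in a common ball for a set of centres of measure at most `V`, as used in `hT2'`.
  have hT1 : ∀ g : Space N → ℝ≥0∞, AEMeasurable g volume →
      ∫⁻ z : Space N, ∫⁻ x in ball z s, g x = V * ∫⁻ x, g x := by
    intro g hg
    have := (lintegral_setLIntegral_section (m := (volume : Measure (Space N))) hS1 hg).2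
    refine Eq.trans this ?_
    rw [← lintegral_const_mul' _ _ hVt]
    refine lintegral_congr fun x => ?_
    congr 1
    rw [← hVz x]
    congr 1
    ext z
    simp [dist_comm]
  have hT2 := lintegral_setLIntegral_section (m := (volume : Measure (Space N))) hS2
    (hJ.aemeasurable_sq_sub hfm)
  have hT2' : ∫⁻ z : Space N, ∫⁻ p in ball z s ×ˢ ball z s,
      ENNReal.ofReal ((f p.2 - f p.1) ^ 2) ∂J ≤ V * quadForm μ univ f := by
    refine le_trans (le_of_eq hT2.2) ?_
    rw [hJ.quadForm_univ_eq hfm, ← lintegral_const_mul' _ _ hVt]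
    refine lintegral_mono fun p => mul_le_mul_left ?_ _
    rw [← hVz p.1]
    refine measure_mono fun z hz => ?_
    rw [mem_ball, dist_comm]
    exact hz.1
  have hI1 : AEMeasurable (fun z : Space N => ∫⁻ p in ball z s ×ˢ ball z s,
      ENNReal.ofReal ((f p.2 - f p.1) ^ 2) ∂J) volume := hT2.1
  have hmain : V * ∫⁻ x, ENNReal.ofReal (f x ^ 2) ≤
      V * (2 * (ENNReal.ofReal (C₁ * s ^ α) * quadForm μ univ f + m * m / V)) := by
    rw [← hT1 _ hf2m]
    refine (lintegral_mono hloc).trans ?_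
    rw [lintegral_const_mul' _ _ (by simp), lintegral_add_left' (hI1.const_mul _),
      lintegral_const_mul' _ _ ENNReal.ofReal_ne_top,
      lintegral_const_mul' _ _ (ENNReal.div_ne_top hmt hV0), hT1 _ hfm.ennreal_ofReal]
    calc 2 * (ENNReal.ofReal (C₁ * s ^ α) * (∫⁻ z : Space N, ∫⁻ p in ball z s ×ˢ ball z s,
            ENNReal.ofReal ((f p.2 - f p.1) ^ 2) ∂J) + m / V * (V * ∫⁻ x, ENNReal.ofReal (f x)))
        ≤ 2 * (ENNReal.ofReal (C₁ * s ^ α) * (V * quadForm μ univ f) + m / V * (V * m)) := by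
          gcongr
      _ = V * (2 * (ENNReal.ofReal (C₁ * s ^ α) * quadForm μ univ f + m * m / V)) := by
          rw [show m * m / V = m / V * m from ENNReal.mul_div_right_comm]; ring
  exact (ENNReal.mul_le_mul_iff_right hV0 hVt).1 hmain

end NonlocalHolder

/-! ### De Giorgi iteration -/

namespace NonlocalHolder

variable {N : ℕ} {μ : Space N → Measure (Space N)} {α C₁ C₂ : ℝ}
  {J : Measure (Space N × Space N)} {E : Set (Space N)} {w : Space N → ℝ} {x₀ : Space N}
  {r a b M : ℝ} {T τ : ℝ≥0∞}

/-- Fast geometric convergence for the De Giorgi recursion. -/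
theorem exists_threshold_tendsto_zero (N : ℕ) {α : ℝ} (hα0 : 0 < α) (hα2 : α < 2) {C : ℝ}
    (hC : 32 ≤ C) :
    ∃ ν : ℝ, 0 < ν ∧ ∀ x : ℕ → ℝ, (∀ j, 0 ≤ x j) → x 0 ≤ ν →
      (∀ (j : ℕ) (σ : ℝ), 0 < σ → σ ≤ 1 / 8 →
        x (j + 1) ≤ C * 16 ^ j * (σ ^ α * x j + x j ^ 2 / σ ^ N)) →
      Filter.Tendsto x Filter.atTop (nhds 0) := by
  set p : ℝ := N / α with hp
  have hp0 : 0 ≤ p := by positivity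
  -- The decay rate is chosen to cancel both growing factors in the quadratic term: `16 ^ j` from
  -- the recursion, and `16 ^ (p j)` from the shrinking `σ`.
  set q : ℝ := (16 * (16 : ℝ) ^ p)⁻¹ with hq
  have h16p : 1 ≤ (16 : ℝ) ^ p := Real.one_le_rpow (by norm_num) hp0
  have hq0 : 0 < q := by positivity
  have hq1 : q < 1 := by
    rw [hq]
    exact inv_lt_one_of_one_lt₀ (by linarith)
  have hqmul : 16 * (16 : ℝ) ^ p * q = 1 := mul_inv_cancel₀ (by positivity)
  -- Both terms of the recursion then contribute `C * Q = q / 2`, which adds up to one factor `q`.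
  set Q : ℝ := q / (2 * C) with hQ
  have hC0 : 0 < C := by linarith
  have hQ0 : 0 < Q := by positivity
  have hQ64 : Q ≤ 1 / 64 := by
    rw [hQ, div_le_div_iff₀ (by positivity) (by norm_num)]
    linarith
  have hQp : 0 < Q ^ p := Real.rpow_pos_of_pos hQ0 _
  refine ⟨Q * Q ^ p, by positivity, fun x hx0 hxν hx => ?_⟩
  have hind : ∀ j, x j ≤ Q * Q ^ p * q ^ j := by
    intro j
    induction j with
    | zero => simpa using hxν
    | succ j ih =>
      have h16 : (1 : ℝ) ≤ 16 ^ j := one_le_pow₀ (by norm_num)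
      have h160 : (0 : ℝ) < 16 ^ j := by positivity
      -- Step `j` uses `σ = t ^ (1/α)`, so that `σ ^ α = Q / 16 ^ j` compensates `16 ^ j` in the
      -- linear term. The assumption `32 ≤ C` gives `t ≤ 1/64`, and with `α < 2` this gives `σ ≤
      -- 1/8`.
      set t : ℝ := Q / 16 ^ j with ht
      have ht0 : 0 < t := by positivity
      have ht64 : t ≤ 1 / 64 := (div_le_self hQ0.le h16).trans hQ64
      have hσ0 : 0 < t ^ (1 / α) := Real.rpow_pos_of_pos ht0 _
      have hσ8 : t ^ (1 / α) ≤ 1 / 8 := by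
        calc t ^ (1 / α) ≤ t ^ (1 / 2 : ℝ) := by
              refine Real.rpow_le_rpow_of_exponent_ge ht0 (by linarith) ?_
              exact one_div_le_one_div_of_le hα0 hα2.le
          _ ≤ (1 / 64) ^ (1 / 2 : ℝ) := Real.rpow_le_rpow ht0.le ht64 (by norm_num)
          _ = 1 / 8 := by
              rw [show (1 / 64 : ℝ) = (1 / 8) ^ (2 : ℝ) by norm_num, ← Real.rpow_mul (by norm_num)]
              norm_num
      have h := hx j _ hσ0 hσ8
      have hσα : (t ^ (1 / α)) ^ α = t := by
        rw [← Real.rpow_mul ht0.le, one_div_mul_cancel hα0.ne', Real.rpow_one]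
      have hσN : (t ^ (1 / α)) ^ N = Q ^ p / (16 ^ p) ^ j := by
        rw [← Real.rpow_natCast, ← Real.rpow_mul ht0.le, one_div_mul_eq_div, ← hp, ht,
          Real.div_rpow hQ0.le h160.le, ← Real.rpow_natCast, ← Real.rpow_natCast,
          ← Real.rpow_mul (by norm_num), ← Real.rpow_mul (by norm_num), mul_comm]
      rw [hσα, hσN] at h
      have hqj : 0 < q ^ j := by positivity
      have hone : (16 : ℝ) ^ j * (16 ^ p) ^ j * q ^ j = 1 := by
        rw [← mul_pow, ← mul_pow, hqmul, one_pow]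
      calc x (j + 1) ≤ C * 16 ^ j * (t * x j + x j ^ 2 / (Q ^ p / (16 ^ p) ^ j)) := h
        _ = C * 16 ^ j * (t + x j * (16 ^ p) ^ j / Q ^ p) * x j := by field_simp
        _ ≤ C * 16 ^ j * (t + (Q * Q ^ p * q ^ j) * (16 ^ p) ^ j / Q ^ p) *
              (Q * Q ^ p * q ^ j) := by gcongr; exact hx0 j
        _ = (C * Q + C * Q * (16 ^ j * (16 ^ p) ^ j * q ^ j)) * (Q * Q ^ p * q ^ j) := by
            rw [ht]; field_simp
        _ = q * (Q * Q ^ p * q ^ j) := by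
            rw [hone, hQ]; field_simp; ring
        _ = Q * Q ^ p * q ^ (j + 1) := by ring
  refine squeeze_zero hx0 hind ?_
  have := (tendsto_pow_atTop_nhds_zero_of_lt_one hq0.le hq1).const_mul (Q * Q ^ p)
  simpa using this

/-- One step of the De Giorgi iteration. -/
theorem measure_sublevel_le (hJ : IsJumpMeasure μ J) (hd : DecayBound μ α C₂) (hα2 : α < 2)
    (hC₂ : 1 ≤ C₂) (hP : PoincareInequality μ E α C₁)
    (h : IsNonnegSolutionOn μ E w x₀ r M T τ) (hab : a < b) (hb : b ≤ r / 4) {k k' s : ℝ}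
    (hk : 0 ≤ k) (hkk' : k' < k) (hs : 0 < s) (hs8 : s ≤ r / 8) :
    ENNReal.ofReal ((k - k') ^ 2) * volume {x | x ∈ ball x₀ a ∧ w x < k'} ≤
      2 * (ENNReal.ofReal (C₁ * s ^ α) * (2 * ((ENNReal.ofReal (k ^ 2) *
        ENNReal.ofReal (levyConst α C₂ / (b - a) ^ α) + ENNReal.ofReal k * τ) *
          volume {x | x ∈ ball x₀ b ∧ w x < k})) +
        (ENNReal.ofReal k * volume {x | x ∈ ball x₀ b ∧ w x < k}) *
          (ENNReal.ofReal k * volume {x | x ∈ ball x₀ b ∧ w x < k}) /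
            volume (ball (0 : Space N) s)) := by
  have hr := h.pos
  have hw := h.sol.aemeasurable
  set A₀ := {x | x ∈ ball x₀ b ∧ w x < k} with hA₀
  -- `w` is only almost everywhere measurable, so the sublevel set is replaced by a measurable hull
  -- of the same measure.
  set A := toMeasurable volume A₀ ∩ ball x₀ b with hA
  have hAm : MeasurableSet A := (measurableSet_toMeasurable _ _).inter measurableSet_ball
  have hAb : A ⊆ ball x₀ b := inter_subset_right
  have hA₀A : A₀ ⊆ A := fun x hx => ⟨subset_toMeasurable _ _ hx, hx.1⟩
  have hAvol : volume A ≤ volume A₀ :=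
    (measure_mono inter_subset_left).trans (measure_toMeasurable _).le
  set f : Space N → ℝ := fun x => cutoff x₀ a b x * truncBelow k (w x) with hf
  have hf0 : ∀ x, 0 ≤ f x := fun x => mul_nonneg (cutoff_nonneg x) (truncBelow_nonneg _ _)
  have hfk : ∀ x, f x ≤ k := fun x => by
    calc f x ≤ 1 * k := mul_le_mul (cutoff_le_one x) (truncBelow_le hk _)
          (truncBelow_nonneg _ _) zero_le_one
      _ = k := one_mul k
  have hfH : MemH μ f := memH_mul_comp hJ hw h.energy (lipschitzWith_truncBelow k)
    (truncBelow_nonneg k) (truncBelow_le hk) measurable_cutoff cutoff_nonneg cutoff_le_one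
    (fun x hx => cutoff_eq_zero hab fun h' => hx (ball_subset_ball (by linarith) h'))
    (lintegral_cutoff_lt_top hJ hd hα2 hC₂ hab)
  have hfA : ∀ x, x ∉ A → f x = 0 := by
    intro x hx
    by_cases hxb : x ∈ ball x₀ b
    · have : truncBelow k (w x) = 0 :=
        truncBelow_eq_zero (not_lt.1 fun h' => hx (hA₀A ⟨hxb, h'⟩))
      simp [hf, this]
    · simp [hf, cutoff_eq_zero hab hxb]
  have hcacc := caccioppoli hJ hd hα2 hC₂ h hab (by linarith) hk hAm hAb
    fun x hx hxk => hA₀A ⟨hx, hxk⟩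
  -- A ball of radius `s ≤ r/8` meeting `B_b`, with `b ≤ r/4`, stays within `B_(r/2)(x₀)`.
  have hfk' := faberKrahn hJ hP hfH hf0 hfk hAm
    ((measure_mono hAb).trans_lt measure_ball_lt_top) hfA hs (by
      rintro z ⟨y, hyz, hyA⟩
      refine Subset.trans (fun x hx => ?_) h.subset
      have h1 := mem_ball.1 (hAb hyA)
      rw [mem_ball] at hx hyz
      rw [mem_closedBall]
      linarith [dist_triangle x z x₀, dist_triangle z y x₀, dist_comm z y])
  -- Chebyshev: where the cut-off is `1` and `w < k'`, the function `f` exceeds `k - k'`.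
  have hcheb : ENNReal.ofReal ((k - k') ^ 2) * volume {x | x ∈ ball x₀ a ∧ w x < k'} ≤
      ∫⁻ x, ENNReal.ofReal (f x ^ 2) := by
    refine le_trans (mul_le_mul_right (measure_mono_ae ?_) _) (mul_meas_ge_le_lintegral₀
      ((hfH.1.aestronglyMeasurable.aemeasurable.pow_const 2).ennreal_ofReal) _)
    filter_upwards [h.nonneg] with x hx hxA
    have hxr : x ∈ ball x₀ r := ball_subset_ball (by linarith) hxA.1
    have hwk : w x < k' := hxA.2
    change ENNReal.ofReal ((k - k') ^ 2) ≤ ENNReal.ofReal (f x ^ 2)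
    refine ENNReal.ofReal_le_ofReal (pow_le_pow_left₀ (by linarith) ?_ 2)
    simp only [hf]
    rw [cutoff_eq_one hab hxA.1, one_mul, truncBelow_eq_sub (hx hxr) (by linarith)]
    linarith
  refine hcheb.trans (hfk'.trans ?_)
  gcongr
  exact hcacc.trans (by gcongr)

/-- The measure-to-pointwise lemma. -/
theorem exists_deGiorgi_threshold (N : ℕ) {α C₁ C₂ : ℝ} (hα0 : 0 < α) (hα2 : α < 2)
    (hC₁ : 1 ≤ C₁) (hC₂ : 1 ≤ C₂) :
    ∃ ν : ℝ, 0 < ν ∧ ∀ (μ : Space N → Measure (Space N)) (J : Measure (Space N × Space N))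
      (E : Set (Space N)) (w : Space N → ℝ) (x₀ : Space N) (r M d : ℝ) (T : ℝ≥0∞),
      IsJumpMeasure μ J → DecayBound μ α C₂ → PoincareInequality μ E α C₁ → 0 < d →
      IsNonnegSolutionOn μ E w x₀ r M T (ENNReal.ofReal (d / r ^ α)) →
      volume {x | x ∈ ball x₀ (r / 4) ∧ w x < d} ≤ ENNReal.ofReal ν * volume (ball x₀ r) →
      ∀ᵐ x, x ∈ ball x₀ (r / 8) → d / 2 ≤ w x := by
  have hL := levyConst_pos hα2 hC₂
  set L := levyConst α C₂ with hLdef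
  -- `16384 = 16 · 2 · 2 · 256`: the level gap gives `16 · 4 ^ j`, the two estimates a factor `2`
  -- each, and the radius gap `256 · 4 ^ j`.
  have hC : 32 ≤ 16384 * C₁ * (L + 1) := by nlinarith
  obtain ⟨ν, hν, hseq⟩ := exists_threshold_tendsto_zero N hα0 hα2 hC
  refine ⟨ν, hν, fun μ J E w x₀ r M d T hJ hd hP hd0 h hmeas => ?_⟩
  have hr := h.pos
  -- Radii shrink from `r/4` to `r/8` and levels from `d` to `d/2`, both geometrically.
  set A : ℕ → Set (Space N) := fun j =>
    {x | x ∈ ball x₀ (r / 8 * (1 + (1 / 2) ^ j)) ∧ w x < d / 2 * (1 + (1 / 2) ^ j)} with hA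
  have hpow1 : ∀ j : ℕ, (1 / 2 : ℝ) ^ j ≤ 1 := fun j => pow_le_one₀ (by norm_num) (by norm_num)
  have hAfin : ∀ j, volume (A j) ≠ ∞ := fun j =>
    ((measure_mono fun x hx => hx.1).trans_lt
      (measure_ball_lt_top (x := x₀) (r := r / 8 * (1 + (1 / 2) ^ j)))).ne
  set V₁ : ℝ := (volume (ball (0 : Space N) 1)).toReal with hV₁
  have hV₁0 : 0 < V₁ :=
    ENNReal.toReal_pos (measure_ball_pos volume _ one_pos).ne' measure_ball_lt_top.ne
  have hV : ∀ (z : Space N) (s : ℝ), 0 < s → volume (ball z s) = ENNReal.ofReal (s ^ N * V₁) := by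
    intro z s hs
    rw [Measure.addHaar_ball_of_pos _ _ hs, finrank_euclideanSpace_fin, ENNReal.ofReal_mul (by positivity),
      hV₁, ENNReal.ofReal_toReal measure_ball_lt_top.ne]
  set y : ℕ → ℝ := fun j => (volume (A j)).toReal with hy
  have hy0 : ∀ j, 0 ≤ y j := fun j => ENNReal.toReal_nonneg
  have hyA : ∀ j, volume (A j) = ENNReal.ofReal (y j) := fun j =>
    (ENNReal.ofReal_toReal (hAfin j)).symm
  have hrα : 0 < r ^ α := Real.rpow_pos_of_pos hr _
  have hstep : ∀ (j : ℕ) (s : ℝ), 0 < s → s ≤ r / 8 →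
      (d / 2 ^ (j + 2)) ^ 2 * y (j + 1) ≤ 2 * (C₁ * s ^ α * (2 * ((d ^ 2 * (L * 4 ^ (j + 4) / r ^ α) +
        d * (d / r ^ α)) * y j)) + (d * y j) * (d * y j) / (s ^ N * V₁)) := by
    intro j s hs hs8
    have hj := hpow1 j
    have hj0 : (0 : ℝ) < (1 / 2) ^ j := by positivity
    have hb : r / 8 * (1 + (1 / 2) ^ j) ≤ r / 4 := by nlinarith
    have hab : r / 8 * (1 + (1 / 2) ^ (j + 1)) < r / 8 * (1 + (1 / 2) ^ j) := by
      rw [pow_succ]; nlinarith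
    have hkk : d / 2 * (1 + (1 / 2) ^ (j + 1)) < d / 2 * (1 + (1 / 2) ^ j) := by
      rw [pow_succ]; nlinarith
    have hk : 0 ≤ d / 2 * (1 + (1 / 2) ^ j) := by positivity
    have hkd : d / 2 * (1 + (1 / 2) ^ j) ≤ d := by nlinarith
    have := measure_sublevel_le hJ hd hα2 hC₂ hP h hab hb hk hkk hs hs8
    rw [show {x | x ∈ ball x₀ (r / 8 * (1 + (1 / 2) ^ j)) ∧ w x < d / 2 * (1 + (1 / 2) ^ j)} = A j
      from rfl, show {x | x ∈ ball x₀ (r / 8 * (1 + (1 / 2) ^ (j + 1))) ∧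
        w x < d / 2 * (1 + (1 / 2) ^ (j + 1))} = A (j + 1) from rfl, hyA, hyA, hV 0 s hs,
      show d / 2 * (1 + (1 / 2) ^ j) - d / 2 * (1 + (1 / 2) ^ (j + 1)) = d / 2 ^ (j + 2) by
        rw [pow_succ, pow_add, one_div_pow]; field_simp; ring,
      show r / 8 * (1 + (1 / 2) ^ j) - r / 8 * (1 + (1 / 2) ^ (j + 1)) = r / 2 ^ (j + 4) by
        rw [pow_succ, pow_add, one_div_pow]; field_simp; ring] at this
    have hyj := hy0 j
    have hpow : L / (r / 2 ^ (j + 4)) ^ α ≤ L * 4 ^ (j + 4) / r ^ α := by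
      rw [Real.div_rpow hr.le (by positivity), div_div_eq_mul_div]
      gcongr
      calc ((2 : ℝ) ^ (j + 4)) ^ α ≤ ((2 : ℝ) ^ (j + 4)) ^ (2 : ℝ) :=
            Real.rpow_le_rpow_of_exponent_le (one_le_pow₀ (by norm_num)) hα2.le
        _ = 4 ^ (j + 4) := by
            rw [Real.rpow_two, ← pow_mul, mul_comm, pow_mul]; norm_num
    have hC₁0 : 0 ≤ C₁ := by linarith
    have hsα : 0 < s ^ α := Real.rpow_pos_of_pos hs _
    have hsN : 0 < s ^ N * V₁ := by positivity
    have h2 : (2 : ℝ≥0∞) = ENNReal.ofReal 2 := by simp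
    set k := d / 2 * (1 + (1 / 2) ^ j)
    have hX : 0 ≤ L / (r / 2 ^ (j + 4)) ^ α := by positivity
    rw [← ENNReal.ofReal_mul (by positivity), ← ENNReal.ofReal_mul (by positivity),
      ← ENNReal.ofReal_mul hk, ← ENNReal.ofReal_mul hk, ← ENNReal.ofReal_mul (by positivity),
      ← ENNReal.ofReal_add (by positivity) (by positivity), ← ENNReal.ofReal_mul (by positivity),
      h2, ← ENNReal.ofReal_mul (by positivity), ← ENNReal.ofReal_mul (by positivity),
      ← ENNReal.ofReal_div_of_pos hsN, ← ENNReal.ofReal_add (by positivity) (by positivity),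
      ← ENNReal.ofReal_mul (by positivity), ENNReal.ofReal_le_ofReal_iff (by positivity)] at this
    refine this.trans ?_
    gcongr
  -- The recursion is applied to the densities of `A j` relative to `B_r`, with `σ = s / r`. The
  -- tail level `d / r ^ α` has the homogeneity that lets `d` drop out.
  have hlim := hseq (fun j => y j / (r ^ N * V₁)) (fun j => by have := hy0 j; positivity) ?_ ?_
  · have hyl : Filter.Tendsto y Filter.atTop (nhds 0) := by
      have := hlim.mul_const (r ^ N * V₁)
      rw [zero_mul] at this
      refine this.congr fun j => ?_
      field_simp
    have hnull : volume {x | x ∈ ball x₀ (r / 8) ∧ w x < d / 2} = 0 := by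
      have hsub : ∀ j, volume {x | x ∈ ball x₀ (r / 8) ∧ w x < d / 2} ≤ ENNReal.ofReal (y j) := by
        intro j
        rw [← hyA j]
        have hj0 : (0 : ℝ) < (1 / 2) ^ j := by positivity
        refine measure_mono fun x hx => ⟨ball_subset_ball ?_ hx.1, hx.2.trans_le ?_⟩ <;> nlinarith
      have hlim' := ENNReal.tendsto_ofReal hyl
      rw [ENNReal.ofReal_zero] at hlim'
      exact le_antisymm (ge_of_tendsto' hlim' hsub) zero_le
    filter_upwards [compl_mem_ae_iff.2 hnull] with x hx hxb
    exact not_lt.1 fun h' => hx ⟨hxb, h'⟩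
  · have h0 : A 0 = {x | x ∈ ball x₀ (r / 4) ∧ w x < d} := by
      simp only [hA, pow_zero]
      norm_num
      ring_nf
    rw [← h0, hyA, hV x₀ r hr, ← ENNReal.ofReal_mul hν.le,
      ENNReal.ofReal_le_ofReal_iff (by positivity)] at hmeas
    rw [div_le_iff₀ (by positivity)]
    exact hmeas
  · intro j σ hσ0 hσ8
    have hst := hstep j (σ * r) (by positivity) (by nlinarith)
    have hyj := hy0 j
    set X := y j / (r ^ N * V₁) with hX
    have hyX : y j = X * (r ^ N * V₁) := by rw [hX]; field_simp
    have hX0 : 0 ≤ X := by positivity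
    have hσα : 0 < σ ^ α := Real.rpow_pos_of_pos hσ0 _
    rw [Real.mul_rpow hσ0.le hr.le, mul_pow] at hst
    have h4 : (1 : ℝ) ≤ 4 ^ (j + 4) := one_le_pow₀ (by norm_num)
    have h44 : (4 : ℝ) ^ (j + 4) = 256 * 4 ^ j := by rw [pow_add]; norm_num; ring
    have h416 : (4 : ℝ) ^ j * 4 ^ j = 16 ^ j := by rw [← mul_pow]; norm_num
    have h2 : ((2 : ℝ) ^ (j + 2)) ^ 2 = 16 * 4 ^ j := by
      rw [← pow_mul, mul_comm, pow_mul, pow_add]; norm_num; ring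
    have h1 : y (j + 1) ≤ 16 * 4 ^ j * (2 * (C₁ * σ ^ α * (2 * ((L * 4 ^ (j + 4) + 1) * y j)) +
        y j * y j / (σ ^ N * r ^ N * V₁))) := by
      have e1 : (d / 2 ^ (j + 2)) ^ 2 * y (j + 1) = d ^ 2 * (y (j + 1) / (16 * 4 ^ j)) := by
        rw [div_pow, h2]; ring
      have e2 : 2 * (C₁ * (σ ^ α * r ^ α) * (2 * ((d ^ 2 * (L * 4 ^ (j + 4) / r ^ α) +
          d * (d / r ^ α)) * y j)) + (d * y j) * (d * y j) / (σ ^ N * r ^ N * V₁)) =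
          d ^ 2 * (2 * (C₁ * σ ^ α * (2 * ((L * 4 ^ (j + 4) + 1) * y j)) +
        y j * y j / (σ ^ N * r ^ N * V₁))) := by
        field_simp
      rw [e1, e2] at hst
      have := le_of_mul_le_mul_left hst (by positivity)
      rwa [div_le_iff₀ (by positivity), mul_comm] at this
    rw [div_le_iff₀ (by positivity)]
    have hmid : L * 4 ^ (j + 4) + 1 ≤ (L + 1) * (256 * 4 ^ j) := by
      rw [← h44]; nlinarith
    calc y (j + 1) ≤ 16 * 4 ^ j * (2 * (C₁ * σ ^ α * (2 * (((L + 1) * (256 * 4 ^ j)) * y j)) +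
        y j * y j / (σ ^ N * r ^ N * V₁))) := by
          refine h1.trans ?_
          gcongr
      _ = (16384 * C₁ * (L + 1) * (4 ^ j * 4 ^ j) * (σ ^ α * X) +
            32 * 4 ^ j * (X ^ 2 / σ ^ N)) * (r ^ N * V₁) := by
          rw [hyX]; field_simp; ring
      _ ≤ (16384 * C₁ * (L + 1) * 16 ^ j * (σ ^ α * X) +
            16384 * C₁ * (L + 1) * 16 ^ j * (X ^ 2 / σ ^ N)) * (r ^ N * V₁) := by
          rw [h416]
          gcongr
          norm_num
      _ = 16384 * C₁ * (L + 1) * 16 ^ j * (σ ^ α * X + X ^ 2 / σ ^ N) * (r ^ N * V₁) := by ring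

end NonlocalHolder

/-! ### Expansion of positivity -/

namespace NonlocalHolder

variable {N : ℕ} {μ : Space N → Measure (Space N)} {α C₁ C₂ : ℝ}
  {J : Measure (Space N × Space N)} {E : Set (Space N)} {u w : Space N → ℝ} {x₀ : Space N}
  {r a b M : ℝ} {T τ : ℝ≥0∞}

/-- If `v` vanishes on at least half of `B` and is at least `ℓ` on `S`, then the measure of `S` is
controlled by the mean square deviation of `v` from any constant. -/
theorem measure_le_of_sq_deviation {v : Space N → ℝ} (hv : AEMeasurable v volume)
    {B S H : Set (Space N)} (hB : MeasurableSet B) (hSB : S ⊆ B) (hHB : H ⊆ B)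
    (hH : volume B ≤ 2 * volume H) {ℓ : ℝ} (hℓ : 0 ≤ ℓ) (hS : ∀ x ∈ S, ℓ ≤ v x)
    (hHv : ∀ x ∈ H, v x = 0) (c : ℝ) :
    ENNReal.ofReal (ℓ ^ 2 / 8) * volume S ≤ ∫⁻ x in B, ENNReal.ofReal ((v x - c) ^ 2) := by
  have key : ∀ S' ⊆ B, (∀ x ∈ S', ℓ ^ 2 / 4 ≤ (v x - c) ^ 2) →
      ENNReal.ofReal (ℓ ^ 2 / 4) * volume S' ≤ ∫⁻ x in B, ENNReal.ofReal ((v x - c) ^ 2) := by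
    intro S' hS'B hS'
    refine le_trans (mul_le_mul_right ?_ _) (mul_meas_ge_le_lintegral₀
      (((hv.sub_const c).pow_const 2).ennreal_ofReal.restrict) _)
    rw [Measure.restrict_apply' hB]
    exact measure_mono fun x hx => ⟨ENNReal.ofReal_le_ofReal (hS' x hx), hS'B hx⟩
  -- The constant `c` is at distance at least `ℓ/2` either from all values on `S` or from the value
  -- `0` taken on `H`; the second case costs a further factor `2`.
  rcases le_total c (ℓ / 2) with hc | hc
  · refine le_trans (mul_le_mul_left (ENNReal.ofReal_le_ofReal ?_) _) (key S hSB fun x hx => ?_)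
    · nlinarith [sq_nonneg ℓ]
    · have := hS x hx
      nlinarith
  · have h1 := key H hHB fun x hx => by rw [hHv x hx]; nlinarith
    refine le_trans ?_ h1
    calc ENNReal.ofReal (ℓ ^ 2 / 8) * volume S ≤ ENNReal.ofReal (ℓ ^ 2 / 8) * (2 * volume H) :=
          mul_le_mul_right ((measure_mono hSB).trans hH) _
      _ = ENNReal.ofReal (ℓ ^ 2 / 4) * volume H := by
          rw [← mul_assoc, show ℓ ^ 2 / 4 = ℓ ^ 2 / 8 * 2 by ring,
            ENNReal.ofReal_mul (p := ℓ ^ 2 / 8) (by positivity), ENNReal.ofReal_ofNat]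

/-- Expansion of positivity. -/
theorem exists_growth_const (N : ℕ) {α C₁ C₂ : ℝ} (hα0 : 0 < α) (hα2 : α < 2)
    (hC₁ : 1 ≤ C₁) (hC₂ : 1 ≤ C₂) :
    ∃ d : ℝ, 0 < d ∧ ∀ (μ : Space N → Measure (Space N)) (J : Measure (Space N × Space N))
      (E : Set (Space N)) (w : Space N → ℝ) (x₀ : Space N) (r M : ℝ) (T : ℝ≥0∞),
      IsJumpMeasure μ J → DecayBound μ α C₂ → PoincareInequality μ E α C₁ →
      Bornology.IsBounded E →
      IsNonnegSolutionOn μ E w x₀ r M T (ENNReal.ofReal (d / r ^ α)) →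
      volume (ball x₀ (r / 4)) ≤ 2 * volume {x | x ∈ ball x₀ (r / 4) ∧ 1 ≤ w x} →
      ∀ᵐ x, x ∈ ball x₀ (r / 8) → d / 2 ≤ w x := by
  obtain ⟨ν, hν, hDG⟩ := exists_deGiorgi_threshold N hα0 hα2 hC₁ hC₂
  have hL := levyConst_pos hα2 hC₂
  set L := levyConst α C₂ with hLdef
  -- Large enough that the bound `2 C₁ (L + 1)` obtained below, divided by `ℓ² / 8`, is at most the
  -- De Giorgi threshold `ν`.
  set ℓ : ℝ := Real.sqrt (16 * C₁ * (L + 1) / ν) + 1 with hℓ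
  have hq : 0 ≤ 16 * C₁ * (L + 1) / ν := by positivity
  have hℓ1 : 1 ≤ ℓ := by rw [hℓ]; linarith [Real.sqrt_nonneg (16 * C₁ * (L + 1) / ν)]
  have hℓsq : 16 * C₁ * (L + 1) / ν ≤ ℓ ^ 2 := by
    rw [← Real.sq_sqrt hq]
    exact pow_le_pow_left₀ (Real.sqrt_nonneg _) (by rw [hℓ]; linarith) 2
  -- Then `-log (2 d) = ℓ`, which is a lower bound for `v` on `{w < d}`, while `v = 0` on `{w ≥ 1}`.
  set d : ℝ := Real.exp (-ℓ) / 2 with hd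
  have hd0 : 0 < d := by positivity
  have hlog : -Real.log (2 * d) = ℓ := by
    rw [hd, mul_div_cancel₀ _ two_ne_zero, Real.log_exp, neg_neg]
  refine ⟨d, hd0, fun μ J E w x₀ r M T hJ hdec hP hE h hhalf => ?_⟩
  have hr := h.pos
  have hw := h.sol.aemeasurable
  refine hDG μ J E w x₀ r M d T hJ hdec hP hd0 h ?_
  set v : Space N → ℝ := fun x => negLog d (w x) with hv
  have hvm : AEMeasurable v volume :=
    (lipschitzWith_negLog hd0).continuous.measurable.comp_aemeasurable hw
  have hvb : ∀ t, |negLog d t| ≤ max 0 (-Real.log d) := fun t => by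
    rw [abs_of_nonneg (negLog_nonneg t)]; exact negLog_le hd0 t
  have hvH : MemHLoc μ E v := h.sol.memHLoc_comp hE (lipschitzWith_negLog hd0) hvb
  have hsub : ball x₀ (r / 4) ⊆ E :=
    (ball_subset_closedBall.trans (closedBall_subset_closedBall (by linarith))).trans h.subset
  have hvi : IntegrableOn v (ball x₀ (r / 4)) volume := by
    have hfin : IsFiniteMeasure (volume.restrict (ball x₀ (r / 4))) := ⟨by
      rw [Measure.restrict_apply_univ]; exact measure_ball_lt_top⟩
    exact Integrable.of_bound hvm.aestronglyMeasurable.restrict _ (ae_of_all _ fun x => hvb _)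
  have hPo := hP x₀ (r / 4) (by positivity) hsub v hvH hvi
  have hlogest := log_estimate hJ hdec hα2 hC₂ h (show r / 4 < r / 2 by linarith)
    (show r / 2 ≤ 7 / 8 * r by linarith) hd0
  have hdev := measure_le_of_sq_deviation (S := {x | x ∈ ball x₀ (r / 4) ∧ w x < d})
    (H := {x | x ∈ ball x₀ (r / 4) ∧ 1 ≤ w x}) hvm measurableSet_ball (fun x hx => hx.1)
    (fun x hx => hx.1) hhalf (show 0 ≤ ℓ by linarith)
    (fun x hx => hlog ▸ neg_log_two_mul_le_negLog hd0 hx.2.le)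
    (fun x hx => negLog_eq_zero hd0 hx.2) (⨍ z in ball x₀ (r / 4), v z)
  have hrα : 0 < r ^ α := Real.rpow_pos_of_pos hr _
  have hr4α : 0 < (r / 4) ^ α := Real.rpow_pos_of_pos (by positivity) _
  have hr4 : (r / 4) ^ α ≤ r ^ α := Real.rpow_le_rpow (by positivity) (by linarith) hα0.le
  have hC₁0 : 0 < C₁ := by linarith
  -- The tail is of size `d / r ^ α`, so it cancels the factor `d⁻¹` of the logarithmic estimate.
  -- The bound is free of `d`, which is why `ℓ`, and then `d`, could be fixed in advance.
  have hbound : ENNReal.ofReal (ℓ ^ 2 / 8) * volume {x | x ∈ ball x₀ (r / 4) ∧ w x < d} ≤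
      ENNReal.ofReal (2 * C₁ * (L + 1)) * volume (ball x₀ r) := by
    calc ENNReal.ofReal (ℓ ^ 2 / 8) * volume {x | x ∈ ball x₀ (r / 4) ∧ w x < d}
        ≤ ENNReal.ofReal (C₁ * (r / 4) ^ α) *
          (2 * ((ENNReal.ofReal (L / (r / 2 - r / 4) ^ α) +
            ENNReal.ofReal d⁻¹ * ENNReal.ofReal (d / r ^ α)) * volume (ball x₀ (r / 2)))) :=
          hdev.trans (hPo.trans (mul_le_mul_right hlogest _))
      _ = ENNReal.ofReal (C₁ * (r / 4) ^ α * (2 * (L / (r / 4) ^ α + d⁻¹ * (d / r ^ α)))) *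
            volume (ball x₀ (r / 2)) := by
          rw [show r / 2 - r / 4 = r / 4 by ring, ← ENNReal.ofReal_mul (by positivity),
            ← ENNReal.ofReal_add (by positivity) (by positivity),
            ENNReal.ofReal_mul (p := C₁ * (r / 4) ^ α) (by positivity),
            ENNReal.ofReal_mul (p := 2) (by norm_num)]
          simp only [ENNReal.ofReal_ofNat]
          ring
      _ ≤ _ := by
          refine mul_le_mul' (ENNReal.ofReal_le_ofReal ?_)
            (measure_mono (ball_subset_ball (by linarith)))
          have h1 : C₁ * (r / 4) ^ α * (2 * (L / (r / 4) ^ α + d⁻¹ * (d / r ^ α))) =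
              2 * C₁ * (L + (r / 4) ^ α / r ^ α) := by
            field_simp
          rw [h1]
          gcongr
          exact (div_le_one hrα).2 hr4
  have hcoef : 2 * C₁ * (L + 1) ≤ ℓ ^ 2 / 8 * ν := by
    rw [div_le_iff₀ hν] at hℓsq
    linarith
  have hℓ8 : 0 < ℓ ^ 2 / 8 := by positivity
  refine (ENNReal.mul_le_mul_iff_right (ENNReal.ofReal_pos.2 hℓ8).ne' ENNReal.ofReal_ne_top).1
    (hbound.trans ?_)
  rw [← mul_assoc, ← ENNReal.ofReal_mul hℓ8.le]
  gcongr

theorem IsWeakHarmonic.affine (hu : IsWeakHarmonic μ E u) (c b : ℝ) :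
    IsWeakHarmonic μ E fun x => c * u x + b where
  aemeasurable := (hu.aemeasurable.const_mul c).add_const b
  energy D hD hDE := by
    have h := ENNReal.mul_lt_top (a := ENNReal.ofReal (c ^ 2)) ENNReal.ofReal_lt_top
      (hu.energy D hD hDE)
    refine lt_of_le_of_lt (le_of_eq ?_) h
    rw [quadForm, quadForm, ← lintegral_const_mul' _ _ ENNReal.ofReal_ne_top]
    refine lintegral_congr fun x => ?_
    rw [← lintegral_const_mul' _ _ ENNReal.ofReal_ne_top]
    refine lintegral_congr fun y => ?_
    rw [← ENNReal.ofReal_mul (by positivity)]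
    congr 1; ring
  weak φ hφ hφ0 hφE := by
    have h := hu.weak φ hφ hφ0 hφE
    have h' : bilinForm μ (fun x => c * u x + b) φ = c * bilinForm μ u φ := by
      rw [bilinForm, bilinForm, ← integral_const_mul]
      refine integral_congr_ae (ae_of_all _ fun x => ?_)
      simp only
      rw [← integral_const_mul]
      refine integral_congr_ae (ae_of_all _ fun y => ?_)
      simp only
      ring
    rw [h', h, mul_zero]

/-! ### Reduction of oscillation -/

/-- On `B_r(x₀)` the function `u` takes values in `[m, m + ω]`, and the tails of the parts of `u`
outside this interval are small. -/
structure OscControl (μ : Space N → Measure (Space N)) (α ε : ℝ) (u : Space N → ℝ) (x₀ : Space N)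
    (r ω m : ℝ) : Prop where
  lower : ∀ᵐ x, x ∈ ball x₀ r → m ≤ u x
  upper : ∀ᵐ x, x ∈ ball x₀ r → u x ≤ m + ω
  tailLower : ∀ᵐ x, x ∈ ball x₀ (7 / 8 * r) →
    ∫⁻ y in (ball x₀ r)ᶜ, ENNReal.ofReal (m - u y) ∂(μ x) ≤ ENNReal.ofReal (ε * ω / r ^ α)
  tailUpper : ∀ᵐ x, x ∈ ball x₀ (7 / 8 * r) →
    ∫⁻ y in (ball x₀ r)ᶜ, ENNReal.ofReal (u y - (m + ω)) ∂(μ x) ≤ ENNReal.ofReal (ε * ω / r ^ α)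

theorem OscControl.neg {ε ω m : ℝ} (h : OscControl μ α ε u x₀ r ω m) :
    OscControl μ α ε (fun x => -u x) x₀ r ω (-m - ω) where
  lower := h.upper.mono fun x hx hxr => by linarith [hx hxr]
  upper := h.lower.mono fun x hx hxr => by linarith [hx hxr]
  tailLower := h.tailUpper.mono fun x hx hxr => by
    refine le_trans (le_of_eq (lintegral_congr fun y => ?_)) (hx hxr)
    congr 1; ring
  tailUpper := h.tailLower.mono fun x hx hxr => by
    refine le_trans (le_of_eq (lintegral_congr fun y => ?_)) (hx hxr)
    congr 1; ring

/-- For almost every `x` the measure `μ x` ignores the null set where `g` fails to vanish on the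
ball. This lets a tail over the complement of a large ball control those of smaller balls. -/
theorem ae_setLIntegral_le_compl_ball (hs : IsSymmetricFamily μ) {g : Space N → ℝ≥0∞}
    (hg : ∀ᵐ x, x ∈ ball x₀ r → g x = 0) :
    ∀ᵐ x, ∀ S : Set (Space N), ∫⁻ y in S, g y ∂(μ x) ≤ ∫⁻ y in (ball x₀ r)ᶜ, g y ∂(μ x) := by
  filter_upwards [ae_measure_null_diff hs (ae_iff.1 hg)] with x hx S
  refine (setLIntegral_le_lintegral _ _).trans ?_
  rw [← lintegral_add_compl _ (measurableSet_ball (x := x₀) (ε := r)),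
    lintegral_eq_zero_of_ae_eq_zero, zero_add]
  rw [Filter.EventuallyEq, ae_restrict_iff' measurableSet_ball]
  exact ae_iff.2 hx

theorem compl_ball_measure_le (hd : DecayBound μ α C₂) {x : Space N} {s t : ℝ} (ht : 0 < t)
    (hx : x ∈ ball x₀ s) (hst : s + t ≤ r) :
    μ x (ball x₀ r)ᶜ ≤ ENNReal.ofReal (C₂ / t ^ α) := by
  refine (measure_mono (compl_subset_compl.2 fun y hy => ?_)).trans (hd x t ht)
  rw [mem_ball] at *
  linarith [dist_triangle y x x₀]

end NonlocalHolder

namespace NonlocalHolder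

variable {N : ℕ} {μ : Space N → Measure (Space N)} {α C₁ C₂ : ℝ}
  {J : Measure (Space N × Space N)} {E : Set (Space N)} {u w : Space N → ℝ} {x₀ : Space N}
  {r a b M : ℝ} {T τ : ℝ≥0∞}

/-- Normalisation of `u` on a ball where it takes values in `[m, m + ω]`. -/
theorem OscControl.isNonnegSolutionOn (hd : DecayBound μ α C₂) (hr : 0 < r)
    (hball : closedBall x₀ r ⊆ E) (hu : IsWeakHarmonic μ E u) (hT : T < ∞)
    (htail : ∀ᵐ x, x ∈ ball x₀ (7 / 8 * r) →
      ∫⁻ y in (ball x₀ r)ᶜ, ENNReal.ofReal |u y| ∂(μ x) ≤ T)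
    {ε ω m : ℝ} (hω : 0 < ω) (h : OscControl μ α ε u x₀ r ω m) :
    ∃ T' : ℝ≥0∞, IsNonnegSolutionOn μ E (fun x => 2 / ω * u x + -(2 / ω * m)) x₀ r 2 T'
      (ENNReal.ofReal (2 * ε / r ^ α)) := by
  have hω2 : 0 < 2 / ω := by positivity
  refine ⟨ENNReal.ofReal (2 / ω) * (T + ENNReal.ofReal |m| * ENNReal.ofReal (C₂ / (r / 8) ^ α)),
    hr, hball, hu.affine _ _, ?_, ?_, ?_, ?_, ?_⟩
  · filter_upwards [h.lower] with x hx hxr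
    have := mul_le_mul_of_nonneg_left (hx hxr) hω2.le
    linarith
  · filter_upwards [h.upper] with x hx hxr
    have := mul_le_mul_of_nonneg_left (hx hxr) hω2.le
    have h2 : 2 / ω * ω = 2 := by field_simp
    linarith
  · exact ENNReal.mul_lt_top ENNReal.ofReal_lt_top (ENNReal.add_lt_top.2
      ⟨hT, ENNReal.mul_lt_top ENNReal.ofReal_lt_top ENNReal.ofReal_lt_top⟩)
  · filter_upwards [htail] with x hx hxr
    have hpt : ∀ y, ENNReal.ofReal |2 / ω * u y + -(2 / ω * m)| ≤
        ENNReal.ofReal (2 / ω) * (ENNReal.ofReal |u y| + ENNReal.ofReal |m|) := by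
      intro y
      rw [← ENNReal.ofReal_add (abs_nonneg _) (abs_nonneg _), ← ENNReal.ofReal_mul hω2.le]
      refine ENNReal.ofReal_le_ofReal ?_
      rw [show 2 / ω * u y + -(2 / ω * m) = 2 / ω * (u y - m) by ring, abs_mul, abs_of_pos hω2]
      exact mul_le_mul_of_nonneg_left (abs_sub _ _) hω2.le
    refine (lintegral_mono hpt).trans ?_
    rw [lintegral_const_mul' _ _ ENNReal.ofReal_ne_top, lintegral_add_right _ measurable_const,
      setLIntegral_const]
    gcongr
    · exact hx hxr
    · exact compl_ball_measure_le hd (by positivity) hxr (by linarith)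
  · filter_upwards [h.tailLower] with x hx hxr
    calc ∫⁻ y in (ball x₀ r)ᶜ, ENNReal.ofReal (-(2 / ω * u y + -(2 / ω * m))) ∂(μ x)
        = ENNReal.ofReal (2 / ω) * ∫⁻ y in (ball x₀ r)ᶜ, ENNReal.ofReal (m - u y) ∂(μ x) := by
          rw [← lintegral_const_mul' _ _ ENNReal.ofReal_ne_top]
          refine lintegral_congr fun y => ?_
          rw [← ENNReal.ofReal_mul hω2.le]
          congr 1; ring
      _ ≤ ENNReal.ofReal (2 / ω) * ENNReal.ofReal (ε * ω / r ^ α) := mul_le_mul_right (hx hxr) _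
      _ = ENNReal.ofReal (2 * ε / r ^ α) := by
          rw [← ENNReal.ofReal_mul hω2.le]
          congr 1; field_simp

/-- Passing to a smaller ball and a smaller interval when the lower bound improves. -/
theorem OscControl.improve_lower (hs : IsSymmetricFamily μ) (hd : DecayBound μ α C₂)
    (hC₂ : 1 ≤ C₂) (hr : 0 < r) {ε ω m κ : ℝ} (hω : 0 < ω) (hε : 0 < ε)
    (hκ : 0 < κ) (hκε : κ * (C₂ * 64 ^ α + ε * 8 ^ α) ≤ ε * (8 ^ α - 1))
    (h : OscControl μ α ε u x₀ r ω m)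
    (himp : ∀ᵐ x, x ∈ ball x₀ (r / 8) → m + κ * ω ≤ u x) :
    OscControl μ α ε u x₀ (r / 8) ((1 - κ) * ω) (m + κ * ω) := by
  have hsub : ball x₀ (r / 8) ⊆ ball x₀ r := ball_subset_ball (by linarith)
  have hsub' : ball x₀ (7 / 8 * (r / 8)) ⊆ ball x₀ (7 / 8 * r) := ball_subset_ball (by linarith)
  have hrα : 0 < r ^ α := Real.rpow_pos_of_pos hr _
  have h8α : 0 < (8 : ℝ) ^ α := Real.rpow_pos_of_pos (by norm_num) _
  have h64α : 0 < (64 : ℝ) ^ α := Real.rpow_pos_of_pos (by norm_num) _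
  -- The right side carries the gain `8 ^ α` from shrinking the radius; it pays for raising the
  -- lower bound by `κ ω`. The `64` arises because points of `B_(7r/64)` have distance at least
  -- `r/64` from the complement of `B_(r/8)`.
  have hε1 : ε + κ * C₂ * 64 ^ α ≤ ε * (1 - κ) * 8 ^ α := by linarith
  have hr8 : ε * ((1 - κ) * ω) / (r / 8) ^ α = (ε * (1 - κ) * 8 ^ α) * (ω / r ^ α) := by
    rw [Real.div_rpow hr.le (by norm_num)]; field_simp
  have hpos : 0 < κ * C₂ * 64 ^ α := by positivity
  refine ⟨himp, ?_, ?_, ?_⟩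
  · filter_upwards [h.upper] with x hx hxr
    linarith [hx (hsub hxr)]
  · have hg : ∀ᵐ x, x ∈ ball x₀ r → ENNReal.ofReal (m - u x) = 0 := by
      filter_upwards [h.lower] with x hx hxr
      exact ENNReal.ofReal_of_nonpos (by linarith [hx hxr])
    filter_upwards [h.tailLower, ae_setLIntegral_le_compl_ball hs hg] with x hx hx' hxr
    calc ∫⁻ y in (ball x₀ (r / 8))ᶜ, ENNReal.ofReal (m + κ * ω - u y) ∂(μ x)
        ≤ ∫⁻ y in (ball x₀ (r / 8))ᶜ,
            (ENNReal.ofReal (m - u y) + ENNReal.ofReal (κ * ω)) ∂(μ x) := by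
          refine lintegral_mono fun y => ?_
          rw [show m + κ * ω - u y = (m - u y) + κ * ω by ring]
          exact ENNReal.ofReal_add_le
      _ = ∫⁻ y in (ball x₀ (r / 8))ᶜ, ENNReal.ofReal (m - u y) ∂(μ x) +
            ENNReal.ofReal (κ * ω) * μ x (ball x₀ (r / 8))ᶜ := by
          rw [lintegral_add_right _ measurable_const, setLIntegral_const]
      _ ≤ ENNReal.ofReal (ε * ω / r ^ α) +
            ENNReal.ofReal (κ * ω) * ENNReal.ofReal (C₂ / (r / 64) ^ α) := by
          gcongr
          · exact (hx' _).trans (hx (hsub' hxr))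
          · exact compl_ball_measure_le hd (by positivity) hxr (by linarith)
      _ = ENNReal.ofReal ((ε + κ * C₂ * 64 ^ α) * (ω / r ^ α)) := by
          rw [← ENNReal.ofReal_mul (by positivity),
            ← ENNReal.ofReal_add (by positivity) (by positivity),
            Real.div_rpow hr.le (by norm_num)]
          congr 1; field_simp
      _ ≤ ENNReal.ofReal (ε * ((1 - κ) * ω) / (r / 8) ^ α) := by
          rw [hr8]
          gcongr
  · have hg : ∀ᵐ x, x ∈ ball x₀ r → ENNReal.ofReal (u x - (m + ω)) = 0 := by
      filter_upwards [h.upper] with x hx hxr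
      exact ENNReal.ofReal_of_nonpos (by linarith [hx hxr])
    filter_upwards [h.tailUpper, ae_setLIntegral_le_compl_ball hs hg] with x hx hx' hxr
    rw [show m + κ * ω + (1 - κ) * ω = m + ω by ring]
    refine (hx' _).trans ((hx (hsub' hxr)).trans ?_)
    rw [hr8, show ε * ω / r ^ α = ε * (ω / r ^ α) by ring]
    gcongr
    linarith

/-- One step of the reduction of oscillation. -/
theorem exists_osc_step (N : ℕ) {α C₁ C₂ : ℝ} (hα0 : 0 < α) (hα2 : α < 2)
    (hC₁ : 1 ≤ C₁) (hC₂ : 1 ≤ C₂) :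
    ∃ κ ε : ℝ, 0 < κ ∧ κ ≤ 1 / 2 ∧ 0 < ε ∧
      ∀ (μ : Space N → Measure (Space N)) (J : Measure (Space N × Space N))
      (E : Set (Space N)) (u : Space N → ℝ) (x₀ : Space N) (r ω m : ℝ) (T : ℝ≥0∞),
      IsSymmetricFamily μ → IsJumpMeasure μ J → DecayBound μ α C₂ → PoincareInequality μ E α C₁ →
      Bornology.IsBounded E → 0 < r → closedBall x₀ r ⊆ E → IsWeakHarmonic μ E u → T < ∞ →
      (∀ᵐ x, x ∈ ball x₀ (7 / 8 * r) →
        ∫⁻ y in (ball x₀ r)ᶜ, ENNReal.ofReal |u y| ∂(μ x) ≤ T) → 0 < ω →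
      OscControl μ α ε u x₀ r ω m →
      ∃ m', OscControl μ α ε u x₀ (r / 8) ((1 - κ) * ω) m' := by
  obtain ⟨d, hd0, hgrowth⟩ := exists_growth_const N hα0 hα2 hC₁ hC₂
  have h8α : 1 < (8 : ℝ) ^ α := Real.one_lt_rpow (by norm_num) hα0
  have h64α : 0 < (64 : ℝ) ^ α := Real.rpow_pos_of_pos (by norm_num) _
  set D := C₂ * 64 ^ α + d / 2 * 8 ^ α with hD
  have hD0 : 0 < D := by positivity
  -- `d / 4` because `w ≥ d / 2` means `u - m ≥ (ω / 2)(d / 2)`; the last entry is the tail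
  -- condition of `OscControl.improve_lower` with `ε = d / 2`; `1 / 2` will keep the Hölder exponent
  -- below `1`.
  set κ := min (1 / 2) (min (d / 4) (d / 2 * (8 ^ α - 1) / D)) with hκ
  have hκ0 : 0 < κ := by
    refine lt_min (by norm_num) (lt_min (by positivity) ?_)
    have : 0 < (8 : ℝ) ^ α - 1 := by linarith
    positivity
  have hκ2 : κ ≤ 1 / 2 := min_le_left _ _
  have hκd : κ ≤ d / 4 := (min_le_right _ _).trans (min_le_left _ _)
  have hκD : κ * D ≤ d / 2 * (8 ^ α - 1) := by
    rw [← le_div_iff₀ hD0]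
    exact (min_le_right _ _).trans (min_le_right _ _)
  refine ⟨κ, d / 2, hκ0, hκ2, by positivity, ?_⟩
  intro μ J E u x₀ r ω m T hs hJ hd hP hE hr hball hu hT htail hω h
  have key : ∀ (u : Space N → ℝ) (m : ℝ), IsWeakHarmonic μ E u →
      (∀ᵐ x, x ∈ ball x₀ (7 / 8 * r) →
        ∫⁻ y in (ball x₀ r)ᶜ, ENNReal.ofReal |u y| ∂(μ x) ≤ T) →
      OscControl μ α (d / 2) u x₀ r ω m →
      volume (ball x₀ (r / 4)) ≤ 2 * volume {x | x ∈ ball x₀ (r / 4) ∧ m + ω / 2 ≤ u x} →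
      OscControl μ α (d / 2) u x₀ (r / 8) ((1 - κ) * ω) (m + κ * ω) := by
    intro u m hu htail h hhalf
    obtain ⟨T', hT'⟩ := h.isNonnegSolutionOn hd hr hball hu hT htail hω
    rw [show 2 * (d / 2) = d by ring] at hT'
    have hω2 : 0 < 2 / ω := by positivity
    have h1 : 2 / ω * (ω / 2) = 1 := by field_simp
    have hset : {x | x ∈ ball x₀ (r / 4) ∧ m + ω / 2 ≤ u x} ⊆
        {x | x ∈ ball x₀ (r / 4) ∧ 1 ≤ 2 / ω * u x + -(2 / ω * m)} := by
      intro x hx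
      have := mul_le_mul_of_nonneg_left hx.2 hω2.le
      exact ⟨hx.1, by linarith⟩
    have hgr := hgrowth μ J E _ x₀ r 2 T' hJ hd hP hE hT' (hhalf.trans
      (mul_le_mul_right (measure_mono hset) _))
    refine h.improve_lower hs hd hC₂ hr hω (by positivity) hκ0 hκD ?_
    filter_upwards [hgr] with x hx hxr
    have h2 := mul_le_mul_of_nonneg_left (hx hxr) (show 0 ≤ ω / 2 by positivity)
    have h3 : ω / 2 * (2 / ω * u x + -(2 / ω * m)) = u x - m := by field_simp; ring
    rw [h3] at h2
    have h4 := mul_le_mul_of_nonneg_right hκd hω.le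
    linarith
  -- Either `u` or `-u` lies in the upper half of its range on at least half of the ball, so the
  -- one-sided result applies to one of them.
  have hcover : volume (ball x₀ (r / 4)) ≤
      volume {x | x ∈ ball x₀ (r / 4) ∧ m + ω / 2 ≤ u x} +
        volume {x | x ∈ ball x₀ (r / 4) ∧ -m - ω + ω / 2 ≤ -u x} := by
    refine (measure_mono fun x hx => ?_).trans (measure_union_le _ _)
    rcases le_total (m + ω / 2) (u x) with h1 | h1
    · exact Or.inl ⟨hx, h1⟩
    · exact Or.inr ⟨hx, by linarith⟩
  rcases le_total (volume {x | x ∈ ball x₀ (r / 4) ∧ -m - ω + ω / 2 ≤ -u x})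
    (volume {x | x ∈ ball x₀ (r / 4) ∧ m + ω / 2 ≤ u x}) with hle | hle
  · refine ⟨_, key u m hu htail h (hcover.trans ?_)⟩
    rw [two_mul]
    gcongr
  · have hneg := key (fun x => -u x) (-m - ω) (by simpa using hu.affine (-1) 0)
      (by simpa using htail) h.neg (hcover.trans (by rw [two_mul]; gcongr))
    exact ⟨_, by simpa using hneg.neg⟩

theorem IsLocalWeakSolution.isWeakHarmonic (hu : IsLocalWeakSolution μ E u) :
    IsWeakHarmonic μ E u :=
  ⟨hu.1.1.measurable, fun D hD hDE => (hu.1.1.memHLoc D hD hDE).2, fun φ h1 h2 h3 =>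
    le_antisymm (hu.1.2 φ h1 h2 h3) (hu.2.2 φ h1 h2 h3)⟩

theorem ae_le_of_essSup_le {X : Type*} [MeasurableSpace X] {m : Measure X} {B : Set X}
    (hB : MeasurableSet B) {f : X → ℝ≥0∞} {c : ℝ≥0∞} (h : essSup f (m.restrict B) ≤ c) :
    ∀ᵐ x ∂m, x ∈ B → f x ≤ c :=
  (ae_restrict_iff' hB).1 ((ENNReal.ae_le_essSup f).mono fun _ hx => hx.trans h)

/-- Decay of oscillation, in terms of an upper bound `W` for `u` and its tail. -/
theorem exists_osc_decay (N : ℕ) {α C₁ C₂ : ℝ} (hα0 : 0 < α) (hα2 : α < 2)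
    (hC₁ : 1 ≤ C₁) (hC₂ : 1 ≤ C₂) :
    ∃ γ β : ℝ, 1 < γ ∧ 0 < β ∧ β < 1 ∧
      ∀ (μ : Space N → Measure (Space N)) (E : Set (Space N)) (u : Space N → ℝ) (x₀ : Space N)
      (ρ R W : ℝ), IsSymmetricFamily μ → DecayBound μ α C₂ → PoincareInequality μ E α C₁ →
      Bornology.IsBounded E → IsLocalWeakSolution μ E u → 0 < ρ → ρ < R → ball x₀ R ⊆ E →
      0 < W → (∀ᵐ x, x ∈ ball x₀ R → |u x| ≤ W / 2) →
      (∀ᵐ x, x ∈ ball x₀ (7 / 8 * R) →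
        ∫⁻ y in (ball x₀ R)ᶜ, ENNReal.ofReal |u y| ∂(μ x) ≤ ENNReal.ofReal (W / R ^ α)) →
      ∃ m : ℝ, ∀ᵐ x, x ∈ ball x₀ ρ → m ≤ u x ∧ u x ≤ m + γ * W * (ρ / R) ^ β := by
  obtain ⟨κ, ε, hκ0, hκ2, hε, hstep⟩ := exists_osc_step N hα0 hα2 hC₁ hC₂
  -- The iteration starts at radius `θ R`: `θ ^ α ≤ ε` turns the given tail bound into one with the
  -- small factor `ε`, and `θ ≤ 1/2` keeps closed balls inside `E`.
  set θ : ℝ := min (1 / 2) (ε ^ (1 / α)) with hθ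
  have hθ0 : 0 < θ := lt_min (by norm_num) (Real.rpow_pos_of_pos hε _)
  have hθ1 : θ ≤ 1 / 2 := min_le_left _ _
  have hθε : θ ^ α ≤ ε := by
    calc θ ^ α ≤ (ε ^ (1 / α)) ^ α := Real.rpow_le_rpow hθ0.le (min_le_right _ _) hα0.le
      _ = ε := by rw [← Real.rpow_mul hε.le, one_div_mul_cancel hα0.ne', Real.rpow_one]
  have hlog8 : Real.log (1 / 8) < 0 := Real.log_neg (by norm_num) (by norm_num)
  have hlogκ : Real.log (1 - κ) < 0 := Real.log_neg (by linarith) (by linarith)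
  -- The exponent with `(1/8) ^ β = 1 - κ`; it is below `1` since `1 - κ ≥ 1/2 > 1/8`.
  set β : ℝ := Real.log (1 - κ) / Real.log (1 / 8) with hβ
  have hβ0 : 0 < β := div_pos_of_neg_of_neg hlogκ hlog8
  have hβ1 : β < 1 := by
    rw [hβ, div_lt_one_of_neg hlog8]
    exact Real.log_lt_log (by norm_num) (by linarith)
  have hβκ : ((1 / 8 : ℝ)) ^ β = 1 - κ := by
    rw [Real.rpow_def_of_pos (by norm_num), hβ, mul_div_cancel₀ _ hlog8.ne,
      Real.exp_log (by linarith)]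
  -- The `8` allows for `ρ` lying between two consecutive radii, and `1 / θ` for starting at `θ R`.
  have hγ : 1 < 8 / θ := by rw [lt_div_iff₀ hθ0]; linarith
  refine ⟨8 / θ, β, hγ, hβ0, hβ1, ?_⟩
  intro μ E u x₀ ρ R W hs hd hP hE hu hρ hρR hball hW hub htail
  obtain ⟨J, hJ⟩ := exists_isJumpMeasure hs hd
  have hR : 0 < R := hρ.trans hρR
  have hRα : 0 < R ^ α := Real.rpow_pos_of_pos hR _
  have hθα : 0 < θ ^ α := Real.rpow_pos_of_pos hθ0 _
  set r := θ * R with hr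
  have hr0 : 0 < r := by positivity
  have hrR : r ≤ R / 2 := by rw [hr]; nlinarith
  have hsub : ball x₀ r ⊆ ball x₀ R := ball_subset_ball (by linarith)
  have hsub' : ball x₀ (7 / 8 * r) ⊆ ball x₀ (7 / 8 * R) := ball_subset_ball (by linarith)
  have htr : W / R ^ α ≤ ε * W / r ^ α := by
    rw [hr, Real.mul_rpow hθ0.le hR.le, div_le_div_iff₀ hRα (by positivity)]
    nlinarith [mul_le_mul_of_nonneg_right hθε (mul_pos hW hRα).le]
  have htail' : ∀ g : Space N → ℝ, (∀ y, g y ≤ |u y|) →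
      (∀ᵐ x, x ∈ ball x₀ R → ENNReal.ofReal (g x) = 0) → ∀ᵐ x, x ∈ ball x₀ (7 / 8 * r) →
      ∫⁻ y in (ball x₀ r)ᶜ, ENNReal.ofReal (g y) ∂(μ x) ≤ ENNReal.ofReal (ε * W / r ^ α) := by
    intro g hgu hg
    filter_upwards [htail, ae_setLIntegral_le_compl_ball hs hg] with x hx hx' hxr
    refine (hx' _).trans ?_
    refine (lintegral_mono fun y => ENNReal.ofReal_le_ofReal (hgu y)).trans ?_
    exact (hx (hsub' hxr)).trans (ENNReal.ofReal_le_ofReal htr)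
  have h0 : OscControl μ α ε u x₀ r W (-(W / 2)) := by
    refine ⟨?_, ?_, htail' _ (fun y => ?_) ?_, htail' _ (fun y => ?_) ?_⟩
    · filter_upwards [hub] with x hx hxr
      exact (abs_le.1 (hx (hsub hxr))).1
    · filter_upwards [hub] with x hx hxr
      linarith [(abs_le.1 (hx (hsub hxr))).2]
    · linarith [neg_abs_le (u y)]
    · filter_upwards [hub] with x hx hxr
      exact ENNReal.ofReal_of_nonpos (by linarith [(abs_le.1 (hx hxr)).1])
    · linarith [le_abs_self (u y)]
    · filter_upwards [hub] with x hx hxr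
      exact ENNReal.ofReal_of_nonpos (by linarith [(abs_le.1 (hx hxr)).2])
  have hiter : ∀ j : ℕ, ∃ m, OscControl μ α ε u x₀ (r * (1 / 8) ^ j) ((1 - κ) ^ j * W) m := by
    intro j
    induction j with
    | zero => exact ⟨_, by simpa using h0⟩
    | succ j ih =>
      obtain ⟨m, hm⟩ := ih
      have hj1 : (1 / 8 : ℝ) ^ j ≤ 1 := pow_le_one₀ (by norm_num) (by norm_num)
      have hrj : 0 < r * (1 / 8) ^ j := by positivity
      have hrjR : r * (1 / 8) ^ j < R := by nlinarith
      have hcb : closedBall x₀ (r * (1 / 8) ^ j) ⊆ E :=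
        (closedBall_subset_ball hrjR).trans hball
      -- Only finiteness of the full tail is needed at this scale; its size plays no role.
      have ht := hu.1.1.tail_lt_top x₀ (r * (1 / 8) ^ j) hrj
        (ball_subset_closedBall.trans hcb)
      have hωj : 0 < (1 - κ) ^ j * W := by
        have : 0 < 1 - κ := by linarith
        positivity
      obtain ⟨m', hm'⟩ := hstep μ J E u x₀ _ _ m _ hs hJ hd hP hE hrj hcb hu.isWeakHarmonic ht
        (ae_le_of_essSup_le measurableSet_ball le_rfl) hωj hm
      refine ⟨m', ?_⟩
      rw [pow_succ (1 / 8 : ℝ), pow_succ' (1 - κ), mul_assoc (1 - κ), ← mul_assoc r, mul_one_div]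
      exact hm'
  have hscale : (8 * (ρ / r)) ^ β * W ≤ 8 / θ * W * (ρ / R) ^ β := by
    have h1 : 8 * (ρ / r) = 8 / θ * (ρ / R) := by rw [hr]; field_simp
    rw [h1, Real.mul_rpow (by positivity) (by positivity)]
    have h2 : (8 / θ) ^ β ≤ 8 / θ := by
      conv_rhs => rw [← Real.rpow_one (8 / θ)]
      exact Real.rpow_le_rpow_of_exponent_le hγ.le hβ1.le
    have h3 : 0 ≤ (ρ / R) ^ β := by positivity
    calc (8 / θ) ^ β * (ρ / R) ^ β * W ≤ 8 / θ * (ρ / R) ^ β * W := by gcongr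
      _ = 8 / θ * W * (ρ / R) ^ β := by ring
  rcases le_or_gt r ρ with hrρ | hrρ
  · refine ⟨-(W / 2), ?_⟩
    have h1 : 1 ≤ (8 * (ρ / r)) ^ β := by
      refine Real.one_le_rpow ?_ hβ0.le
      have : 1 ≤ ρ / r := (one_le_div hr0).2 hrρ
      linarith
    filter_upwards [hub] with x hx hxρ
    have hx' := abs_le.1 (hx (ball_subset_ball hρR.le hxρ))
    refine ⟨hx'.1, ?_⟩
    nlinarith [mul_le_mul_of_nonneg_right h1 hW.le]
  · obtain ⟨n, hn1, hn2⟩ := exists_nat_pow_near_of_lt_one (show 0 < ρ / r by positivity)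
      ((div_le_one hr0).2 hrρ.le) (show (0 : ℝ) < 1 / 8 by norm_num) (by norm_num)
    obtain ⟨m, hm⟩ := hiter n
    refine ⟨m, ?_⟩
    have hρn : ρ ≤ r * (1 / 8) ^ n := by
      rw [div_le_iff₀ hr0] at hn2
      linarith
    have hle : (1 - κ) ^ n * W ≤ 8 / θ * W * (ρ / R) ^ β := by
      refine le_trans ?_ hscale
      gcongr
      rw [← hβκ, ← Real.rpow_natCast, ← Real.rpow_mul (by norm_num), mul_comm,
        Real.rpow_mul (by norm_num), Real.rpow_natCast]
      refine Real.rpow_le_rpow (by positivity) ?_ hβ0.le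
      rw [pow_succ] at hn1
      linarith
    filter_upwards [hm.lower, hm.upper] with x h1 h2 hxρ
    have hxn := ball_subset_ball hρn hxρ
    exact ⟨h1 hxn, (h2 hxn).trans (by linarith)⟩

end NonlocalHolder

/-! ### Hölder representative and conclusion -/

namespace NonlocalHolder

open Filter Topology

variable {N : ℕ} {μ : Space N → Measure (Space N)} {α C₁ C₂ : ℝ}
  {E : Set (Space N)} {u : Space N → ℝ} {x₀ : Space N}

theorem essSup_coe_le {X : Type*} [MeasurableSpace X] {m : Measure X} {f : X → ℝ} {c : ℝ}
    (h : ∀ᵐ x ∂m, f x ≤ c) : essSup (fun x => (f x : EReal)) m ≤ c :=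
  essSup_le_of_ae_le _ (h.mono fun _ hx => EReal.coe_le_coe_iff.2 hx)

theorem le_essInf_coe {X : Type*} [MeasurableSpace X] {m : Measure X} {f : X → ℝ} {c : ℝ}
    (h : ∀ᵐ x ∂m, c ≤ f x) : (c : EReal) ≤ essInf (fun x => (f x : EReal)) m :=
  le_essInf_of_ae_le _ (h.mono fun _ hx => EReal.coe_le_coe_iff.2 hx)

theorem essOsc_le {B : Set (Space N)} (hB : MeasurableSet B) {m c : ℝ}
    (h : ∀ᵐ x, x ∈ B → m ≤ u x ∧ u x ≤ m + c) : essOsc u B ≤ (c : EReal) := by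
  have h' := (ae_restrict_iff' hB).2 h
  refine (EReal.sub_le_sub (essSup_coe_le (h'.mono fun _ hx => hx.2))
    (le_essInf_coe (h'.mono fun _ hx => hx.1))).trans (le_of_eq ?_)
  rw [← EReal.coe_sub]
  congr 1; ring

theorem holderOnWith_of_dist_le {X : Type*} [PseudoMetricSpace X] {f : X → ℝ} {s : Set X}
    {C β : ℝ≥0} (h : ∀ x ∈ s, ∀ y ∈ s, |f x - f y| ≤ C * dist x y ^ (β : ℝ)) :
    HolderOnWith C β f s := by
  intro x hx y hy
  rw [edist_dist, edist_dist, ENNReal.ofReal_rpow_of_nonneg dist_nonneg β.coe_nonneg,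
    ← ENNReal.ofReal_coe_nnreal, ← ENNReal.ofReal_mul C.coe_nonneg, Real.dist_eq]
  exact ENNReal.ofReal_le_ofReal (h x hx y hy)

/-- A function which is locally Hölder continuous in `E` is so uniformly on compact sets. -/
theorem exists_holderOnWith_of_isCompact {X : Type*} [MetricSpace X] {v : X → ℝ} {E : Set X}
    {β : ℝ≥0} (hβ : 0 < β)
    (hloc : ∀ z ∈ E, ∃ δ > 0, ∃ C : ℝ≥0, ∀ x ∈ ball z δ, ∀ y ∈ ball z δ,
      |v x - v y| ≤ C * dist x y ^ (β : ℝ)) {K : Set X} (hK : IsCompact K) (hKE : K ⊆ E) :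
    ∃ C : ℝ≥0, HolderOnWith C β v K := by
  have hcont : ContinuousOn v K := by
    intro z hz
    obtain ⟨δ, hδ, C, hC⟩ := hloc z (hKE hz)
    have := (holderOnWith_of_dist_le hC).continuousOn hβ
    exact (this.continuousAt (ball_mem_nhds z hδ)).continuousWithinAt
  obtain ⟨M, hM⟩ := hK.exists_bound_of_continuousOn hcont
  choose! δ hδ C hC using hloc
  obtain ⟨t, htK, htc⟩ := hK.elim_nhds_subcover (fun z => ball z (δ z))
    fun z hz => ball_mem_nhds z (hδ z (hKE hz))
  have hcov : K ⊆ ⋃ z : t, ball (z : X) (δ z) := by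
    intro x hx
    obtain ⟨z, hz, hxz⟩ := mem_iUnion₂.1 (htc hx)
    exact mem_iUnion.2 ⟨⟨z, hz⟩, hxz⟩
  -- Pairs closer than the Lebesgue number lie in a common ball, where a local constant works; for
  -- the others boundedness of `v` on `K` suffices.
  obtain ⟨ε, hε, hleb⟩ := lebesgue_number_lemma_of_metric hK (fun z : t => isOpen_ball) hcov
  have hεβ : 0 < ε ^ (β : ℝ) := Real.rpow_pos_of_pos hε _
  set D : ℝ≥0 := ∑ z ∈ t, C z with hD
  set D' : ℝ≥0 := Real.toNNReal (2 * M / ε ^ (β : ℝ)) with hD'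
  refine ⟨D + D', holderOnWith_of_dist_le fun x hx y hy => ?_⟩
  have hd0 : 0 ≤ dist x y ^ (β : ℝ) := by positivity
  rw [NNReal.coe_add, add_mul]
  rcases lt_or_ge (dist x y) ε with hxy | hxy
  · obtain ⟨z, hz⟩ := hleb x hx
    have hzE : (z : X) ∈ E := hKE (htK z z.2)
    have h1 := hC z hzE x (hz (mem_ball_self hε)) y (hz (by rwa [mem_ball, dist_comm]))
    have h2 : (C z : ℝ) ≤ D := by
      exact_mod_cast Finset.single_le_sum (f := C) (fun _ _ => zero_le) z.2
    calc |v x - v y| ≤ C z * dist x y ^ (β : ℝ) := h1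
      _ ≤ D * dist x y ^ (β : ℝ) := by gcongr
      _ ≤ _ := le_add_of_nonneg_right (by positivity)
  · have h1 : |v x - v y| ≤ 2 * M := by
      have hx' := hM x hx
      have hy' := hM y hy
      rw [Real.norm_eq_abs] at hx' hy'
      linarith [abs_sub (v x) (v y)]
    have hM0 : 0 ≤ M := (norm_nonneg _).trans (hM x hx)
    have h2 : ε ^ (β : ℝ) ≤ dist x y ^ (β : ℝ) := Real.rpow_le_rpow hε.le hxy β.2
    calc |v x - v y| ≤ 2 * M := h1
      _ = D' * ε ^ (β : ℝ) := by
          rw [hD', Real.coe_toNNReal _ (by positivity)]; field_simp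
      _ ≤ D' * dist x y ^ (β : ℝ) := by gcongr
      _ ≤ _ := le_add_of_nonneg_left (by positivity)

/-- A function with local power decay of the oscillation on balls has a locally Hölder continuous
representative. -/
theorem exists_holder_representative (hE : IsOpen E) {β : ℝ≥0} (hβ : 0 < β) (hβ1 : β < 1)
    (hosc : ∀ z ∈ E, ∃ δ > 0, ∃ C : ℝ, 0 ≤ C ∧ ∀ p ∈ ball z δ, ∀ ρ : ℝ, 0 < ρ → ρ < 2 * δ →
      ∃ m : ℝ, ∀ᵐ x, x ∈ ball p ρ → m ≤ u x ∧ u x ≤ m + C * ρ ^ (β : ℝ)) :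
    ∃ v : Space N → ℝ, (∀ᵐ x ∂(volume.restrict E), v x = u x) ∧
      ∀ K : Set (Space N), IsCompact K → K ⊆ E → ∃ C : ℝ≥0, HolderOnWith C β v K := by
  set D := TopologicalSpace.denseSeq (Space N) with hD
  -- Countably many balls, so `G` has full measure and is dense; on `G`, essential bounds on these
  -- balls hold pointwise. The representative is the continuous extension from `G`.
  set G : Set (Space N) := {x | ∀ (n : ℕ) (q : ℚ), x ∈ ball (D n) q →
    essInf (fun x => (u x : EReal)) (volume.restrict (ball (D n) q)) ≤ u x ∧
    (u x : EReal) ≤ essSup (fun x => (u x : EReal)) (volume.restrict (ball (D n) q))} with hG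
  have hGae : ∀ᵐ x : Space N, x ∈ G := by
    refine ae_all_iff.2 fun n => ae_all_iff.2 fun q => ?_
    rw [← ae_restrict_iff' measurableSet_ball]
    filter_upwards [ae_le_essSup (f := fun x => (u x : EReal))
      (μ := volume.restrict (ball (D n) (q : ℝ))),
      ae_essInf_le (f := fun x => (u x : EReal))
      (μ := volume.restrict (ball (D n) (q : ℝ)))] with x h1 h2 using ⟨h2, h1⟩
  have hGd : Dense G := Measure.dense_of_ae hGae
  have hGloc : ∀ z ∈ E, ∃ δ > 0, ∃ C : ℝ≥0, ∀ x ∈ G ∩ ball z δ, ∀ y ∈ G ∩ ball z δ,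
      |u x - u y| ≤ C * dist x y ^ (β : ℝ) := by
    intro z hz
    obtain ⟨δ, hδ, C, hC0, hC⟩ := hosc z hz
    refine ⟨δ / 2, by positivity, Real.toNNReal (2 * C), ?_⟩
    rw [Real.coe_toNNReal _ (by positivity)]
    rintro x ⟨hxG, hx⟩ y ⟨hyG, hy⟩
    rcases eq_or_ne x y with rfl | hxy
    · have : 0 ≤ 2 * C * dist x x ^ (β : ℝ) := by positivity
      simpa using this
    set t := dist x y with ht
    have ht0 : 0 < t := dist_pos.2 hxy
    have htδ : t < δ := by
      rw [mem_ball] at hx hy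
      linarith [dist_triangle x z y, dist_comm y z]
    obtain ⟨n, hn⟩ := (TopologicalSpace.denseRange_denseSeq (Space N)).exists_dist_lt x
      (show 0 < t / 2 by positivity)
    -- The centre is within `t/2` of `x`, hence within `3t/2` of `y`, so radius `q` captures both
    -- points; `q < 2t` keeps the oscillation comparable to `t ^ β`.
    obtain ⟨q, hq1, hq2⟩ := exists_rat_btwn (show 3 / 2 * t < 2 * t by linarith)
    have hnz : D n ∈ ball z δ := by
      rw [mem_ball] at *
      linarith [dist_triangle (D n) x z, dist_comm x (D n)]
    have hxn : x ∈ ball (D n) (q : ℝ) := by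
      rw [mem_ball]; linarith
    have hyn : y ∈ ball (D n) (q : ℝ) := by
      rw [mem_ball]; linarith [dist_triangle y x (D n), dist_comm x y]
    obtain ⟨m, hm⟩ := hC (D n) hnz q (by linarith) (by linarith)
    have hm' := (ae_restrict_iff' measurableSet_ball).2 hm
    have hlo := le_essInf_coe (hm'.mono fun _ hx => hx.1)
    have hhi := essSup_coe_le (hm'.mono fun _ hx => hx.2)
    have hx1 := EReal.coe_le_coe_iff.1 (hlo.trans (hxG n q hxn).1)
    have hx2 := EReal.coe_le_coe_iff.1 ((hxG n q hxn).2.trans hhi)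
    have hy1 := EReal.coe_le_coe_iff.1 (hlo.trans (hyG n q hyn).1)
    have hy2 := EReal.coe_le_coe_iff.1 ((hyG n q hyn).2.trans hhi)
    have hq0 : (0 : ℝ) ≤ q := by linarith
    have hqt : (q : ℝ) ^ (β : ℝ) ≤ 2 * t ^ (β : ℝ) := by
      calc (q : ℝ) ^ (β : ℝ) ≤ (2 * t) ^ (β : ℝ) := Real.rpow_le_rpow hq0 hq2.le β.2
        _ = 2 ^ (β : ℝ) * t ^ (β : ℝ) := Real.mul_rpow (by norm_num) ht0.le
        _ ≤ 2 ^ (1 : ℝ) * t ^ (β : ℝ) := by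
            gcongr
            · norm_num
            · exact_mod_cast hβ1.le
        _ = 2 * t ^ (β : ℝ) := by rw [Real.rpow_one]
    have := mul_le_mul_of_nonneg_left hqt hC0
    rw [abs_le]
    constructor <;> linarith
  have hlim : ∀ z ∈ E, ∃ l, Tendsto u (𝓝[G] z) (𝓝 l) := by
    intro z hz
    obtain ⟨δ, hδ, C, hC⟩ := hGloc z hz
    have huc := (holderOnWith_of_dist_le hC).uniformContinuousOn hβ
    have hne : (𝓝[G] z).NeBot := mem_closure_iff_nhdsWithin_neBot.1 (hGd z)
    have hc : Cauchy (𝓝[G] z) := (cauchy_nhds).mono' hne nhdsWithin_le_nhds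
    refine cauchy_map_iff_exists_tendsto.1 (hc.map_of_le huc ?_)
    rw [le_principal_iff]
    exact inter_mem self_mem_nhdsWithin (nhdsWithin_le_nhds (ball_mem_nhds z hδ))
  have hext : ∀ z ∈ E, Tendsto u (𝓝[G] z) (𝓝 (extendFrom G u z)) := fun z hz =>
    tendsto_extendFrom (hlim z hz)
  refine ⟨extendFrom G u, ?_, fun K hK hKE => ?_⟩
  · have hE' : ∀ z ∈ E, z ∈ G → extendFrom G u z = u z := by
      intro z hz hzG
      obtain ⟨δ, hδ, C, hC⟩ := hGloc z hz
      have hco := (holderOnWith_of_dist_le hC).continuousOn hβ z ⟨hzG, mem_ball_self hδ⟩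
      refine extendFrom_eq (hGd z) ?_
      rwa [ContinuousWithinAt, nhdsWithin_inter_of_mem'
        (nhdsWithin_le_nhds (ball_mem_nhds z hδ))] at hco
    rw [ae_restrict_iff' hE.measurableSet]
    exact hGae.mono fun x hxG hx => hE' x hx hxG
  · refine exists_holderOnWith_of_isCompact hβ (fun z hz => ?_) hK hKE
    obtain ⟨δ, hδ, C, hC⟩ := hGloc z hz
    obtain ⟨δ', hδ', hzE⟩ := Metric.isOpen_iff.1 hE z hz
    refine ⟨min δ δ', lt_min hδ hδ', C, fun x hx y hy => ?_⟩
    have hxE := hzE (ball_subset_ball (min_le_right _ _) hx)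
    have hyE := hzE (ball_subset_ball (min_le_right _ _) hy)
    have hxδ := ball_subset_ball (min_le_left δ δ') hx
    have hyδ := ball_subset_ball (min_le_left δ δ') hy
    have hnx : (𝓝[G] x).NeBot := mem_closure_iff_nhdsWithin_neBot.1 (hGd x)
    have hny : (𝓝[G] y).NeBot := mem_closure_iff_nhdsWithin_neBot.1 (hGd y)
    have htx : Tendsto (fun p : Space N × Space N => u p.1) (𝓝[G] x ×ˢ 𝓝[G] y)
        (𝓝 (extendFrom G u x)) := (hext x hxE).comp tendsto_fst
    have hty : Tendsto (fun p : Space N × Space N => u p.2) (𝓝[G] x ×ˢ 𝓝[G] y)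
        (𝓝 (extendFrom G u y)) := (hext y hyE).comp tendsto_snd
    have hd1 : Tendsto (fun p : Space N × Space N => p.1) (𝓝[G] x ×ˢ 𝓝[G] y) (𝓝 x) :=
      (tendsto_id.mono_left nhdsWithin_le_nhds).comp tendsto_fst
    have hd2 : Tendsto (fun p : Space N × Space N => p.2) (𝓝[G] x ×ˢ 𝓝[G] y) (𝓝 y) :=
      (tendsto_id.mono_left nhdsWithin_le_nhds).comp tendsto_snd
    refine le_of_tendsto_of_tendsto (htx.sub hty).abs
      (((hd1.dist hd2).rpow_const (Or.inr β.2)).const_mul (C : ℝ)) ?_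
    have h1 : ∀ᶠ a in 𝓝[G] x, a ∈ G ∩ ball z δ :=
      inter_mem self_mem_nhdsWithin (nhdsWithin_le_nhds (isOpen_ball.mem_nhds hxδ))
    have h2 : ∀ᶠ b in 𝓝[G] y, b ∈ G ∩ ball z δ :=
      inter_mem self_mem_nhdsWithin (nhdsWithin_le_nhds (isOpen_ball.mem_nhds hyδ))
    filter_upwards [h1.prod_mk h2] with p hp using hC p.1 hp.1 p.2 hp.2

/-- Uniform decay of the oscillation on balls centred near a given point. -/
theorem exists_local_osc_decay {γ β : ℝ} (hγ : 1 < γ)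
    (hdecay : ∀ (x₀ : Space N) (ρ R W : ℝ), 0 < ρ → ρ < R → ball x₀ R ⊆ E → 0 < W →
      (∀ᵐ x, x ∈ ball x₀ R → |u x| ≤ W / 2) →
      (∀ᵐ x, x ∈ ball x₀ (7 / 8 * R) →
        ∫⁻ y in (ball x₀ R)ᶜ, ENNReal.ofReal |u y| ∂(μ x) ≤ ENNReal.ofReal (W / R ^ α)) →
      ∃ m : ℝ, ∀ᵐ x, x ∈ ball x₀ ρ → m ≤ u x ∧ u x ≤ m + γ * W * (ρ / R) ^ β)
    (hE : IsOpen E) (hs : IsSymmetricFamily μ) (hd : DecayBound μ α C₂) (hC₂ : 1 ≤ C₂)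
    (hu : IsLocalWeakSolution μ E u) (hb : IsLocallyBounded E u) {z : Space N} (hz : z ∈ E) :
    ∃ δ > 0, ∃ C : ℝ, 0 ≤ C ∧ ∀ p ∈ ball z δ, ∀ ρ : ℝ, 0 < ρ → ρ < 2 * δ →
      ∃ m : ℝ, ∀ᵐ x, x ∈ ball p ρ → m ≤ u x ∧ u x ≤ m + C * ρ ^ β := by
  obtain ⟨δ', hδ', hzE⟩ := Metric.isOpen_iff.1 hE z hz
  set δ := δ' / 5 with hδdef
  have hδ : 0 < δ := by positivity
  have hcE : closedBall z (4 * δ) ⊆ E :=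
    (closedBall_subset_ball (by rw [hδdef]; linarith)).trans hzE
  obtain ⟨M₀, hM₀⟩ := hb _ (isCompact_closedBall z (4 * δ)) hcE
  set M := max M₀ 0 with hM
  have hM0 : 0 ≤ M := le_max_right _ _
  have hMu : ∀ᵐ x, x ∈ ball z (4 * δ) → |u x| ≤ M := by
    filter_upwards [(ae_restrict_iff' measurableSet_closedBall).1 hM₀] with x hx hxb
    exact (hx (ball_subset_closedBall hxb)).trans (le_max_left _ _)
  have hTfin := hu.1.1.tail_lt_top z (4 * δ) (by positivity) (ball_subset_closedBall.trans hcE)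
  set T := essSup (fun x => ∫⁻ y in (ball z (4 * δ))ᶜ, ENNReal.ofReal |u y| ∂(μ x))
    (volume.restrict (ball z (7 / 8 * (4 * δ)))) with hT
  have hTae : ∀ᵐ x, x ∈ ball z (7 / 8 * (4 * δ)) →
      ∫⁻ y in (ball z (4 * δ))ᶜ, ENNReal.ofReal |u y| ∂(μ x) ≤ T :=
    ae_le_of_essSup_le measurableSet_ball le_rfl
  have hδα : 0 < (δ / 4) ^ α := Real.rpow_pos_of_pos (by positivity) _
  have h2δα : 0 < (2 * δ) ^ α := Real.rpow_pos_of_pos (by positivity) _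
  set Q := T.toReal + M * (C₂ / (δ / 4) ^ α) with hQ
  have hT0 : 0 ≤ T.toReal := ENNReal.toReal_nonneg
  have hQ0 : 0 ≤ Q := by positivity
  set W := 2 * M + 1 + (2 * δ) ^ α * Q with hW
  have hprod : 0 ≤ (2 * δ) ^ α * Q := by positivity
  have hW0 : 0 < W := by positivity
  refine ⟨δ, hδ, γ * W * ((2 * δ) ^ β)⁻¹, by positivity, fun p hp ρ hρ hρδ => ?_⟩
  rw [mem_ball] at hp
  have hpz : ball p (2 * δ) ⊆ ball z (4 * δ) := ball_subset_ball' (by linarith)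
  have hpz' : ball p (7 / 8 * (2 * δ)) ⊆ ball z (7 / 8 * (4 * δ)) := ball_subset_ball' (by linarith)
  have hub : ∀ᵐ x, x ∈ ball p (2 * δ) → |u x| ≤ W / 2 := by
    filter_upwards [hMu] with x hx hxp
    linarith [hx (hpz hxp)]
  have htail : ∀ᵐ x, x ∈ ball p (7 / 8 * (2 * δ)) →
      ∫⁻ y in (ball p (2 * δ))ᶜ, ENNReal.ofReal |u y| ∂(μ x) ≤
        ENNReal.ofReal (W / (2 * δ) ^ α) := by
    -- Splitting `|u| ≤ (|u| - M)₊ + M`: the first part vanishes on `B_(4δ)(z)`, so the tail at `z`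
    -- controls it around every nearby `p`, and the constant is handled by the decay bound.
    have hg : ∀ᵐ x, x ∈ ball z (4 * δ) → ENNReal.ofReal (|u x| - M) = 0 := by
      filter_upwards [hMu] with x hx hxb
      exact ENNReal.ofReal_of_nonpos (by linarith [hx hxb])
    filter_upwards [hTae, ae_setLIntegral_le_compl_ball hs hg] with x hx hx' hxp
    calc ∫⁻ y in (ball p (2 * δ))ᶜ, ENNReal.ofReal |u y| ∂(μ x)
        ≤ ∫⁻ y in (ball p (2 * δ))ᶜ, (ENNReal.ofReal (|u y| - M) + ENNReal.ofReal M) ∂(μ x) := by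
          refine lintegral_mono fun y => ?_
          refine le_trans (le_of_eq ?_) ENNReal.ofReal_add_le
          rw [sub_add_cancel]
      _ = ∫⁻ y in (ball p (2 * δ))ᶜ, ENNReal.ofReal (|u y| - M) ∂(μ x) +
            ENNReal.ofReal M * μ x (ball p (2 * δ))ᶜ := by
          rw [lintegral_add_right _ measurable_const, setLIntegral_const]
      _ ≤ T + ENNReal.ofReal M * ENNReal.ofReal (C₂ / (δ / 4) ^ α) := by
          refine add_le_add ((hx' _).trans ?_) (mul_le_mul_right ?_ _)
          · refine (lintegral_mono fun y => ENNReal.ofReal_le_ofReal ?_).trans (hx (hpz' hxp))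
            linarith
          · exact compl_ball_measure_le hd (by positivity) hxp (by linarith)
      _ = ENNReal.ofReal Q := by
          rw [hQ, ENNReal.ofReal_add hT0 (by positivity), ENNReal.ofReal_mul hM0,
            ENNReal.ofReal_toReal hTfin.ne]
      _ ≤ ENNReal.ofReal (W / (2 * δ) ^ α) := by
          refine ENNReal.ofReal_le_ofReal ?_
          rw [le_div_iff₀ h2δα]
          linarith
  obtain ⟨m, hm⟩ := hdecay p ρ (2 * δ) W hρ hρδ
    (hpz.trans (ball_subset_closedBall.trans hcE)) hW0 hub htail
  refine ⟨m, hm.mono fun x hx hxρ => ⟨(hx hxρ).1, (hx hxρ).2.trans (le_of_eq ?_)⟩⟩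
  rw [Real.div_rpow hρ.le (by positivity)]
  ring

/-- Decay of oscillation in terms of `omega`. -/
theorem essOsc_le_of_decay {γ β : ℝ} (hγ : 1 < γ)
    (hdecay : ∀ (x₀ : Space N) (ρ R W : ℝ), 0 < ρ → ρ < R → ball x₀ R ⊆ E → 0 < W →
      (∀ᵐ x, x ∈ ball x₀ R → |u x| ≤ W / 2) →
      (∀ᵐ x, x ∈ ball x₀ (7 / 8 * R) →
        ∫⁻ y in (ball x₀ R)ᶜ, ENNReal.ofReal |u y| ∂(μ x) ≤ ENNReal.ofReal (W / R ^ α)) →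
      ∃ m : ℝ, ∀ᵐ x, x ∈ ball x₀ ρ → m ≤ u x ∧ u x ≤ m + γ * W * (ρ / R) ^ β)
    {ρ R : ℝ} (hρ : 0 < ρ) (hρR : ρ < R) (hball : ball x₀ R ⊆ E) :
    essOsc u (ball x₀ ρ) ≤ ((ENNReal.ofReal γ * omega μ α u x₀ R *
      ENNReal.ofReal ((ρ / R) ^ β) : ℝ≥0∞) : EReal) := by
  have hR : 0 < R := hρ.trans hρR
  have hRα : 0 < R ^ α := Real.rpow_pos_of_pos hR _
  have hρRβ : 0 < (ρ / R) ^ β := Real.rpow_pos_of_pos (by positivity) _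
  have hγ0 : 0 < γ := by linarith
  by_cases htop : omega μ α u x₀ R = ∞
  · rw [htop, ENNReal.mul_top (ENNReal.ofReal_pos.2 hγ0).ne',
      ENNReal.top_mul (ENNReal.ofReal_pos.2 hρRβ).ne', EReal.coe_ennreal_top]
    exact le_top
  set W := (omega μ α u x₀ R).toReal with hW
  have hW0 : 0 ≤ W := ENNReal.toReal_nonneg
  have hWω : omega μ α u x₀ R = ENNReal.ofReal W := (ENNReal.ofReal_toReal htop).symm
  have hub : ∀ᵐ x, x ∈ ball x₀ R → |u x| ≤ W / 2 := by
    have h1 : essSup (fun x => ENNReal.ofReal |u x|) (volume.restrict (ball x₀ R)) ≤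
        ENNReal.ofReal (W / 2) := by
      have h2 : 2 * essSup (fun x => ENNReal.ofReal |u x|) (volume.restrict (ball x₀ R)) ≤
          ENNReal.ofReal W := by
        rw [← hWω]; exact le_self_add
      rw [ENNReal.ofReal_div_of_pos two_pos, ENNReal.ofReal_ofNat,
        ENNReal.le_div_iff_mul_le (by simp) (by simp), mul_comm]
      exact h2
    filter_upwards [ae_le_of_essSup_le measurableSet_ball h1] with x hx hxR
    exact (ENNReal.ofReal_le_ofReal_iff (by positivity)).1 (hx hxR)
  have htail : ∀ᵐ x, x ∈ ball x₀ (7 / 8 * R) →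
      ∫⁻ y in (ball x₀ R)ᶜ, ENNReal.ofReal |u y| ∂(μ x) ≤ ENNReal.ofReal (W / R ^ α) := by
    refine ae_le_of_essSup_le measurableSet_ball ?_
    rw [ENNReal.ofReal_div_of_pos hRα, ENNReal.le_div_iff_mul_le
      (Or.inl (ENNReal.ofReal_pos.2 hRα).ne') (Or.inl ENNReal.ofReal_ne_top), mul_comm, ← hWω]
    exact le_add_self
  have key : ∃ m : ℝ, ∀ᵐ x, x ∈ ball x₀ ρ → m ≤ u x ∧ u x ≤ m + γ * W * (ρ / R) ^ β := by
    -- The decay estimate requires `W > 0`; for `W = 0` the function vanishes almost everywhere on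
    -- the ball.
    rcases hW0.eq_or_lt with h0 | h0
    · refine ⟨0, hub.mono fun x hx hxρ => ?_⟩
      have h1 := hx (ball_subset_ball hρR.le hxρ)
      rw [← h0, zero_div, abs_nonpos_iff] at h1
      simp [h1, ← h0]
    · exact hdecay x₀ ρ R W hρ hρR hball h0 hub htail
  obtain ⟨m, hm⟩ := key
  refine (essOsc_le measurableSet_ball hm).trans (le_of_eq ?_)
  rw [hWω, ← ENNReal.ofReal_mul hγ0.le, ← ENNReal.ofReal_mul (by positivity),
    EReal.coe_ennreal_ofReal, max_eq_left (by positivity)]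

end NonlocalHolder

theorem theorem1p1 (N : ℕ) (hN : 2 ≤ N) (α C₁ C₂ : ℝ) (hα0 : 0 < α) (hα2 : α < 2)
    (hC₁ : 1 ≤ C₁) (hC₂ : 1 ≤ C₂) :
    ∃ (γ : ℝ) (αs : ℝ≥0), 1 < γ ∧ 0 < αs ∧ αs < 1 ∧
      ∀ E : Set (EuclideanSpace ℝ (Fin N)), IsOpen E → IsConnected E → Bornology.IsBounded E →
      ∀ μ : EuclideanSpace ℝ (Fin N) → Measure (EuclideanSpace ℝ (Fin N)),
        NonlocalHolder.IsSymmetricFamily μ →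
        NonlocalHolder.PoincareInequality μ E α C₁ →
        NonlocalHolder.DecayBound μ α C₂ →
      ∀ u : EuclideanSpace ℝ (Fin N) → ℝ,
        NonlocalHolder.IsLocalWeakSolution μ E u →
        NonlocalHolder.IsLocallyBounded E u →
        (∃ v : EuclideanSpace ℝ (Fin N) → ℝ,
          (∀ᵐ x ∂(volume.restrict E), v x = u x) ∧
          ∀ K : Set (EuclideanSpace ℝ (Fin N)), IsCompact K → K ⊆ E →
            ∃ C : ℝ≥0, HolderOnWith C αs v K) ∧
        ∀ (x₀ : EuclideanSpace ℝ (Fin N)) (ρ R : ℝ), 0 < ρ → ρ < R → ball x₀ R ⊆ E →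
          NonlocalHolder.essOsc u (ball x₀ ρ) ≤
            ((ENNReal.ofReal γ * NonlocalHolder.omega μ α u x₀ R *
              ENNReal.ofReal ((ρ / R) ^ (αs : ℝ)) : ℝ≥0∞) : EReal) := by
  obtain ⟨γ, β, hγ, hβ0, hβ1, hdecay⟩ := NonlocalHolder.exists_osc_decay N hα0 hα2 hC₁ hC₂
  refine ⟨γ, ⟨β, hβ0.le⟩, hγ, hβ0, hβ1, ?_⟩
  intro E hE _ hEb μ hs hP hd u hu hb
  have hdec := fun x₀ ρ R W => hdecay μ E u x₀ ρ R W hs hd hP hEb hu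
  exact ⟨NonlocalHolder.exists_holder_representative hE hβ0 hβ1 fun z hz =>
      NonlocalHolder.exists_local_osc_decay hγ hdec hE hs hd hC₂ hu hb hz,
    fun x₀ ρ R hρ hρR hball => NonlocalHolder.essOsc_le_of_decay hγ hdec hρ hρR hball⟩
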